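/- **Conventions.** Algorithms are programs for a randomized real RAM: at unit cost they perform $+,-$ on natural numbers (used as counters and addresses), $+,-,\times,/,\sqrt{\cdot}$ and comparisons on real numbers, memory accesses and assignments, and they may draw an independent standard Gaussian number; there is no rounding operation, and the only constants are natural numbers. For $v\in\mathbb{R}^n$ let $\operatorname{supp}(v)=\{i: v_i\ne 0\}$; $v$ is $k$-sparse if $|\operatorname{supp}(v)|\le k$. A matrix $X\in\mathbb{R}^{m\times n}$ satisfies the $(\zeta,\epsilon)$-restricted eigenvalue condition for $S\subseteq[n]$ if each of its columns has Euclidean norm at most $\sqrt m$ and $\|X\Delta\|_2^2\ge \zeta\, m\,\|\Delta\|_2^2$ for all $\Delta\in\mathbb{R}^n$ with $\|\Delta_{[n]\setminus S}\|_1\le(1+\epsilon)\|\Delta_S\|_1$. For an invertible $B\in\mathbb{R}^{d\times d}$ let $\kappa(B)=\sigma_{\max}(B)/\sigma_{\min}(B)$ and $\lambda_{1,\mathrm{bin}}(B)=\min\{\|Bz-Bz'\|_2: z\ne z'\in\{-1,1\}^d\}$. The problem $\mathsf{BinaryBDD}_{d,\alpha}$ is: given $(B,\ t=Bz+e)$ with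 $z\in\{-1,1\}^d$ and $\|e\|_2\le\alpha\,\lambda_{1,\mathrm{bin}}(B)$, output $z$. **Theorem.** There are universal constants $c_0\in\mathbb{N}$ and $c>0$, and for every $K>0$ there is a constant $C>0$ (depending only on $K$), such that the following holds. Let $\beta\in(0,2]$, and let $P$ be any set of triples $(d,k,m)$ of natural numbers with $d\ge1$, $k\mid d$ and $m\ge c_0 d$; write $n=k\cdot 2^{d/k}$. Suppose there is an algorithm that, for all $(d,k,m)\in P$, given $m,n,k$ and any $(\widetilde X,\widetilde y)\in\mathbb{R}^{m\times n}\times\mathbb{R}^m$, halts in time $\mathrm{poly}(m,n)$, and that whenever $\widetilde y=\widetilde X\theta^*+\widetilde w$ for some nonzero $k$-sparse $\theta^*\in\mathbb{R}^n$ such that $\widetilde X$ satisfies the $(\zeta,\epsilon)$-restricted eigenvalue condition for $\operatorname{supp}(\theta^*)$, where $\zeta>0$ and $\epsilon\in(0,2]$, outputs (with certainty) a $k$-sparse vector $\widehat\theta$ with $$\frac1m\|\widetilde X\widehat\theta-\widetilde X\theta^*\|_2^2\le K\cdot\frac{\|\widetilde w\|_2^2\,k^2}{\zeta^{2-\beta}\,\epsilon^2\,m}.$$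 Then there is a randomized algorithm that, for all $(d,k,m)\in P$, given $d,k,m$ and any $(B,t)\in\mathbb{R}^{d\times d}\times\mathbb{R}^d$, halts in time $\mathrm{poly}(m,\ k\cdot2^{d/k})$, and that solves every $\mathsf{BinaryBDD}_{d,\alpha}$ instance $(B,t)$ with $B$ invertible and $$\alpha\le C\cdot\frac{k^{1-\beta/2}}{d^{5-2\beta}\,\kappa(B)^{2-\beta}}$$ with probability at least $1-e^{-cm}$. -/

import Mathlib

open MeasureTheory ProbabilityTheory

/-! ## The machine model: a randomized real RAM

Programs work on arrays of natural numbers (used for counting and for addresses) and on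
two-dimensional arrays of real numbers, all initially zero outside the input.  One step is one
basic operation: a constant, a memory access, `+` or `-` on natural numbers, an arithmetic operation
or a square root on reals, a comparison, an assignment, or the drawing of one standard Gaussian
number.  There is no rounding operation, no conversion from reals to naturals, and the only
constants are natural numbers. -/

namespace RealRAM

/-- The memory: `nat a i` is cell `i` of the array of naturals named `a`, `real a i j` is
cell `(i, j)` of the array of reals named `a`, and `tape` is the stream of Gaussian numbers that
have not been drawn yet. -/
@[ext] structure State where
  nat : ℕ → ℕ → ℕ
  real : ℕ → ℕ → ℕ → ℝ
  tape : ℕ → ℝ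

/-- Expressions with values in `ℕ`; `sub` is truncated. -/
inductive NExpr where
  | const (c : ℕ)
  | get (a : ℕ) (i : NExpr)
  | add (e f : NExpr)
  | sub (e f : NExpr)

namespace NExpr

def eval (s : State) : NExpr → ℕ
  | const c => c
  | get a i => s.nat a (i.eval s)
  | add e f => e.eval s + f.eval s
  | sub e f => e.eval s - f.eval s

/-- The number of operations that are used to evaluate an expression. -/
def cost : NExpr → ℕ
  | const _ => 1
  | get _ i => i.cost + 1
  | add e f => e.cost + f.cost + 1
  | sub e f => e.cost + f.cost + 1

end NExpr

/-- Expressions with values in `ℝ`; dividing by `0` and taking the root of a negative number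
return `0`. -/
inductive RExpr where
  | ofNat (e : NExpr)
  | get (a : ℕ) (i j : NExpr)
  | add (e f : RExpr)
  | sub (e f : RExpr)
  | mul (e f : RExpr)
  | div (e f : RExpr)
  | sqrt (e : RExpr)

namespace RExpr

noncomputable def eval (s : State) : RExpr → ℝ
  | ofNat e => (e.eval s : ℝ)
  | get a i j => s.real a (i.eval s) (j.eval s)
  | add e f => e.eval s + f.eval s
  | sub e f => e.eval s - f.eval s
  | mul e f => e.eval s * f.eval s
  | div e f => e.eval s / f.eval s
  | sqrt e => Real.sqrt (e.eval s)

/-- The number of operations that are used to evaluate an expression. -/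
def cost : RExpr → ℕ
  | ofNat e => e.cost + 1
  | get _ i j => i.cost + j.cost + 1
  | add e f => e.cost + f.cost + 1
  | sub e f => e.cost + f.cost + 1
  | mul e f => e.cost + f.cost + 1
  | div e f => e.cost + f.cost + 1
  | sqrt e => e.cost + 1

end RExpr

/-- Comparisons. -/
inductive Test where
  | natLt (e f : NExpr)
  | realLt (e f : RExpr)

namespace Test

def Holds (s : State) : Test → Prop
  | natLt e f => e.eval s < f.eval s
  | realLt e f => e.eval s < f.eval s

def cost : Test → ℕ
  | natLt e f => e.cost + f.cost + 1
  | realLt e f => e.cost + f.cost + 1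

end Test

namespace State

/-- Write `v` into cell `i` of the array of naturals `a`. -/
def setNat (s : State) (a i v : ℕ) : State :=
  { s with nat := fun a' i' => if a' = a ∧ i' = i then v else s.nat a' i' }

/-- Write `v` into cell `(i, j)` of the array of reals `a`. -/
noncomputable def setReal (s : State) (a i j : ℕ) (v : ℝ) : State :=
  { s with real := fun a' i' j' => if a' = a ∧ i' = i ∧ j' = j then v else s.real a' i' j' }

/-- Remove the first number from the tape. -/
def advance (s : State) : State :=
  { s with tape := fun i => s.tape (i + 1) }

end State

/-- Programs. -/
inductive Prog where
  | skip
  | assignNat (a : ℕ) (i e : NExpr)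
  | assignReal (a : ℕ) (i j : NExpr) (e : RExpr)
  | sample (a : ℕ) (i j : NExpr)
  | seq (p q : Prog)
  | ite (b : Test) (p q : Prog)
  | loop (b : Test) (p : Prog)

/-- `Exec p s t s'`: started in the memory `s`, the program `p` halts after exactly `t` steps with
the memory `s'`.  The program `loop b p` is "while `b` do `p`". -/
inductive Exec : Prog → State → ℕ → State → Prop where
  | skip (s : State) : Exec .skip s 1 s
  | assignNat (s : State) (a : ℕ) (i e : NExpr) :
      Exec (.assignNat a i e) s (i.cost + e.cost + 1) (s.setNat a (i.eval s) (e.eval s))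
  | assignReal (s : State) (a : ℕ) (i j : NExpr) (e : RExpr) :
      Exec (.assignReal a i j e) s (i.cost + j.cost + e.cost + 1)
        (s.setReal a (i.eval s) (j.eval s) (e.eval s))
  | sample (s : State) (a : ℕ) (i j : NExpr) :
      Exec (.sample a i j) s (i.cost + j.cost + 1)
        ((s.setReal a (i.eval s) (j.eval s) (s.tape 0)).advance)
  | seq {p q : Prog} {s s₁ s₂ : State} {t₁ t₂ : ℕ} (h₁ : Exec p s t₁ s₁) (h₂ : Exec q s₁ t₂ s₂) :
      Exec (.seq p q) s (t₁ + t₂) s₂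
  | iteTrue {b : Test} {p q : Prog} {s s₁ : State} {t : ℕ} (hb : b.Holds s) (h : Exec p s t s₁) :
      Exec (.ite b p q) s (b.cost + t) s₁
  | iteFalse {b : Test} {p q : Prog} {s s₁ : State} {t : ℕ} (hb : ¬ b.Holds s)
      (h : Exec q s t s₁) :
      Exec (.ite b p q) s (b.cost + t) s₁
  | loopTrue {b : Test} {p : Prog} {s s₁ s₂ : State} {t₁ t₂ : ℕ} (hb : b.Holds s)
      (h₁ : Exec p s t₁ s₁) (h₂ : Exec (.loop b p) s₁ t₂ s₂) :
      Exec (.loop b p) s (b.cost + t₁ + t₂) s₂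
  | loopFalse {b : Test} {p : Prog} {s : State} (hb : ¬ b.Holds s) :
      Exec (.loop b p) s b.cost s

/-- For a given memory (and hence a given tape), the running time and the result are unique. -/
theorem Exec.unique {p : Prog} {s s₁ s₂ : State} {t₁ t₂ : ℕ}
    (h₁ : Exec p s t₁ s₁) (h₂ : Exec p s t₂ s₂) : t₁ = t₂ ∧ s₁ = s₂ := by
  induction h₁ generalizing t₂ s₂ with
  | skip => cases h₂; exact ⟨rfl, rfl⟩
  | assignNat => cases h₂; exact ⟨rfl, rfl⟩
  | assignReal => cases h₂; exact ⟨rfl, rfl⟩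
  | sample => cases h₂; exact ⟨rfl, rfl⟩
  | seq _ _ ih₁ ih₂ =>
    cases h₂ with
    | seq g₁ g₂ =>
      obtain ⟨rfl, rfl⟩ := ih₁ g₁
      obtain ⟨rfl, rfl⟩ := ih₂ g₂
      exact ⟨rfl, rfl⟩
  | iteTrue hb _ ih =>
    cases h₂ with
    | iteTrue _ g => obtain ⟨rfl, rfl⟩ := ih g; exact ⟨rfl, rfl⟩
    | iteFalse hb' _ => exact absurd hb hb'
  | iteFalse hb _ ih =>
    cases h₂ with
    | iteTrue hb' _ => exact absurd hb' hb
    | iteFalse _ g => obtain ⟨rfl, rfl⟩ := ih g; exact ⟨rfl, rfl⟩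
  | loopTrue hb _ _ ih₁ ih₂ =>
    cases h₂ with
    | loopTrue _ g₁ g₂ =>
      obtain ⟨rfl, rfl⟩ := ih₁ g₁
      obtain ⟨rfl, rfl⟩ := ih₂ g₂
      exact ⟨rfl, rfl⟩
    | loopFalse hb' => exact absurd hb hb'
  | loopFalse hb =>
    cases h₂ with
    | loopTrue hb' _ _ => exact absurd hb' hb
    | loopFalse _ => exact ⟨rfl, rfl⟩

/-- The law of the tape: independent standard Gaussian numbers. -/
noncomputable def gaussianTape : Measure (ℕ → ℝ) :=
  Measure.infinitePi fun _ : ℕ => gaussianReal 0 1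

/-- The initial memory on an input that consists of three natural numbers, a matrix and a vector:
the numbers are in cells `0, 1, 2` of the array of naturals `0`, the matrix is in the array of
reals `0`, and the vector is in column `0` of the array of reals `1`. -/
noncomputable def inputState {r c l : ℕ} (a₀ a₁ a₂ : ℕ) (M : Matrix (Fin r) (Fin c) ℝ)
    (v : Fin l → ℝ) (ω : ℕ → ℝ) : State where
  nat := fun a i =>
    if a = 0 ∧ i = 0 then a₀ else if a = 0 ∧ i = 1 then a₁ else if a = 0 ∧ i = 2 then a₂ else 0
  real := fun a i j =>
    if a = 0 then (if h : i < r ∧ j < c then M ⟨i, h.1⟩ ⟨j, h.2⟩ else 0)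
    else if a = 1 ∧ j = 0 then (if h : i < l then v ⟨i, h⟩ else 0)
    else 0
  tape := ω

/-- The output vector of length `l`: column `0` of the array of reals `2`. -/
def State.output (s : State) (l : ℕ) : Fin l → ℝ := fun i => s.real 2 i 0

end RealRAM

/-! ## Sparse linear regression -/

namespace SLR

/-- The Euclidean norm. -/
noncomputable def norm2 {n : ℕ} (v : Fin n → ℝ) : ℝ := ‖WithLp.toLp 2 v‖

open Classical in
/-- The support of a vector. -/
noncomputable def supp {n : ℕ} (θ : Fin n → ℝ) : Finset (Fin n) :=
  Finset.univ.filter fun i => θ i ≠ 0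

/-- At most `k` entries are nonzero. -/
def IsSparse {n : ℕ} (k : ℕ) (θ : Fin n → ℝ) : Prop := (supp θ).card ≤ k

def ColumnNormalized {m n : ℕ} (X : Matrix (Fin m) (Fin n) ℝ) : Prop :=
  ∀ j, norm2 (fun i => X i j) ≤ Real.sqrt m

/-- The `ε`-cone of `S`. -/
def cone {n : ℕ} (ε : ℝ) (S : Finset (Fin n)) : Set (Fin n → ℝ) :=
  {Δ | ∑ i ∈ Sᶜ, |Δ i| ≤ (1 + ε) * ∑ i ∈ S, |Δ i|}

/-- The `(ζ, ε)`-restricted eigenvalue condition for `S`, which includes column normalization. -/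
def RestrictedEigenvalue {m n : ℕ} (ζ ε : ℝ) (X : Matrix (Fin m) (Fin n) ℝ)
    (S : Finset (Fin n)) : Prop :=
  ColumnNormalized X ∧
    ∀ θ ∈ cone ε S, θ ≠ 0 → ζ ≤ norm2 (X.mulVec θ) ^ 2 / (m * norm2 θ ^ 2)

/-- The initial memory on an instance `(X, y)` of sparse linear regression with `m` samples in
dimension `n` and sparsity `k`; the numbers `m, n, k` are part of the input. -/
noncomputable def input {m n : ℕ} (k : ℕ) (X : Matrix (Fin m) (Fin n) ℝ) (y : Fin m → ℝ)
    (ω : ℕ → ℝ) : RealRAM.State :=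
  RealRAM.inputState m n k X y ω

/-- `A` always halts, in time polynomial in `m` and `n = k * 2 ^ (d / k)`, for all parameters
`(d, k, m)` in `P`. -/
def PolyTime (P : ℕ → ℕ → ℕ → Prop) (A : RealRAM.Prog) : Prop :=
  ∃ q : Polynomial ℕ, ∀ d k m : ℕ, P d k m →
    ∀ (X : Matrix (Fin m) (Fin (k * 2 ^ (d / k))) ℝ) (y : Fin m → ℝ) (ω : ℕ → ℝ),
      ∃ t s, RealRAM.Exec A (input k X y ω) t s ∧ t ≤ q.eval (m + k * 2 ^ (d / k))

/-- For all parameters `(d, k, m)` in `P`, with `n = k * 2 ^ (d / k)`: on every instance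
`y = X θ + w` with a nonzero `k`-sparse `θ` such that `X` satisfies the `(ζ, ε)`-restricted
eigenvalue condition for the support of `θ`, and whatever is on the tape, `A` outputs a `k`-sparse
vector with prediction error at most `K ‖w‖² k² / (ζ ^ (2 - β) ε² m)`. -/
def AchievesError (P : ℕ → ℕ → ℕ → Prop) (K β : ℝ) (A : RealRAM.Prog) : Prop :=
  ∀ d k m : ℕ, P d k m →
    ∀ (X : Matrix (Fin m) (Fin (k * 2 ^ (d / k))) ℝ) (θ : Fin (k * 2 ^ (d / k)) → ℝ)
      (w : Fin m → ℝ) (ζ ε : ℝ), 0 < ζ → 0 < ε → ε ≤ 2 →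
      θ ≠ 0 → IsSparse k θ → RestrictedEigenvalue ζ ε X (supp θ) →
      ∀ (ω : ℕ → ℝ) (t : ℕ) (s : RealRAM.State),
        RealRAM.Exec A (input k X (X.mulVec θ + w) ω) t s →
          IsSparse k (s.output (k * 2 ^ (d / k))) ∧
          1 / (m : ℝ) * norm2 (X.mulVec (s.output (k * 2 ^ (d / k))) - X.mulVec θ) ^ 2 ≤
            K * (norm2 w ^ 2 * (k : ℝ) ^ 2 / (ζ ^ (2 - β) * ε ^ 2 * m))

end SLR

/-! ## Binary bounded distance decoding -/

namespace BinaryBDD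

/-- The vectors in `{-1, 1}^d`. -/
def signVectors (d : ℕ) : Set (Fin d → ℝ) := {z | ∀ i, z i = -1 ∨ z i = 1}

/-- The binary minimum distance `λ_{1,bin}(B)`: the least distance between `B z` and `B z'` for
distinct `z, z'` in `{-1, 1}^d`. -/
noncomputable def binaryMinDist {d : ℕ} (B : Matrix (Fin d) (Fin d) ℝ) : ℝ :=
  sInf {r | ∃ z ∈ signVectors d, ∃ z' ∈ signVectors d, z ≠ z' ∧
    r = SLR.norm2 (B.mulVec z - B.mulVec z')}

/-- The condition number: the largest singular value divided by the smallest one. -/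
noncomputable def condNumber {d : ℕ} (B : Matrix (Fin d) (Fin d) ℝ) : ℝ :=
  (Matrix.toEuclideanLin B).singularValues 0 / (Matrix.toEuclideanLin B).singularValues (d - 1)

/-- The initial memory on an instance `(B, t)` of binary bounded distance decoding; the dimension
`d` and the parameters `k, m` are part of the input, `α` is not. -/
noncomputable def input {d : ℕ} (k m : ℕ) (B : Matrix (Fin d) (Fin d) ℝ) (t : Fin d → ℝ)
    (ω : ℕ → ℝ) : RealRAM.State :=
  RealRAM.inputState d k m B t ω

/-- `D` always halts, in time polynomial in `m` and `k * 2 ^ (d / k)`, for all parameters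
`(d, k, m)` in `P`. -/
def PolyTime (P : ℕ → ℕ → ℕ → Prop) (D : RealRAM.Prog) : Prop :=
  ∃ q : Polynomial ℕ, ∀ d k m : ℕ, P d k m →
    ∀ (B : Matrix (Fin d) (Fin d) ℝ) (t : Fin d → ℝ) (ω : ℕ → ℝ),
      ∃ τ s, RealRAM.Exec D (input k m B t ω) τ s ∧ τ ≤ q.eval (m + k * 2 ^ (d / k))

/-- The event that `D`, with parameters `k, m` and on the instance `(B, t)`, does not return `z`. -/
def failure {d : ℕ} (D : RealRAM.Prog) (k m : ℕ) (B : Matrix (Fin d) (Fin d) ℝ)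
    (t z : Fin d → ℝ) : Set (ℕ → ℝ) :=
  {ω | ¬ ∃ τ s, RealRAM.Exec D (input k m B t ω) τ s ∧ s.output d = z}

/-- `D` solves the instances `(B, t = B z + e)` of binary bounded distance decoding in dimension `d`
with parameter `α`, for the given basis `B`, except with probability `p`. -/
def SolvesFor {d : ℕ} (D : RealRAM.Prog) (k m : ℕ) (B : Matrix (Fin d) (Fin d) ℝ)
    (α p : ℝ) : Prop :=
  ∀ z ∈ signVectors d, ∀ e : Fin d → ℝ, SLR.norm2 e ≤ α * binaryMinDist B →
    RealRAM.gaussianTape (failure D k m B (B.mulVec z + e) z) ≤ ENNReal.ofReal p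

end BinaryBDD

namespace SLR

/-! ## Euclidean norms -/

/-! Put `D = d / k` and let `G` be the `gadget` matrix: block diagonal with `k` blocks, each listing
all `2 ^ D` sign vectors of length `D` as columns. Choosing one column per block (`selector`) gives
a `k`-sparse `θ`, and every `z ∈ {-1,1}^d` equals `G θ` for such a choice. The design `X` stacks `s
• B G`, with `s = √m / (2 √d ‖B‖_F)`, on `W • S`, where `W = √m / 2` and `S` takes block sums; the
response stacks `s • t` on the constant `W`. Thus `y = X θ + w` with `w = (s e, 0)`. Nothing here is
random, so decoding succeeds for every tape.

Restricted eigenvalues: in one block, let `c` be the selected column and give column `c_j` the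
weight `1 - ⟨c_j, c⟩ / D`, which is `0` at `c` and lies in `[2/D, 2]` elsewhere. If `S Δ` and `G Δ`
vanish on the block, both the sum and the weighted sum of the entries are zero, and combining the
two shows that the unselected entries have `ℓ₁` norm at least `1 + 2/D` times the selected one. The
cone with `ε = 1/D` allows only `1 + 1/D`, so `Δ = 0`. The quantitative forms are `block_bound` and
`norm2_le_of_mem_cone`; inserting the singular values of `B` yields `ζ = 1 / (900 d³ κ²)` in
`restrictedEigenvalue_design`.

Decoding: a prediction error `‖X (θ' - θ)‖ ≤ s λ / 8` keeps all block sums of `θ'` near `1`.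
Sparsity then leaves exactly one nonzero entry per block, so `G θ'` is a sign vector `z'` scaled
blockwise by positive factors. Both `B z` and `B z'` are within `λ / 8` of `B G θ'`, whence `z' =
z`, and the signs of `G θ'` are the answer (`sign_gadget_mulVec_eq`). As `k / ε = k D = d`, the
requirement on the noise is `√K d α ≤ ζ^(1-β/2) / 8`, which is `noise_factor_le`.

On the machine, all tables are computed by counted loops. The regression program runs on the arrays
named below `N`, and the reduction keeps its own data from `N` on, where `Exec.frame` protects it;
`reduction_runs` assembles the pieces. -/

theorem norm2_nonneg {n : ℕ} (v : Fin n → ℝ) : 0 ≤ norm2 v := norm_nonneg _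

theorem norm2_sq {n : ℕ} (v : Fin n → ℝ) : norm2 v ^ 2 = ∑ i, v i ^ 2 := by
  simp [norm2, EuclideanSpace.norm_sq_eq]

theorem norm2_sub_le {n : ℕ} (v w : Fin n → ℝ) : norm2 (v - w) ≤ norm2 v + norm2 w :=
  norm_sub_le (WithLp.toLp 2 v) (WithLp.toLp 2 w)

theorem norm2_smul {n : ℕ} (a : ℝ) (v : Fin n → ℝ) : norm2 (a • v) = |a| * norm2 v :=
  norm_smul a (WithLp.toLp 2 v)

theorem norm2_pos {n : ℕ} {v : Fin n → ℝ} (hv : v ≠ 0) : 0 < norm2 v := by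
  simpa [norm2] using hv

theorem abs_le_norm2 {n : ℕ} (v : Fin n → ℝ) (i : Fin n) : |v i| ≤ norm2 v := by
  refine abs_le_of_sq_le_sq ?_ (norm2_nonneg v)
  rw [norm2_sq]
  exact Finset.single_le_sum (f := fun i => v i ^ 2) (fun i _ => sq_nonneg (v i))
    (Finset.mem_univ i)

theorem norm2_le_sum_abs {n : ℕ} (v : Fin n → ℝ) : norm2 v ≤ ∑ i, |v i| := by
  refine le_of_sq_le_sq ?_ (Finset.sum_nonneg fun i _ => abs_nonneg _)
  rw [norm2_sq, ← Finset.sum_congr rfl fun i _ => sq_abs (v i)]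
  exact Finset.sum_sq_le_sq_sum_of_nonneg fun i _ => abs_nonneg _

theorem sum_abs_le_sqrt_mul_norm2 {n : ℕ} (v : Fin n → ℝ) : ∑ i, |v i| ≤ √n * norm2 v := by
  refine le_of_sq_le_sq ?_ (mul_nonneg (Real.sqrt_nonneg _) (norm2_nonneg v))
  rw [mul_pow, Real.sq_sqrt (Nat.cast_nonneg n), norm2_sq]
  simpa [sq_abs] using sq_sum_le_card_mul_sum_sq (s := Finset.univ) (f := fun i => |v i|)

theorem norm2_le_of_abs_le {n : ℕ} {v : Fin n → ℝ} {a : ℝ} (ha : 0 ≤ a) (h : ∀ i, |v i| ≤ a) :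
    norm2 v ≤ √n * a := by
  refine le_of_sq_le_sq ?_ (mul_nonneg (Real.sqrt_nonneg _) ha)
  rw [mul_pow, Real.sq_sqrt (Nat.cast_nonneg n), norm2_sq]
  calc ∑ i, v i ^ 2 ≤ ∑ _i : Fin n, a ^ 2 := Finset.sum_le_sum fun i _ => sq_le_sq.2 (by
        rw [abs_of_nonneg ha]; exact h i)
    _ = n * a ^ 2 := by simp

/-- The Frobenius norm. -/
noncomputable def frobenius {m n : ℕ} (B : Matrix (Fin m) (Fin n) ℝ) : ℝ :=
  √(∑ i, ∑ j, B i j ^ 2)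

theorem frobenius_nonneg {m n : ℕ} (B : Matrix (Fin m) (Fin n) ℝ) : 0 ≤ frobenius B :=
  Real.sqrt_nonneg _

theorem frobenius_sq {m n : ℕ} (B : Matrix (Fin m) (Fin n) ℝ) :
    frobenius B ^ 2 = ∑ i, ∑ j, B i j ^ 2 :=
  Real.sq_sqrt (Finset.sum_nonneg fun _ _ => Finset.sum_nonneg fun _ _ => sq_nonneg _)

theorem norm2_mulVec_le {m n : ℕ} (B : Matrix (Fin m) (Fin n) ℝ) (x : Fin n → ℝ) :
    norm2 (B.mulVec x) ≤ frobenius B * norm2 x := by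
  refine le_of_sq_le_sq ?_ (mul_nonneg (frobenius_nonneg B) (norm2_nonneg x))
  rw [mul_pow, frobenius_sq, norm2_sq, norm2_sq, Finset.sum_mul]
  exact Finset.sum_le_sum fun i _ => by
    simpa only [Matrix.mulVec, dotProduct] using Finset.sum_mul_sq_le_sq_mul_sq Finset.univ (B i) x

end SLR

/-! ## Singular values -/

namespace LinearMap

variable {E : Type*} [NormedAddCommGroup E] [InnerProductSpace ℝ E] [FiniteDimensional ℝ E]

/-- Expand `⟪T* T x, x⟫` in an orthonormal eigenbasis of `T* T`, whose eigenvalues are the squared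
singular values. Compared with Parseval in the same basis, this bounds the stretching by `T` from
above and below. -/
theorem norm_sq_apply_eq_sum_singularValues (T : E →ₗ[ℝ] E) {n : ℕ}
    (hn : Module.finrank ℝ E = n) (x : E) :
    ‖T x‖ ^ 2 = ∑ i : Fin n, T.singularValues i ^ 2 *
      (T.isSymmetric_adjoint_comp_self.eigenvectorBasis hn).repr x i ^ 2 := by
  set b := T.isSymmetric_adjoint_comp_self.eigenvectorBasis hn
  have h1 : ‖T x‖ ^ 2 = inner ℝ ((adjoint T ∘ₗ T) x) x := by
    rw [comp_apply, adjoint_inner_left, real_inner_self_eq_norm_sq]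
  rw [h1, ← b.sum_inner_mul_inner]
  refine Finset.sum_congr rfl fun i _ => ?_
  rw [real_inner_comm, ← b.repr_apply_apply, ← b.repr_apply_apply,
    T.isSymmetric_adjoint_comp_self.eigenvectorBasis_apply_self_apply hn,
    sq_singularValues_fin T hn i]
  simp only [RCLike.ofReal_real_eq_id, id_eq]
  ring

theorem norm_sq_eq_sum_eigenvectorBasis (T : E →ₗ[ℝ] E) {n : ℕ}
    (hn : Module.finrank ℝ E = n) (x : E) :
    ‖x‖ ^ 2 = ∑ i : Fin n,
      (T.isSymmetric_adjoint_comp_self.eigenvectorBasis hn).repr x i ^ 2 := by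
  set b := T.isSymmetric_adjoint_comp_self.eigenvectorBasis hn
  rw [← b.repr.norm_map x, EuclideanSpace.norm_sq_eq]
  simp

theorem norm_apply_le_singularValues_zero (T : E →ₗ[ℝ] E) (x : E) :
    ‖T x‖ ≤ T.singularValues 0 * ‖x‖ := by
  refine le_of_sq_le_sq ?_ (mul_nonneg (T.singularValues_nonneg 0) (norm_nonneg x))
  rw [mul_pow, norm_sq_apply_eq_sum_singularValues T rfl, norm_sq_eq_sum_eigenvectorBasis T rfl,
    Finset.mul_sum]
  refine Finset.sum_le_sum fun i _ => mul_le_mul_of_nonneg_right ?_ (sq_nonneg _)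
  exact pow_le_pow_left₀ (T.singularValues_nonneg _) (T.singularValues_antitone (Nat.zero_le _)) 2

theorem singularValues_last_le_norm_apply (T : E →ₗ[ℝ] E) (x : E) :
    T.singularValues (Module.finrank ℝ E - 1) * ‖x‖ ≤ ‖T x‖ := by
  refine le_of_sq_le_sq ?_ (norm_nonneg _)
  rw [mul_pow, norm_sq_apply_eq_sum_singularValues T rfl, norm_sq_eq_sum_eigenvectorBasis T rfl,
    Finset.mul_sum]
  refine Finset.sum_le_sum fun i _ => mul_le_mul_of_nonneg_right ?_ (sq_nonneg _)
  exact pow_le_pow_left₀ (T.singularValues_nonneg _) (T.singularValues_antitone (by omega)) 2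

end LinearMap

namespace SLR

theorem norm2_mulVec_le_singularValues {d : ℕ} (B : Matrix (Fin d) (Fin d) ℝ) (x : Fin d → ℝ) :
    norm2 (B.mulVec x) ≤ (Matrix.toEuclideanLin B).singularValues 0 * norm2 x :=
  (Matrix.toEuclideanLin B).norm_apply_le_singularValues_zero (WithLp.toLp 2 x)

theorem singularValues_mul_norm2_le {d : ℕ} (B : Matrix (Fin d) (Fin d) ℝ) (x : Fin d → ℝ) :
    (Matrix.toEuclideanLin B).singularValues (d - 1) * norm2 x ≤ norm2 (B.mulVec x) := by
  have h := (Matrix.toEuclideanLin B).singularValues_last_le_norm_apply (WithLp.toLp 2 x)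
  rwa [finrank_euclideanSpace_fin] at h

/-- Each of the `d` columns is the image of a unit vector, so its norm is at most the largest
singular value. The design is normalized by the Frobenius norm because the machine obtains it with
arithmetic and one root; this lemma measures what that costs. -/
theorem frobenius_le_singularValues {d : ℕ} (B : Matrix (Fin d) (Fin d) ℝ) :
    frobenius B ≤ √d * (Matrix.toEuclideanLin B).singularValues 0 := by
  have h0 := (Matrix.toEuclideanLin B).singularValues_nonneg 0
  refine le_of_sq_le_sq ?_ (mul_nonneg (Real.sqrt_nonneg _) h0)
  rw [mul_pow, Real.sq_sqrt (Nat.cast_nonneg d), frobenius_sq, Finset.sum_comm]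
  have key : ∀ j, ∑ i, B i j ^ 2 ≤ (Matrix.toEuclideanLin B).singularValues 0 ^ 2 := by
    intro j
    have h := norm2_mulVec_le_singularValues B (Pi.single j 1)
    have h1 : norm2 (Pi.single j 1 : Fin d → ℝ) = 1 := by
      have := norm2_sq (Pi.single j 1 : Fin d → ℝ)
      simp only [Pi.single_apply, ite_pow, one_pow, ne_eq, OfNat.ofNat_ne_zero, not_false_eq_true,
        zero_pow, Finset.sum_ite_eq', Finset.mem_univ, if_true] at this
      nlinarith [norm2_nonneg (Pi.single j 1 : Fin d → ℝ)]
    rw [h1, mul_one] at h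
    have h2 := pow_le_pow_left₀ (norm2_nonneg _) h 2
    rw [norm2_sq] at h2
    simpa using h2
  calc _ ≤ ∑ _j : Fin d, (Matrix.toEuclideanLin B).singularValues 0 ^ 2 :=
        Finset.sum_le_sum fun j _ => key j
    _ = _ := by simp

theorem singularValues_last_pos {d : ℕ} (hd : 1 ≤ d) {B : Matrix (Fin d) (Fin d) ℝ}
    (hB : B.det ≠ 0) : 0 < (Matrix.toEuclideanLin B).singularValues (d - 1) := by
  have hinj : Function.Injective (Matrix.toEuclideanLin B) := by
    intro x y h
    have h' : B.mulVec x.ofLp = B.mulVec y.ofLp := congrArg WithLp.ofLp h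
    exact WithLp.ofLp_injective 2
      (Matrix.mulVec_injective_of_isUnit ((Matrix.isUnit_iff_isUnit_det B).2 hB.isUnit) h')
  exact (Matrix.toEuclideanLin B).injective_iff_forall_lt_finrank_singularValues_pos.1 hinj
    (d - 1) (by rw [finrank_euclideanSpace_fin]; omega)

/-! ### A weighted `ℓ₁` inequality -/

/-- A lower bound on the `ℓ₁` norm of a vector on the complement of one index, in terms of its value
`a` at that index, when the total sum `a + ∑ Δ` and a weighted sum are almost zero. -/
theorem sum_abs_ge_of_weights {ι : Type*} (T : Finset ι) (Δ w : ι → ℝ) (a δ : ℝ) (hδ : 0 ≤ δ)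
    (hw : ∀ c ∈ T, δ ≤ w c ∧ w c ≤ 2) :
    (1 + δ) * (|a| - |a + ∑ c ∈ T, Δ c|) - |∑ c ∈ T, Δ c * w c| ≤ ∑ c ∈ T, |Δ c| := by
  obtain ⟨σ, hσ, hσa⟩ : ∃ σ : ℝ, |σ| = 1 ∧ σ * a = |a| := by
    rcases le_total 0 a with h | h
    · exact ⟨1, by simp, by simp [abs_of_nonneg h]⟩
    · exact ⟨-1, by simp, by simp [abs_of_nonpos h]⟩
  -- Shifting by `1 + δ` moves the weights from `[δ, 2]` into `[-1, 1 - δ]`, so every coefficient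
  -- has modulus at most one.
  have h1 : ∑ c ∈ T, σ * (w c - (1 + δ)) * Δ c ≤ ∑ c ∈ T, |Δ c| := by
    refine Finset.sum_le_sum fun c hc => (le_abs_self _).trans ?_
    obtain ⟨h2, h3⟩ := hw c hc
    rw [abs_mul, abs_mul, hσ, one_mul]
    exact mul_le_of_le_one_left (abs_nonneg _) (abs_le.2 ⟨by linarith, by linarith⟩)
  have h2 : ∑ c ∈ T, σ * (w c - (1 + δ)) * Δ c
      = σ * ∑ c ∈ T, Δ c * w c - (1 + δ) * (σ * (a + ∑ c ∈ T, Δ c)) + (1 + δ) * |a| := by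
    rw [← hσa, mul_add, Finset.mul_sum, Finset.mul_sum, mul_add, Finset.mul_sum]
    have : ∀ x y z : ℝ, x - (y + z) + y = x - z := fun x y z => by ring
    rw [this, ← Finset.sum_sub_distrib]
    exact Finset.sum_congr rfl fun c _ => by ring
  have h3 : -|∑ c ∈ T, Δ c * w c| ≤ σ * ∑ c ∈ T, Δ c * w c := by
    have := neg_abs_le (σ * ∑ c ∈ T, Δ c * w c)
    rwa [abs_mul, hσ, one_mul] at this
  have h4 : σ * (a + ∑ c ∈ T, Δ c) ≤ |a + ∑ c ∈ T, Δ c| := by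
    have := le_abs_self (σ * (a + ∑ c ∈ T, Δ c))
    rwa [abs_mul, hσ, one_mul] at this
  nlinarith

end SLR

namespace SLR

/-! ## The gadget matrix -/

/-- The `i`-th binary digit of `j`, as a sign. -/
noncomputable def bitSign (i j : ℕ) : ℝ := 2 * ((j / 2 ^ i % 2 : ℕ) : ℝ) - 1

theorem bitSign_eq (i j : ℕ) : bitSign i j = if j.testBit i then 1 else -1 := by
  rw [Nat.testBit_eq_decide_div_mod_eq, bitSign]
  rcases Nat.mod_two_eq_zero_or_one (j / 2 ^ i) with h | h <;> rw [h] <;> norm_num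

/-- Natural-number expressions of the machine have no multiplication, so the doubling is an
addition, as in `signRow`. -/
theorem bitSign_zero (j : ℕ) : bitSign 0 j = ((j % 2 + j % 2 : ℕ) : ℝ) - 1 := by
  simp only [bitSign, pow_zero, Nat.div_one]
  push_cast
  ring

/-- This recurrence lets the machine build the table of sign vectors row by row, using only halved
indices. -/
theorem bitSign_succ (i j : ℕ) : bitSign (i + 1) j = bitSign i (j / 2) := by
  rw [bitSign, bitSign, Nat.div_div_eq_div_mul, pow_succ']

theorem bitSign_eq_one_or (i j : ℕ) : bitSign i j = 1 ∨ bitSign i j = -1 := by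
  rw [bitSign_eq]
  split_ifs <;> simp

theorem abs_bitSign (i j : ℕ) : |bitSign i j| = 1 := by
  rcases bitSign_eq_one_or i j with h | h <;> simp [h]

theorem bitSign_mul_self (i j : ℕ) : bitSign i j * bitSign i j = 1 := by
  rcases bitSign_eq_one_or i j with h | h <;> simp [h]

/-- All digits from position `D` on are zero in both numbers, so a difference must show among the
first `D`. -/
theorem exists_bitSign_ne {D j j' : ℕ} (hj : j < 2 ^ D) (hj' : j' < 2 ^ D) (h : j ≠ j') :
    ∃ i < D, bitSign i j ≠ bitSign i j' := by
  by_contra! H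
  refine h (Nat.eq_of_testBit_eq fun i => ?_)
  rcases lt_or_ge i D with hi | hi
  · have := H i hi
    rw [bitSign_eq, bitSign_eq] at this
    by_contra hne
    cases h1 : j.testBit i <;> cases h2 : j'.testBit i <;> simp [h1, h2] at this hne <;>
      linarith
  · rw [Nat.testBit_lt_two_pow (hj.trans_le (Nat.pow_le_pow_right two_pos hi)),
      Nat.testBit_lt_two_pow (hj'.trans_le (Nat.pow_le_pow_right two_pos hi))]

theorem exists_bitSign {D : ℕ} (z : Fin D → ℝ) (hz : ∀ i, z i = -1 ∨ z i = 1) :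
    ∃ j : Fin (2 ^ D), ∀ i : Fin D, bitSign i j = z i := by
  classical
  refine ⟨⟨Nat.ofBits fun i => decide (z i = 1), Nat.ofBits_lt_two_pow _⟩, fun i => ?_⟩
  rw [bitSign_eq, Nat.testBit_ofBits_lt _ _ i.2]
  rcases hz i with h | h <;> simp [h]
  norm_num

/-- Entry `(l, c)` of the gadget matrix, which is block diagonal with blocks whose columns are all
the sign vectors of length `D`. -/
noncomputable def gadgetEntry (D l c : ℕ) : ℝ :=
  if l / D = c / 2 ^ D then bitSign (l % D) (c % 2 ^ D) else 0

variable {d k D : ℕ}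

/-- The gadget matrix. -/
noncomputable def gadget (d k D : ℕ) : Matrix (Fin d) (Fin (k * 2 ^ D)) ℝ :=
  fun l c => gadgetEntry D l c

/-- The matrix of the sums over the blocks. -/
noncomputable def blockSum (k D : ℕ) : Matrix (Fin k) (Fin (k * 2 ^ D)) ℝ :=
  fun b c => if (b : ℕ) = c / 2 ^ D then 1 else 0

/-- The `i`-th coordinate in block `b`. -/
def coord (h : k * D = d) : Fin k × Fin D ≃ Fin d := finProdFinEquiv.trans (finCongr h)

/-- The `j`-th column in block `b`. -/
def column (k D : ℕ) : Fin k × Fin (2 ^ D) ≃ Fin (k * 2 ^ D) := finProdFinEquiv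

theorem val_coord (h : k * D = d) (b : Fin k) (i : Fin D) :
    (coord h (b, i) : ℕ) = i + D * b := rfl

theorem val_column (b : Fin k) (j : Fin (2 ^ D)) :
    (column k D (b, j) : ℕ) = j + 2 ^ D * b := rfl

theorem add_mul_div_self {q b i : ℕ} (h : i < q) : (i + q * b) / q = b := by
  rw [Nat.add_mul_div_left _ _ (by omega), Nat.div_eq_of_lt h, zero_add]

theorem add_mul_mod_self {q b i : ℕ} (h : i < q) : (i + q * b) % q = i := by
  rw [Nat.add_mul_mod_self_left, Nat.mod_eq_of_lt h]

theorem gadget_apply (h : k * D = d) (b b' : Fin k) (i : Fin D) (j : Fin (2 ^ D)) :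
    gadget d k D (coord h (b, i)) (column k D (b', j)) =
      if b = b' then bitSign i j else 0 := by
  rw [gadget, gadgetEntry, val_coord, val_column, add_mul_div_self i.2, add_mul_div_self j.2,
    add_mul_mod_self i.2, add_mul_mod_self j.2]
  simp only [Fin.ext_iff]

theorem blockSum_apply (b b' : Fin k) (j : Fin (2 ^ D)) :
    blockSum k D b (column k D (b', j)) = if b = b' then 1 else 0 := by
  rw [blockSum, val_column, add_mul_div_self j.2]
  simp only [Fin.ext_iff]

theorem sum_column {M : Type*} [AddCommMonoid M] (f : Fin (k * 2 ^ D) → M) :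
    ∑ c, f c = ∑ b, ∑ j, f (column k D (b, j)) := by
  rw [← (column k D).sum_comp, Fintype.sum_prod_type]

theorem sum_coord {M : Type*} [AddCommMonoid M] (h : k * D = d) (f : Fin d → M) :
    ∑ l, f l = ∑ b, ∑ i, f (coord h (b, i)) := by
  rw [← (coord h).sum_comp, Fintype.sum_prod_type]

theorem gadget_mulVec (h : k * D = d) (Δ : Fin (k * 2 ^ D) → ℝ) (b : Fin k) (i : Fin D) :
    (gadget d k D).mulVec Δ (coord h (b, i)) = ∑ j : Fin (2 ^ D), bitSign i j * Δ (column k D (b, j)) := by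
  rw [Matrix.mulVec, dotProduct, sum_column, Finset.sum_eq_single b]
  · simp [gadget_apply]
  · intro b' _ hb'
    simp [gadget_apply, hb'.symm]
  · simp

theorem blockSum_mulVec (Δ : Fin (k * 2 ^ D) → ℝ) (b : Fin k) :
    (blockSum k D).mulVec Δ b = ∑ j, Δ (column k D (b, j)) := by
  rw [Matrix.mulVec, dotProduct, sum_column, Finset.sum_eq_single b]
  · simp [blockSum_apply]
  · intro b' _ hb'
    simp [blockSum_apply, hb'.symm]
  · simp

/-- The vector with exactly one entry `1` in every block, at the position given by `σ`. -/
noncomputable def selector (σ : Fin k → Fin (2 ^ D)) : Fin (k * 2 ^ D) → ℝ :=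
  fun c => if ((column k D).symm c).2 = σ ((column k D).symm c).1 then 1 else 0

theorem selector_column (σ : Fin k → Fin (2 ^ D)) (b : Fin k) (j : Fin (2 ^ D)) :
    selector σ (column k D (b, j)) = if j = σ b then 1 else 0 := by
  simp [selector]

theorem supp_selector (σ : Fin k → Fin (2 ^ D)) :
    supp (selector σ) = Finset.univ.image fun b => column k D (b, σ b) := by
  ext c
  obtain ⟨⟨b, j⟩, rfl⟩ := (column k D).surjective c
  simp only [supp, Finset.mem_filter, Finset.mem_univ, true_and, selector_column,
    Finset.mem_image, EmbeddingLike.apply_eq_iff_eq, Prod.mk.injEq]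
  constructor
  · intro h
    by_contra h'
    exact h (if_neg fun hj => h' ⟨b, rfl, hj.symm⟩)
  · rintro ⟨b, rfl, rfl⟩
    simp

theorem column_mem_supp_selector (σ : Fin k → Fin (2 ^ D)) (b : Fin k) (j : Fin (2 ^ D)) :
    column k D (b, j) ∈ supp (selector σ) ↔ j = σ b := by
  simp [supp, selector_column]

theorem isSparse_selector (σ : Fin k → Fin (2 ^ D)) : IsSparse k (selector σ) := by
  rw [IsSparse, supp_selector]
  exact Finset.card_image_le.trans (by simp)

theorem selector_ne_zero (hk : 1 ≤ k) (σ : Fin k → Fin (2 ^ D)) : selector σ ≠ 0 := by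
  intro h
  have := congrFun h (column k D (⟨0, hk⟩, σ ⟨0, hk⟩))
  simp [selector_column] at this

theorem blockSum_mulVec_selector (σ : Fin k → Fin (2 ^ D)) :
    (blockSum k D).mulVec (selector σ) = 1 := by
  ext b
  simp [blockSum_mulVec, selector_column]

theorem gadget_mulVec_selector (h : k * D = d) (σ : Fin k → Fin (2 ^ D)) (b : Fin k) (i : Fin D) :
    (gadget d k D).mulVec (selector σ) (coord h (b, i)) = bitSign i (σ b) := by
  simp [gadget_mulVec, selector_column]

/-- The blocks are independent and each contains every sign vector of length `D`, so the column
indices can be read off block by block. -/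
theorem exists_selector (h : k * D = d) (z : Fin d → ℝ) (hz : z ∈ BinaryBDD.signVectors d) :
    ∃ σ : Fin k → Fin (2 ^ D), (gadget d k D).mulVec (selector σ) = z := by
  choose σ hσ using fun b => exists_bitSign (fun i => z (coord h (b, i))) fun i => hz _
  refine ⟨σ, funext fun l => ?_⟩
  obtain ⟨⟨b, i⟩, rfl⟩ := (coord h).surjective l
  rw [gadget_mulVec_selector, hσ]

theorem sum_supp_selector (σ : Fin k → Fin (2 ^ D)) (f : Fin (k * 2 ^ D) → ℝ) :
    ∑ c ∈ supp (selector σ), f c = ∑ b, f (column k D (b, σ b)) := by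
  rw [supp_selector, Finset.sum_image]
  intro b _ b' _ hb
  simpa using congrArg Prod.fst ((column k D).injective hb)

theorem sum_supp_selector_compl (σ : Fin k → Fin (2 ^ D)) (f : Fin (k * 2 ^ D) → ℝ) :
    ∑ c ∈ (supp (selector σ))ᶜ, f c =
      ∑ b, ∑ j ∈ Finset.univ.erase (σ b), f (column k D (b, j)) := by
  have h := Finset.sum_add_sum_compl (supp (selector σ)) f
  rw [sum_supp_selector, sum_column] at h
  have h' : ∑ b, ∑ j, f (column k D (b, j)) = ∑ b, f (column k D (b, σ b)) +
      ∑ b, ∑ j ∈ Finset.univ.erase (σ b), f (column k D (b, j)) := by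
    rw [← Finset.sum_add_distrib]
    exact Finset.sum_congr rfl fun b _ => (Finset.add_sum_erase _ _ (Finset.mem_univ _)).symm
  linarith

/-! ### Sign distances and the cone of a selector -/

/-- The normalized distance between the sign vectors with indices `j` and `j'`. -/
noncomputable def signDist (D j j' : ℕ) : ℝ :=
  1 - (∑ i : Fin D, bitSign i j * bitSign i j') / D

theorem signDist_self (hD : 1 ≤ D) (j : ℕ) : signDist D j j = 0 := by
  have : (D : ℝ) ≠ 0 := by positivity
  simp [signDist, bitSign_mul_self, this]

/-- `signDist` is `2 / D` times the Hamming distance of the two sign vectors, and that distance is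
between `1` and `D` for distinct indices. -/
theorem signDist_bounds (hD : 1 ≤ D) {j j' : ℕ} (hj : j < 2 ^ D) (hj' : j' < 2 ^ D)
    (h : j ≠ j') : 2 / D ≤ signDist D j j' ∧ signDist D j j' ≤ 2 := by
  have hD' : (0 : ℝ) < D := by positivity
  have hle : ∀ i : Fin D, |bitSign i j * bitSign i j'| ≤ 1 := fun i => by
    rw [abs_mul, abs_bitSign, abs_bitSign, one_mul]
  have h1 : signDist D j j' = (∑ i : Fin D, (1 - bitSign i j * bitSign i j')) / D := by
    rw [signDist, Finset.sum_sub_distrib]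
    simp [sub_div, hD'.ne']
  rw [h1]
  constructor
  · obtain ⟨i, hne⟩ : ∃ i : Fin D, bitSign i j ≠ bitSign i j' := by
      obtain ⟨i, hi, hne⟩ := exists_bitSign_ne hj hj' h
      exact ⟨⟨i, hi⟩, hne⟩
    refine div_le_div_of_nonneg_right ?_ hD'.le
    have h2 : (2 : ℝ) = 1 - bitSign i j * bitSign i j' := by
      rcases bitSign_eq_one_or i j with h | h <;> rcases bitSign_eq_one_or i j' with h' | h' <;>
        simp only [h, h', ne_eq, not_true_eq_false] at hne ⊢ <;> norm_num
    have h3 := Finset.single_le_sum (f := fun i : Fin D => 1 - bitSign i j * bitSign i j')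
      (fun i _ => sub_nonneg.2 ((abs_le.1 (hle i)).2)) (Finset.mem_univ i)
    linarith
  · rw [div_le_iff₀ hD']
    calc _ ≤ ∑ _i : Fin D, (2 : ℝ) :=
          Finset.sum_le_sum fun i _ => by linarith [(abs_le.1 (hle i)).1]
      _ = 2 * D := by simp [mul_comm]

/-- This is `sum_abs_ge_of_weights` with gap `2 / D` and the distances to the selected column as
weights. The weighted sum is the block sum minus a signed average of the gadget rows applied to `Δ`,
so only quantities visible to the design matrix enter the error. -/
theorem block_bound (hD : 1 ≤ D) (s : Fin (2 ^ D)) (Δ : Fin (2 ^ D) → ℝ) :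
    (1 + 2 / D) * (|Δ s| - |∑ j, Δ j|) - |∑ j, Δ j| -
      (∑ i : Fin D, |∑ j : Fin (2 ^ D), bitSign i j * Δ j|) / D ≤ ∑ j ∈ Finset.univ.erase s, |Δ j| := by
  have hD' : (0 : ℝ) < D := by positivity
  have h := sum_abs_ge_of_weights (Finset.univ.erase s) Δ (fun j => signDist D j s) (Δ s) (2 / D)
    (by positivity) fun c hc => signDist_bounds hD c.2 s.2
      fun h => Finset.ne_of_mem_erase hc (Fin.ext h)
  rw [Finset.add_sum_erase _ _ (Finset.mem_univ s)] at h
  -- The weight of the selected column is zero, so the sum may run over the whole block.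
  have h2 : ∑ j ∈ Finset.univ.erase s, Δ j * signDist D j s = ∑ j, Δ j * signDist D j s := by
    rw [← Finset.add_sum_erase _ _ (Finset.mem_univ s), signDist_self hD]
    simp
  have h3 : ∑ j, Δ j * signDist D j s =
      ∑ j, Δ j - (∑ i : Fin D, bitSign i s * ∑ j : Fin (2 ^ D), bitSign i j * Δ j) / D := by
    simp only [signDist, mul_sub, mul_one, Finset.sum_sub_distrib, Finset.mul_sum,
      Finset.sum_div]
    rw [Finset.sum_comm]
    congr 1
    refine Finset.sum_congr rfl fun i _ => Finset.sum_congr rfl fun j _ => ?_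
    ring
  have h4 : |∑ j, Δ j * signDist D j s| ≤
      |∑ j, Δ j| + (∑ i : Fin D, |∑ j : Fin (2 ^ D), bitSign i j * Δ j|) / D := by
    rw [h3]
    refine (abs_sub _ _).trans (add_le_add le_rfl ?_)
    rw [abs_div, abs_of_pos hD']
    refine div_le_div_of_nonneg_right ((Finset.abs_sum_le_sum_abs _ _).trans ?_) hD'.le
    exact Finset.sum_le_sum fun i _ => by rw [abs_mul, abs_bitSign, one_mul]
  rw [h2] at h
  linarith

/-- A vector in the `1 / D`-cone of the support of a selector is controlled by its block sums and by
its image under the gadget matrix. -/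
theorem norm2_le_of_mem_cone (hD : 1 ≤ D) (h : k * D = d) (σ : Fin k → Fin (2 ^ D))
    {Δ : Fin (k * 2 ^ D) → ℝ} (hΔ : Δ ∈ cone (1 / D) (supp (selector σ))) :
    norm2 Δ ≤ 3 * (4 * D * (√k * norm2 ((blockSum k D).mulVec Δ)) +
      √d * norm2 ((gadget d k D).mulVec Δ)) := by
  have hD' : (1 : ℝ) ≤ D := by exact_mod_cast hD
  have hcone : ∑ c ∈ (supp (selector σ))ᶜ, |Δ c| ≤
    (1 + 1 / D) * ∑ c ∈ supp (selector σ), |Δ c| := hΔ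
  have htot := Finset.sum_add_sum_compl (supp (selector σ)) fun c => |Δ c|
  rw [sum_supp_selector] at hcone htot
  set a := ∑ b, |Δ (column k D (b, σ b))|
  have hsum := Finset.sum_le_sum fun b (_ : b ∈ (Finset.univ : Finset (Fin k))) =>
    block_bound hD (σ b) fun j => Δ (column k D (b, j))
  rw [← sum_supp_selector_compl σ fun c => |Δ c|, Finset.sum_sub_distrib, Finset.sum_sub_distrib,
    ← Finset.mul_sum, Finset.sum_sub_distrib, ← Finset.sum_div] at hsum
  simp only [← gadget_mulVec h, ← blockSum_mulVec] at hsum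
  rw [← sum_coord h fun l => |(gadget d k D).mulVec Δ l|] at hsum
  have hu := sum_abs_le_sqrt_mul_norm2 ((blockSum k D).mulVec Δ)
  have hg := sum_abs_le_sqrt_mul_norm2 ((gadget d k D).mulVec Δ)
  have hu0 : 0 ≤ ∑ b, |(blockSum k D).mulVec Δ b| := Finset.sum_nonneg fun _ _ => abs_nonneg _
  set u := ∑ b, |(blockSum k D).mulVec Δ b|
  set g := ∑ l, |(gadget d k D).mulVec Δ l|
  change (1 + 2 / (D : ℝ)) * (a - u) - u - g / D ≤ _ at hsum
  have ha0 : 0 ≤ a := Finset.sum_nonneg fun _ _ => abs_nonneg _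
  -- After multiplication by `D`, the blocks contribute `D + 2` copies of `a` and the cone only `D +
  -- 1`, so one copy survives; `1 ≤ D` turns `(2 D + 2) u` into at most `4 D u`.
  have ha : a ≤ 4 * D * u + g := by
    have h1 : (1 + 2 / (D : ℝ)) * (a - u) - u - g / D ≤ (1 + 1 / D) * a := hsum.trans hcone
    have h2 : ((1 + 2 / (D : ℝ)) * (a - u) - u - g / D) * D ≤ ((1 + 1 / D) * a) * D :=
      mul_le_mul_of_nonneg_right h1 (by linarith)
    have h3 : ((1 + 2 / (D : ℝ)) * (a - u) - u - g / D) * D =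
      (D + 2) * (a - u) - D * u - g := by field_simp
    have h4 : ((1 + 1 / (D : ℝ)) * a) * D = (D + 1) * a := by field_simp
    nlinarith
  have h1 : (1 + 1 / (D : ℝ)) * a ≤ 2 * a := by
    refine mul_le_mul_of_nonneg_right ?_ ha0
    have : 1 / (D : ℝ) ≤ 1 := (div_le_one (by linarith)).2 hD'
    linarith
  calc norm2 Δ ≤ ∑ c, |Δ c| := norm2_le_sum_abs Δ
    _ ≤ 3 * a := by linarith
    _ ≤ 3 * (4 * D * u + g) := by linarith
    _ ≤ _ := by gcongr

end SLR

namespace SLR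

variable {d k D m : ℕ}

/-! ## The design matrix -/

/-- Two vectors on top of each other, padded with zeros. -/
def stack (m : ℕ) (a : Fin d → ℝ) (b : Fin k → ℝ) : Fin m → ℝ := fun i =>
  if h : (i : ℕ) < d then a ⟨i, h⟩ else if h' : (i : ℕ) - d < k then b ⟨i - d, h'⟩ else 0

theorem norm2_stack_sq (h : d + k ≤ m) (a : Fin d → ℝ) (b : Fin k → ℝ) :
    norm2 (stack m a b) ^ 2 = norm2 a ^ 2 + norm2 b ^ 2 := by
  obtain ⟨r, rfl⟩ := Nat.exists_eq_add_of_le h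
  rw [norm2_sq, norm2_sq, norm2_sq, Fin.sum_univ_add, Fin.sum_univ_add,
    Finset.sum_eq_zero (s := Finset.univ (α := Fin r))]
  · simp [stack]
  · intro i _
    simp only [stack, Fin.val_natAdd]
    rw [dif_neg (by omega), dif_neg (by omega)]
    norm_num

theorem stack_add (a a' : Fin d → ℝ) (b b' : Fin k → ℝ) :
    stack m (a + a') (b + b') = stack m a b + stack m a' b' := by
  ext i
  simp only [stack, Pi.add_apply]
  split_ifs <;> simp

/-- The design matrix: a multiple of `B` times the gadget matrix, and a multiple of the matrix of
block sums. -/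
noncomputable def design (m k D : ℕ) (s W : ℝ) (B : Matrix (Fin d) (Fin d) ℝ) :
    Matrix (Fin m) (Fin (k * 2 ^ D)) ℝ :=
  fun i c => stack m (fun l => s * (B * gadget d k D) l c) (fun b => W * blockSum k D b c) i

theorem design_mulVec (s W : ℝ) (B : Matrix (Fin d) (Fin d) ℝ) (Δ : Fin (k * 2 ^ D) → ℝ) :
    (design m k D s W B).mulVec Δ =
      stack m (s • B.mulVec ((gadget d k D).mulVec Δ)) (W • (blockSum k D).mulVec Δ) := by
  ext i
  rw [Matrix.mulVec_mulVec]
  simp only [Matrix.mulVec, dotProduct, design, stack, Pi.smul_apply, smul_eq_mul]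
  split_ifs
  · rw [Finset.mul_sum]
    exact Finset.sum_congr rfl fun c _ => by ring
  · rw [Finset.mul_sum]
    exact Finset.sum_congr rfl fun c _ => by ring
  · simp

theorem norm2_design_mulVec_sq (h : d + k ≤ m) (s W : ℝ) (B : Matrix (Fin d) (Fin d) ℝ)
    (Δ : Fin (k * 2 ^ D) → ℝ) :
    norm2 ((design m k D s W B).mulVec Δ) ^ 2 =
      (s * norm2 (B.mulVec ((gadget d k D).mulVec Δ))) ^ 2 +
        (W * norm2 ((blockSum k D).mulVec Δ)) ^ 2 := by
  rw [design_mulVec, norm2_stack_sq h, norm2_smul, norm2_smul, mul_pow, mul_pow, sq_abs, sq_abs,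
    mul_pow, mul_pow]

theorem abs_gadget_le (l : Fin d) (c : Fin (k * 2 ^ D)) : |gadget d k D l c| ≤ 1 := by
  rw [gadget, gadgetEntry]
  split_ifs
  · exact (abs_bitSign _ _).le
  · simp

/-- A gadget column has norm at most `√d`, so the upper part of a design column has norm at most `s
√d ‖B‖_F = W`. The lower part is also at most `W`, and `2 W² ≤ (2 W)² = m`. -/
theorem columnNormalized_design (h : d + k ≤ m) {s W : ℝ} {B : Matrix (Fin d) (Fin d) ℝ}
    (hs : 0 ≤ s) (hsW : s * (√d * frobenius B) = W) (hW : W = √m / 2) :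
    ColumnNormalized (design m k D s W B) := by
  intro c
  have hW0 : 0 ≤ W := by rw [hW]; positivity
  have hm : √(m : ℝ) = 2 * W := by linarith
  rw [hm]
  refine le_of_sq_le_sq ?_ (by positivity)
  have h1 : norm2 (fun i => design m k D s W B i c) ^ 2 =
      (s * norm2 (B.mulVec fun l => gadget d k D l c)) ^ 2 +
        (W * norm2 fun b => blockSum k D b c) ^ 2 := by
    have h2 : (fun i => design m k D s W B i c) =
        stack m (s • B.mulVec fun l => gadget d k D l c) (W • fun b => blockSum k D b c) := rfl
    rw [h2, norm2_stack_sq h, norm2_smul, norm2_smul, mul_pow, mul_pow, sq_abs, sq_abs,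
      mul_pow, mul_pow]
  have h3 : s * norm2 (B.mulVec fun l => gadget d k D l c) ≤ W := by
    rw [← hsW]
    refine mul_le_mul_of_nonneg_left ((norm2_mulVec_le B _).trans ?_) hs
    rw [mul_comm]
    refine mul_le_mul_of_nonneg_right ?_ (frobenius_nonneg B)
    simpa using norm2_le_of_abs_le zero_le_one fun l => abs_gadget_le l c
  have h4 : norm2 (fun b => blockSum k D b c) ≤ 1 := by
    obtain ⟨⟨b, j⟩, rfl⟩ := (column k D).surjective c
    refine le_of_sq_le_sq ?_ zero_le_one
    rw [norm2_sq]
    simp [blockSum_apply]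
  have h5 : W * norm2 (fun b => blockSum k D b c) ≤ W := mul_le_of_le_one_right hW0 h4
  rw [h1]
  nlinarith [pow_le_pow_left₀ (mul_nonneg hs (norm2_nonneg _)) h3 2,
    pow_le_pow_left₀ (mul_nonneg hW0 (norm2_nonneg _)) h5 2]

/-! ### The restricted eigenvalue condition for the design matrix -/

theorem one_le_condNumber (hd : 1 ≤ d) {B : Matrix (Fin d) (Fin d) ℝ} (hB : B.det ≠ 0) :
    1 ≤ BinaryBDD.condNumber B :=
  (one_le_div (singularValues_last_pos hd hB)).2
    ((Matrix.toEuclideanLin B).singularValues_antitone (Nat.zero_le _))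

/-- The constant for which the design matrix satisfies the restricted eigenvalue condition. -/
noncomputable def eigenvalueBound (B : Matrix (Fin d) (Fin d) ℝ) : ℝ :=
  1 / (900 * (d : ℝ) ^ 3 * BinaryBDD.condNumber B ^ 2)

theorem eigenvalueBound_pos (hd : 1 ≤ d) {B : Matrix (Fin d) (Fin d) ℝ} (hB : B.det ≠ 0) :
    0 < eigenvalueBound B := by
  have := one_le_condNumber hd hB
  unfold eigenvalueBound
  positivity

/-- The lower rows of the design measure the block sums of `Δ`, and the upper rows control `G Δ`
through the smallest singular value of `B`; `norm2_le_of_mem_cone` says that these two determine the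
size of `Δ`. Squaring the constant gives `900 d³ κ²`. -/
theorem norm2_le_design (hd : 1 ≤ d) (hk : k * D = d) (hm : d + k ≤ m)
    {B : Matrix (Fin d) (Fin d) ℝ} (hB : B.det ≠ 0) {s W : ℝ}
    (hsW : s * (√d * frobenius B) = W) (hW : W = √m / 2) (hs : 0 < s)
    (σ : Fin k → Fin (2 ^ D)) {Δ : Fin (k * 2 ^ D) → ℝ}
    (hΔ : Δ ∈ cone (1 / D) (supp (selector σ))) :
    norm2 Δ * √m ≤ 30 * (d * √d * BinaryBDD.condNumber B) *
      norm2 ((design m k D s W B).mulVec Δ) := by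
  have hD : 1 ≤ D := Nat.one_le_iff_ne_zero.2 fun h => by simp [h] at hk; omega
  have hk1 : 1 ≤ k := Nat.one_le_iff_ne_zero.2 fun h => by simp [h] at hk; omega
  have hm0 : (0 : ℝ) < m := by exact_mod_cast (by omega : 0 < m)
  have hmr : 0 < √(m : ℝ) := Real.sqrt_pos.2 hm0
  have hW0 : 0 < W := by rw [hW]; positivity
  have hκ := one_le_condNumber hd hB
  have hσ := singularValues_last_pos hd hB
  have hg0 := singularValues_mul_norm2_le B ((gadget d k D).mulVec Δ)
  have hF := frobenius_le_singularValues B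
  have hκdef : BinaryBDD.condNumber B * (Matrix.toEuclideanLin B).singularValues (d - 1) =
      (Matrix.toEuclideanLin B).singularValues 0 := div_mul_cancel₀ _ hσ.ne'
  have hmain := norm2_le_of_mem_cone hD hk σ hΔ
  have hsq := norm2_design_mulVec_sq hm s W B Δ
  set N := norm2 ((design m k D s W B).mulVec Δ)
  set κ := BinaryBDD.condNumber B
  set σ₁ := (Matrix.toEuclideanLin B).singularValues 0
  set σ₂ := (Matrix.toEuclideanLin B).singularValues (d - 1)
  set u := norm2 ((blockSum k D).mulVec Δ)
  set g := norm2 ((gadget d k D).mulVec Δ)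
  set F := frobenius B
  have hN : 0 ≤ N := norm2_nonneg _
  have hu : u * √m ≤ 2 * N := by
    have : W * u ≤ N := 
      le_of_sq_le_sq (by rw [hsq]; exact le_add_of_nonneg_left (sq_nonneg _)) hN
    rw [hW] at this
    linarith
  have hd1 : (1 : ℝ) ≤ d := by exact_mod_cast hd
  have hsd : (1 : ℝ) ≤ √d := Real.one_le_sqrt.2 hd1
  have hdd : √(d : ℝ) * √d = d := Real.mul_self_sqrt (by linarith)
  have hg : g * √m ≤ 2 * d * κ * N := by
    have h1 : s * norm2 (B.mulVec ((gadget d k D).mulVec Δ)) ≤ N :=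
      le_of_sq_le_sq (by rw [hsq]; exact le_add_of_nonneg_right (sq_nonneg _)) hN
    have h2 : s * (σ₂ * g) ≤ N := (mul_le_mul_of_nonneg_left hg0 hs.le).trans h1
    -- Since `F ≤ √d σ₁`, the normalization gives `√m / 2 = s √d F ≤ s d σ₁`. Dividing by the
    -- smallest singular value produces the factor `d κ`.
    have h3 : √m ≤ 2 * (s * (d * σ₁)) := by
      have : s * (√d * F) ≤ s * (√d * (√d * σ₁)) := by gcongr
      rw [← mul_assoc √(d : ℝ), hdd] at this
      linarith
    calc g * √m ≤ g * (2 * (s * (d * σ₁))) := mul_le_mul_of_nonneg_left h3 (norm2_nonneg _)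
      _ = 2 * d * κ * (s * (σ₂ * g)) := by rw [← hκdef]; ring
      _ ≤ 2 * d * κ * N := mul_le_mul_of_nonneg_left h2 (by positivity)
  -- Here `√k ≤ k` and `k D = d`.
  have hDk : D * √(k : ℝ) ≤ d := by
    have h1 : √(k : ℝ) ≤ k := by
      have : (1 : ℝ) ≤ k := by exact_mod_cast hk1
      exact Real.sqrt_le_iff.2 ⟨by linarith, by nlinarith⟩
    have h2 : (k : ℝ) * D = d := by exact_mod_cast hk
    nlinarith [Nat.cast_nonneg (α := ℝ) D]
  -- This absorbs the block-sum term `24 d N` into the gadget term `6 d √d κ N`, for a total of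
  -- `30`.
  have hd2 : (d : ℝ) ≤ d * √d * κ := by
    have : 1 ≤ √(d : ℝ) * κ := one_le_mul_of_one_le_of_one_le hsd hκ
    nlinarith
  have hu0 : 0 ≤ u * √m := mul_nonneg (norm2_nonneg _) hmr.le
  calc norm2 Δ * √m ≤ 3 * (4 * D * (√k * u) + √d * g) * √m :=
        mul_le_mul_of_nonneg_right hmain hmr.le
    _ = 12 * (D * √k) * (u * √m) + 3 * √d * (g * √m) := by ring
    _ ≤ 12 * d * (2 * N) + 3 * √d * (2 * d * κ * N) := by gcongr
    _ = 24 * (d * N) + 6 * (d * √d * κ) * N := by ring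
    _ ≤ 24 * (d * √d * κ * N) + 6 * (d * √d * κ) * N := by gcongr
    _ = _ := by ring

theorem restrictedEigenvalue_design (hd : 1 ≤ d) (hk : k * D = d) (hm : d + k ≤ m)
    {B : Matrix (Fin d) (Fin d) ℝ} (hB : B.det ≠ 0) {s W : ℝ}
    (hsW : s * (√d * frobenius B) = W) (hW : W = √m / 2) (hs : 0 < s)
    (σ : Fin k → Fin (2 ^ D)) :
    RestrictedEigenvalue (eigenvalueBound B) (1 / D) (design m k D s W B)
      (supp (selector σ)) := by
  refine ⟨columnNormalized_design hm hs.le hsW hW, fun Δ hΔ hne => ?_⟩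
  have hm0 : (0 : ℝ) < m := by exact_mod_cast (by omega : 0 < m)
  have hΔ0 := norm2_pos hne
  have hκ := one_le_condNumber hd hB
  have hd1 : (1 : ℝ) ≤ d := by exact_mod_cast hd
  have h := pow_le_pow_left₀ (by positivity)
    (norm2_le_design hd hk hm hB hsW hW hs σ hΔ) 2
  rw [mul_pow, mul_pow, mul_pow, mul_pow, mul_pow, Real.sq_sqrt hm0.le,
    Real.sq_sqrt (by linarith)] at h
  rw [eigenvalueBound, le_div_iff₀ (by positivity), one_div_mul_eq_div, div_le_iff₀ (by positivity)]
  nlinarith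

/-! ## Decoding -/

theorem binaryMinDist_le {B : Matrix (Fin d) (Fin d) ℝ} {z z' : Fin d → ℝ}
    (hz : z ∈ BinaryBDD.signVectors d) (hz' : z' ∈ BinaryBDD.signVectors d) (hne : z ≠ z') :
    BinaryBDD.binaryMinDist B ≤ norm2 (B.mulVec z - B.mulVec z') :=
  csInf_le ⟨0, by rintro _ ⟨_, _, _, _, _, rfl⟩; exact norm2_nonneg _⟩
    ⟨z, hz, z', hz', hne, rfl⟩

theorem exists_signVectors_single (hd : 1 ≤ d) :
    ∃ z ∈ BinaryBDD.signVectors d, ∃ z' ∈ BinaryBDD.signVectors d,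
      z ≠ z' ∧ norm2 (z - z') ≤ 2 := by
  have h : norm2 (Pi.single ⟨0, hd⟩ 2 : Fin d → ℝ) ≤ 2 := by
    refine (norm2_le_sum_abs _).trans ?_
    rw [Finset.sum_eq_single ⟨0, hd⟩] <;> simp +contextual
  refine ⟨1, fun i => Or.inr rfl, 1 - Pi.single ⟨0, hd⟩ 2, fun i => ?_, fun h => ?_, by simpa⟩
  · by_cases hi : i = ⟨0, hd⟩
    · subst hi; left; norm_num
    · right; simp [hi]
  · have := congrFun h ⟨0, hd⟩
    norm_num at this

/-- Distinct sign vectors differ by `2` in some coordinate, so the minimum distance is at least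
twice the smallest singular value. The infimum is over a nonempty set because a coordinate can be
flipped; over the empty set it would be `0`. -/
theorem binaryMinDist_pos (hd : 1 ≤ d) {B : Matrix (Fin d) (Fin d) ℝ} (hB : B.det ≠ 0) :
    0 < BinaryBDD.binaryMinDist B := by
  have hσ := singularValues_last_pos hd hB
  refine (mul_pos hσ two_pos).trans_le (le_csInf ?_ ?_)
  · obtain ⟨z, hz, z', hz', hne, -⟩ := exists_signVectors_single hd
    exact ⟨_, z, hz, z', hz', hne, rfl⟩
  · rintro _ ⟨z, hz, z', hz', hne, rfl⟩
    rw [← Matrix.mulVec_sub]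
    refine le_trans (mul_le_mul_of_nonneg_left ?_ hσ.le) (singularValues_mul_norm2_le B _)
    obtain ⟨i, hi⟩ := Function.ne_iff.1 hne
    refine le_trans ?_ (abs_le_norm2 _ i)
    rcases hz i with h | h <;> rcases hz' i with h' | h' <;> rw [Pi.sub_apply, h, h'] <;>
      first | exact absurd (h.trans h'.symm) hi | norm_num

/-- Flipping a single sign moves `z` by at most `2`. This later keeps the block sums of the
regression output away from zero. -/
theorem binaryMinDist_le_frobenius (hd : 1 ≤ d) (B : Matrix (Fin d) (Fin d) ℝ) :
    BinaryBDD.binaryMinDist B ≤ 2 * frobenius B := by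
  obtain ⟨z, hz, z', hz', hne, h⟩ := exists_signVectors_single hd
  refine (binaryMinDist_le hz hz' hne).trans ?_
  rw [← Matrix.mulVec_sub]
  nlinarith [norm2_mulVec_le B (z - z'), frobenius_nonneg B]

/-- A sparse vector all of whose block sums are nonzero has one nonzero entry in every block. -/
theorem exists_eq_zero_of_isSparse {θ : Fin (k * 2 ^ D) → ℝ} (hθ : IsSparse k θ)
    (h : ∀ b, (blockSum k D).mulVec θ b ≠ 0) :
    ∃ τ : Fin k → Fin (2 ^ D), ∀ b j, j ≠ τ b → θ (column k D (b, j)) = 0 := by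
  have hex : ∀ b, ∃ j, θ (column k D (b, j)) ≠ 0 := by
    intro b
    by_contra! H
    exact h b (by rw [blockSum_mulVec]; simp [H])
  choose τ hτ using hex
  refine ⟨τ, fun b j hj => ?_⟩
  -- Pigeonhole: one nonzero entry per block already uses up all `k` that sparsity allows, so the
  -- two supports coincide.
  have hsub : supp (selector τ) ⊆ supp θ := by
    rw [supp_selector]
    intro c hc
    obtain ⟨b, -, rfl⟩ := Finset.mem_image.1 hc
    simpa [supp] using hτ b
  have hcard : (supp (selector τ)).card = k := by
    rw [supp_selector, Finset.card_image_of_injective, Finset.card_univ, Fintype.card_fin]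
    intro b b' hb
    simpa using congrArg Prod.fst ((column k D).injective hb)
  have heq := Finset.eq_of_subset_of_card_le hsub (by rw [hcard]; exact hθ)
  by_contra hne
  refine hj ((column_mem_supp_selector τ b j).1 ?_)
  rw [heq]
  simpa [supp] using hne

theorem gadget_mulVec_mem_signVectors (h : k * D = d) (τ : Fin k → Fin (2 ^ D)) :
    (gadget d k D).mulVec (selector τ) ∈ BinaryBDD.signVectors d := by
  intro l
  obtain ⟨⟨b, i⟩, rfl⟩ := (coord h).surjective l
  rw [gadget_mulVec_selector]
  exact (bitSign_eq_one_or _ _).symm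

/-- The lower rows force block sums near `1`, so `θ'` has exactly one nonzero entry per block and `G
θ'` is a blockwise rescaled sign vector. The upper rows force `B G θ'` close to `B z`. The minimum
distance then identifies that sign vector, and dividing by the root of the square removes the
scaling. -/
theorem sign_gadget_mulVec_eq (hd : 1 ≤ d) (hk : k * D = d) (hm : d + k ≤ m)
    {B : Matrix (Fin d) (Fin d) ℝ} (hB : B.det ≠ 0) {s W : ℝ}
    (hsW : s * (√d * frobenius B) = W) (hW : 0 < W) (hs : 0 < s)
    {z : Fin d → ℝ} (hz : z ∈ BinaryBDD.signVectors d) {θ θ' : Fin (k * 2 ^ D) → ℝ}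
    (hθ : (gadget d k D).mulVec θ = z) (hθ1 : (blockSum k D).mulVec θ = 1)
    (hθ' : IsSparse k θ')
    (h : norm2 ((design m k D s W B).mulVec θ' - (design m k D s W B).mulVec θ) ≤
      s * BinaryBDD.binaryMinDist B / 8) (l : Fin d) :
    (gadget d k D).mulVec θ' l /
      √((gadget d k D).mulVec θ' l * (gadget d k D).mulVec θ' l) = z l := by
  have hlam := binaryMinDist_pos hd hB
  have hlamF := binaryMinDist_le_frobenius hd B
  rw [← Matrix.mulVec_sub] at h
  have hsq := norm2_design_mulVec_sq hm s W B (θ' - θ)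
  rw [Matrix.mulVec_sub (gadget d k D), Matrix.mulVec_sub (blockSum k D), hθ, hθ1] at hsq
  set lam := BinaryBDD.binaryMinDist B
  set N := norm2 ((design m k D s W B).mulVec (θ' - θ))
  set F := frobenius B
  have hd1 : (1 : ℝ) ≤ d := by exact_mod_cast hd
  have hsd : (1 : ℝ) ≤ √d := Real.one_le_sqrt.2 hd1
  have hN : 0 ≤ N := norm2_nonneg _
  have hsum : W * norm2 ((blockSum k D).mulVec θ' - 1) ≤ s * lam / 8 :=
    (le_of_sq_le_sq (by rw [hsq]; exact le_add_of_nonneg_left (sq_nonneg _)) hN).trans h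
  have hgad : norm2 (B.mulVec ((gadget d k D).mulVec θ' - z)) ≤ lam / 8 := by
    have h1 : s * norm2 (B.mulVec ((gadget d k D).mulVec θ' - z)) ≤ s * lam / 8 :=
      (le_of_sq_le_sq (by rw [hsq]; exact le_add_of_nonneg_right (sq_nonneg _)) hN).trans h
    rw [mul_div_assoc] at h1
    exact le_of_mul_le_mul_left h1 hs
  have hη : ∀ b, |(blockSum k D).mulVec θ' b - 1| ≤ s * lam / (8 * W) := by
    intro b
    refine (abs_le_norm2 ((blockSum k D).mulVec θ' - 1) b).trans ?_
    rw [le_div_iff₀ (by positivity)]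
    linarith
  -- From `lam ≤ 2 F ≤ 2 √d F` and `W = s √d F`.
  have hη' : s * lam / (8 * W) ≤ 1 / 4 := by
    rw [div_le_iff₀ (by positivity), ← hsW]
    have hF : F ≤ √d * F := le_mul_of_one_le_left (frobenius_nonneg B) hsd
    nlinarith
  have hpos : ∀ b, 0 < (blockSum k D).mulVec θ' b := fun b => by
    linarith [(abs_le.1 (hη b)).1]
  obtain ⟨τ, hτ⟩ := exists_eq_zero_of_isSparse hθ' fun b => (hpos b).ne'
  have hu : ∀ b, (blockSum k D).mulVec θ' b = θ' (column k D (b, τ b)) := fun b => by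
    rw [blockSum_mulVec]
    exact Finset.sum_eq_single _ (fun j _ hj => hτ b j hj) (by simp)
  have hg : ∀ b i, (gadget d k D).mulVec θ' (coord hk (b, i)) =
      (gadget d k D).mulVec (selector τ) (coord hk (b, i)) * (blockSum k D).mulVec θ' b := by
    intro b i
    rw [gadget_mulVec_selector, hu, gadget_mulVec]
    exact Finset.sum_eq_single _ (fun j _ hj => by rw [hτ b j hj, mul_zero]) (by simp)
  have hτz := gadget_mulVec_mem_signVectors hk τ
  set z' := (gadget d k D).mulVec (selector τ)
  have hz' : ∀ l, |z' l| = 1 := fun l => by rcases hτz l with h | h <;> simp [h]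
  -- Undoing the rescaling costs as much as the noise: `F √d` times the block-sum error is exactly
  -- `lam / 8`, because `W = s √d F`.
  have hv : norm2 (B.mulVec ((gadget d k D).mulVec θ' - z')) ≤ lam / 8 := by
    have h1 : norm2 ((gadget d k D).mulVec θ' - z') ≤ √d * (s * lam / (8 * W)) := by
      refine norm2_le_of_abs_le (by positivity) fun l => ?_
      obtain ⟨⟨b, i⟩, rfl⟩ := (coord hk).surjective l
      rw [Pi.sub_apply, hg, ← mul_sub_one, abs_mul, hz', one_mul]
      exact hη b
    calc norm2 (B.mulVec ((gadget d k D).mulVec θ' - z'))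
        ≤ F * (√d * (s * lam / (8 * W))) := (norm2_mulVec_le B _).trans
          (mul_le_mul_of_nonneg_left h1 (frobenius_nonneg B))
      _ = (s * (√d * F)) * lam / (8 * W) := by ring
      _ = lam / 8 := by rw [hsW]; field_simp
  -- Otherwise `B z'` and `B z` would be at distance at least `lam`, yet both are within `lam / 8`
  -- of `B G θ'`.
  have hzz : z' = z := by
    by_contra hne
    have h1 := binaryMinDist_le (B := B) hτz hz hne
    have h2 : B.mulVec z' - B.mulVec z = B.mulVec ((gadget d k D).mulVec θ' - z) -
        B.mulVec ((gadget d k D).mulVec θ' - z') := by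
      simp only [Matrix.mulVec_sub]
      abel
    rw [h2] at h1
    have h3 := h1.trans (norm2_sub_le _ _)
    change lam ≤ _ at h3
    linarith
  obtain ⟨⟨b, i⟩, rfl⟩ := (coord hk).surjective l
  rw [hg, hzz, Real.sqrt_mul_self_eq_abs, abs_mul, abs_of_pos (hpos b), ← hzz, hz', one_mul,
    mul_div_assoc, div_self (hpos b).ne', mul_one]

/-! ### Scaling, exponents and recovery -/

/-- The factor with which the basis is multiplied in the design matrix. -/
noncomputable def scale (m : ℕ) (B : Matrix (Fin d) (Fin d) ℝ) : ℝ :=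
  √m / (2 * √(d * ∑ i, ∑ j, B i j ^ 2))

theorem frobenius_pos (hd : 1 ≤ d) {B : Matrix (Fin d) (Fin d) ℝ} (hB : B.det ≠ 0) :
    0 < frobenius B := by
  have := binaryMinDist_pos hd hB
  have := binaryMinDist_le_frobenius hd B
  linarith

theorem scale_pos (hd : 1 ≤ d) (hm : 1 ≤ m) {B : Matrix (Fin d) (Fin d) ℝ} (hB : B.det ≠ 0) :
    0 < scale m B := by
  have h := frobenius_pos hd hB
  rw [frobenius, Real.sqrt_pos] at h
  unfold scale
  positivity

theorem scale_mul (hd : 1 ≤ d) {B : Matrix (Fin d) (Fin d) ℝ} (hB : B.det ≠ 0) :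
    scale m B * (√d * frobenius B) = √m / 2 := by
  have h := frobenius_pos hd hB
  have hd1 : 0 < √(d : ℝ) := Real.sqrt_pos.2 (by exact_mod_cast hd)
  rw [scale, Real.sqrt_mul (Nat.cast_nonneg d)]
  change √(m : ℝ) / (2 * (√d * frobenius B)) * (√d * frobenius B) = √m / 2
  field_simp

/-- The exponents in the bound on the noise match those in the prediction error. -/
theorem noise_factor_le {K β : ℝ} (hK : 0 < K) (hβ : 0 < β) (hβ2 : β ≤ 2) (hd : 1 ≤ d)
    (hk1 : 1 ≤ k) (hk : k ≤ d) {B : Matrix (Fin d) (Fin d) ℝ} (hB : B.det ≠ 0) :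
    √K * d * (1 / (7200 * √K) * ((k : ℝ) ^ (1 - β / 2) /
        ((d : ℝ) ^ (5 - 2 * β) * BinaryBDD.condNumber B ^ (2 - β)))) ≤
      eigenvalueBound B ^ (1 - β / 2) / 8 := by
  have hκ := one_le_condNumber hd hB
  set κ := BinaryBDD.condNumber B
  have hκ0 : 0 < κ := by linarith
  have hd0 : (0 : ℝ) < d := by exact_mod_cast hd
  have hk0 : (0 : ℝ) < k := by exact_mod_cast hk1
  have hkd : (k : ℝ) ≤ d := by exact_mod_cast hk
  have hK0 : 0 < √K := Real.sqrt_pos.2 hK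
  -- In terms of `p ∈ [0, 1]` the exponents are `5 - 2 β = 1 + 4 p` and `2 - β = 2 p`.
  obtain ⟨p, hp⟩ : ∃ p, p = 1 - β / 2 := ⟨_, rfl⟩
  have hp0 : 0 ≤ p := by linarith
  have hp1 : p ≤ 1 := by linarith
  rw [eigenvalueBound, show 5 - 2 * β = 1 + 4 * p by linarith, show 2 - β = 2 * p by linarith,
    ← hp, Real.rpow_add hd0, Real.rpow_one, Real.rpow_mul hd0.le, Real.rpow_mul hκ0.le,
    Real.div_rpow zero_le_one (by positivity), Real.one_rpow]
  norm_num only [Real.rpow_ofNat]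
  -- The bound `k ≤ d` spends one of the four powers of `d` raised to `p`, and `900 ^ p ≤ 900`. With
  -- the factor `8` of the decoding margin this explains `7200`.
  have h1 : (k : ℝ) ^ p * (900 * (d : ℝ) ^ 3 * κ ^ 2) ^ p ≤
      900 * (((d : ℝ) ^ 4) ^ p * (κ ^ 2) ^ p) := by
    rw [← Real.mul_rpow hk0.le (by positivity)]
    calc ((k : ℝ) * (900 * (d : ℝ) ^ 3 * κ ^ 2)) ^ p
        ≤ (900 * ((d : ℝ) ^ 4 * κ ^ 2)) ^ p := by
          refine Real.rpow_le_rpow (by positivity) ?_ hp0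
          have : 0 ≤ (d : ℝ) ^ 3 * κ ^ 2 := by positivity
          nlinarith
      _ = 900 ^ p * (((d : ℝ) ^ 4) ^ p * (κ ^ 2) ^ p) := by
          rw [Real.mul_rpow (by norm_num) (by positivity),
            Real.mul_rpow (by positivity) (by positivity)]
      _ ≤ _ := by
          refine mul_le_mul_of_nonneg_right ?_ (by positivity)
          calc (900 : ℝ) ^ p ≤ 900 ^ (1 : ℝ) :=
                Real.rpow_le_rpow_of_exponent_le (by norm_num) hp1
            _ = 900 := Real.rpow_one _
  have h2 : 0 < (900 * (d : ℝ) ^ 3 * κ ^ 2) ^ p := by positivity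
  have h3 : 0 < ((d : ℝ) ^ 4) ^ p * (κ ^ 2) ^ p := by positivity
  have h4 : √K * d * (1 / (7200 * √K) * ((k : ℝ) ^ p / (d * ((d : ℝ) ^ 4) ^ p * (κ ^ 2) ^ p))) =
      (k : ℝ) ^ p / (7200 * (((d : ℝ) ^ 4) ^ p * (κ ^ 2) ^ p)) := by
    field_simp
  rw [h4, div_div, div_le_div_iff₀ (by positivity) (by positivity)]
  nlinarith

/-- Solving the sparse regression instance that belongs to a binary decoding instance with small
noise reveals the sign vector. -/
theorem recover_signVector {K β : ℝ} (hK : 0 < K) (hβ : 0 < β) (hβ2 : β ≤ 2) (hd : 1 ≤ d)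
    (hk : k * D = d) (hm : 2 * d ≤ m) {B : Matrix (Fin d) (Fin d) ℝ} (hB : B.det ≠ 0)
    {z : Fin d → ℝ} (hz : z ∈ BinaryBDD.signVectors d) {e : Fin d → ℝ}
    (he : norm2 e ≤ 1 / (7200 * √K) * ((k : ℝ) ^ (1 - β / 2) /
      ((d : ℝ) ^ (5 - 2 * β) * BinaryBDD.condNumber B ^ (2 - β))) * BinaryBDD.binaryMinDist B)
    {X : Matrix (Fin m) (Fin (k * 2 ^ D)) ℝ} (hX : X = design m k D (scale m B) (√m / 2) B)
    {y : Fin m → ℝ}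
    (hy : y = stack m (scale m B • (B.mulVec z + e)) (fun _ : Fin k => √m / 2))
    {θ' : Fin (k * 2 ^ D) → ℝ}
    (H : ∀ (θ : Fin (k * 2 ^ D) → ℝ) (w : Fin m → ℝ) (ζ ε : ℝ), 0 < ζ → 0 < ε → ε ≤ 2 →
      θ ≠ 0 → IsSparse k θ → RestrictedEigenvalue ζ ε X (supp θ) → X.mulVec θ + w = y →
        IsSparse k θ' ∧ 1 / (m : ℝ) * norm2 (X.mulVec θ' - X.mulVec θ) ^ 2 ≤
          K * (norm2 w ^ 2 * (k : ℝ) ^ 2 / (ζ ^ (2 - β) * ε ^ 2 * m))) (l : Fin d) :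
    (gadget d k D).mulVec θ' l /
      √((gadget d k D).mulVec θ' l * (gadget d k D).mulVec θ' l) = z l := by
  subst hX
  have hD1 : 1 ≤ D := Nat.one_le_iff_ne_zero.2 fun h => by simp [h] at hk; omega
  have hk1 : 1 ≤ k := Nat.one_le_iff_ne_zero.2 fun h => by simp [h] at hk; omega
  have hkd : k ≤ d := by nlinarith
  have hm0 : (0 : ℝ) < m := by exact_mod_cast (by omega : 0 < m)
  have hD0 : (0 : ℝ) < D := by exact_mod_cast hD1
  have hdm : d + k ≤ m := by omega
  obtain ⟨σ, hσ⟩ := exists_selector hk z hz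
  have hs := scale_pos (m := m) hd (by omega) hB
  have hsW := scale_mul (m := m) hd hB
  have hζ := eigenvalueBound_pos hd hB
  have hlam := binaryMinDist_pos hd hB
  have hnf := noise_factor_le hK hβ hβ2 hd hk1 hkd hB
  set C := 1 / (7200 * √K) * ((k : ℝ) ^ (1 - β / 2) /
      ((d : ℝ) ^ (5 - 2 * β) * BinaryBDD.condNumber B ^ (2 - β)))
  set s := scale m B
  -- The block sums of a selector are exactly `1`, so the lower rows are noise-free and the noise is
  -- the scaled `e` alone. The cone parameter is `1 / D`, half of the gap in `block_bound`.
  obtain ⟨hθ', herr⟩ := H (selector σ) (stack m (s • e) (0 : Fin k → ℝ)) (eigenvalueBound B) (1 / D)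
    hζ (by positivity) (by
      have : 1 / (D : ℝ) ≤ 1 := (div_le_one hD0).2 (by exact_mod_cast hD1)
      linarith)
    (selector_ne_zero hk1 σ) (isSparse_selector σ)
    (restrictedEigenvalue_design hd hk hdm hB hsW rfl hs σ) (by
      rw [hy, design_mulVec, ← stack_add, hσ, blockSum_mulVec_selector, ← smul_add, add_zero]
      congr 1
      ext
      simp)
  refine sign_gadget_mulVec_eq hd hk hdm hB hsW (by positivity) hs hz hσ
    (blockSum_mulVec_selector σ) hθ' ?_ l
  set N := norm2 ((design m k D s (√m / 2) B).mulVec θ' -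
    (design m k D s (√m / 2) B).mulVec (selector σ))
  have hw : norm2 (stack m (s • e) (0 : Fin k → ℝ)) ^ 2 = (s * norm2 e) ^ 2 := by
    rw [norm2_stack_sq hdm, norm2_smul, abs_of_pos hs]
    simp [norm2]
  -- Naming the half power makes the denominator a square, so a root can be taken without further
  -- real exponents.
  obtain ⟨q, hq⟩ : ∃ q, q = eigenvalueBound B ^ (1 - β / 2) := ⟨_, rfl⟩
  have hq0 : 0 < q := hq ▸ Real.rpow_pos_of_pos hζ _
  have hq2 : eigenvalueBound B ^ (2 - β) = q ^ 2 := by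
    rw [hq, ← Real.rpow_mul_natCast hζ.le]
    norm_num [sub_mul]
  have hkD : (k : ℝ) * D = d := by exact_mod_cast hk
  -- The factor `k²` of the error bound and `1 / ε² = D²` combine to `d²`.
  have h1 : N ^ 2 ≤ (√K * d * (s * norm2 e) / q) ^ 2 := by
    rw [hw, hq2, one_div_mul_eq_div, div_le_iff₀ hm0] at herr
    refine herr.trans (le_of_eq ?_)
    rw [div_pow _ q, mul_pow (√K * d), mul_pow √K, Real.sq_sqrt hK.le, ← hkD]
    field_simp
  have h2 : N ≤ √K * d * (s * norm2 e) / q :=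
    le_of_sq_le_sq h1 (by have := norm2_nonneg e; positivity)
  refine h2.trans ?_
  rw [div_le_iff₀ hq0]
  rw [← hq] at hnf
  calc √K * d * (s * norm2 e) ≤ √K * d * (s * (C * BinaryBDD.binaryMinDist B)) := by gcongr
    _ = (√K * d * C) * (s * BinaryBDD.binaryMinDist B) := by ring
    _ ≤ q / 8 * (s * BinaryBDD.binaryMinDist B) :=
        mul_le_mul_of_nonneg_right hnf (by positivity)
    _ = _ := by ring

end SLR

namespace RealRAM

/-! ## Array names -/

/-- All array names in the expression are below this number. -/
def NExpr.bound : NExpr → ℕ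
  | .const _ => 0
  | .get a i => max (a + 1) i.bound
  | .add e f => max e.bound f.bound
  | .sub e f => max e.bound f.bound

/-- All array names in the expression are below this number. -/
def RExpr.bound : RExpr → ℕ
  | .ofNat e => e.bound
  | .get a i j => max (a + 1) (max i.bound j.bound)
  | .add e f => max e.bound f.bound
  | .sub e f => max e.bound f.bound
  | .mul e f => max e.bound f.bound
  | .div e f => max e.bound f.bound
  | .sqrt e => e.bound

/-- All array names in the test are below this number. -/
def Test.bound : Test → ℕ
  | .natLt e f => max e.bound f.bound
  | .realLt e f => max e.bound f.bound

/-- All array names in the program are below this number. -/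
def Prog.bound : Prog → ℕ
  | .skip => 0
  | .assignNat a i e => max (a + 1) (max i.bound e.bound)
  | .assignReal a i j e => max (a + 1) (max i.bound (max j.bound e.bound))
  | .sample a i j => max (a + 1) (max i.bound j.bound)
  | .seq p q => max p.bound q.bound
  | .ite b p q => max b.bound (max p.bound q.bound)
  | .loop b p => max b.bound p.bound

/-- The two memories agree on all arrays with names below `N`, and on the tape. -/
structure AgreeBelow (N : ℕ) (s s' : State) : Prop where
  nat : ∀ a < N, s.nat a = s'.nat a
  real : ∀ a < N, s.real a = s'.real a
  tape : s.tape = s'.tape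

/-- The two memories agree on all arrays with names at least `N`. -/
structure AgreeAbove (N : ℕ) (s s' : State) : Prop where
  nat : ∀ a, N ≤ a → s.nat a = s'.nat a
  real : ∀ a, N ≤ a → s.real a = s'.real a

variable {N : ℕ} {s s' s₁ s₂ : State}

theorem AgreeAbove.refl (s : State) : AgreeAbove N s s := ⟨fun _ _ => rfl, fun _ _ => rfl⟩

theorem AgreeAbove.trans (h : AgreeAbove N s s₁) (h' : AgreeAbove N s₁ s₂) : AgreeAbove N s s₂ :=
  ⟨fun a ha => (h.nat a ha).trans (h'.nat a ha), fun a ha => (h.real a ha).trans (h'.real a ha)⟩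

theorem AgreeBelow.eval_nexpr (h : AgreeBelow N s s') :
    ∀ {e : NExpr}, e.bound ≤ N → e.eval s = e.eval s'
  | .const _, _ => rfl
  | .get a i, hb => by
    simp only [NExpr.bound, max_le_iff] at hb
    rw [NExpr.eval, NExpr.eval, h.eval_nexpr hb.2, h.nat a hb.1]
  | .add e f, hb => by
    simp only [NExpr.bound, max_le_iff] at hb
    rw [NExpr.eval, NExpr.eval, h.eval_nexpr hb.1, h.eval_nexpr hb.2]
  | .sub e f, hb => by
    simp only [NExpr.bound, max_le_iff] at hb
    rw [NExpr.eval, NExpr.eval, h.eval_nexpr hb.1, h.eval_nexpr hb.2]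

theorem AgreeBelow.eval_rexpr (h : AgreeBelow N s s') :
    ∀ {e : RExpr}, e.bound ≤ N → e.eval s = e.eval s'
  | .ofNat e, hb => by rw [RExpr.eval, RExpr.eval, h.eval_nexpr hb]
  | .get a i j, hb => by
    simp only [RExpr.bound, max_le_iff] at hb
    rw [RExpr.eval, RExpr.eval, h.eval_nexpr hb.2.1, h.eval_nexpr hb.2.2, h.real a hb.1]
  | .add e f, hb => by
    simp only [RExpr.bound, max_le_iff] at hb
    rw [RExpr.eval, RExpr.eval, h.eval_rexpr hb.1, h.eval_rexpr hb.2]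
  | .sub e f, hb => by
    simp only [RExpr.bound, max_le_iff] at hb
    rw [RExpr.eval, RExpr.eval, h.eval_rexpr hb.1, h.eval_rexpr hb.2]
  | .mul e f, hb => by
    simp only [RExpr.bound, max_le_iff] at hb
    rw [RExpr.eval, RExpr.eval, h.eval_rexpr hb.1, h.eval_rexpr hb.2]
  | .div e f, hb => by
    simp only [RExpr.bound, max_le_iff] at hb
    rw [RExpr.eval, RExpr.eval, h.eval_rexpr hb.1, h.eval_rexpr hb.2]
  | .sqrt e, hb => congrArg Real.sqrt (h.eval_rexpr (e := e) hb)

theorem AgreeBelow.holds (h : AgreeBelow N s s') {b : Test} (hb : b.bound ≤ N) :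
    b.Holds s ↔ b.Holds s' := by
  cases b with
  | natLt e f =>
    simp only [Test.bound, max_le_iff] at hb
    rw [Test.Holds, Test.Holds, h.eval_nexpr hb.1, h.eval_nexpr hb.2]
  | realLt e f =>
    simp only [Test.bound, max_le_iff] at hb
    rw [Test.Holds, Test.Holds, h.eval_rexpr hb.1, h.eval_rexpr hb.2]

theorem AgreeBelow.setNat (h : AgreeBelow N s s') (a i v : ℕ) :
    AgreeBelow N (s.setNat a i v) (s'.setNat a i v) :=
  ⟨fun b hb => by simp only [State.setNat, h.nat b hb], h.real, h.tape⟩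

theorem AgreeBelow.setReal (h : AgreeBelow N s s') (a i j : ℕ) (v : ℝ) :
    AgreeBelow N (s.setReal a i j v) (s'.setReal a i j v) :=
  ⟨h.nat, fun b hb => by simp only [State.setReal, h.real b hb], h.tape⟩

theorem agreeAbove_setNat {a : ℕ} (ha : a < N) (s : State) (i v : ℕ) :
    AgreeAbove N (s.setNat a i v) s :=
  ⟨fun b hb => by
    funext i'
    simp [State.setNat, show b ≠ a by omega], fun _ _ => rfl⟩

theorem agreeAbove_setReal {a : ℕ} (ha : a < N) (s : State) (i j : ℕ) (v : ℝ) :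
    AgreeAbove N (s.setReal a i j v) s :=
  ⟨fun _ _ => rfl, fun b hb => by
    funext i' j'
    simp [State.setReal, show b ≠ a by omega]⟩

/-- A program neither sees nor changes arrays that it does not name. -/
theorem Exec.frame {p : Prog} {t : ℕ} (h : Exec p s t s₁) (hp : p.bound ≤ N)
    (hs : AgreeBelow N s s') :
    ∃ s₁', Exec p s' t s₁' ∧ AgreeBelow N s₁ s₁' ∧ AgreeAbove N s₁' s' := by
  induction h generalizing s' with
  | skip => exact ⟨s', .skip _, hs, .refl _⟩
  | assignNat s a i e =>
    simp only [Prog.bound, max_le_iff] at hp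
    refine ⟨_, .assignNat _ _ _ _, ?_, agreeAbove_setNat hp.1 _ _ _⟩
    rw [hs.eval_nexpr hp.2.1, hs.eval_nexpr hp.2.2]
    exact hs.setNat _ _ _
  | assignReal s a i j e =>
    simp only [Prog.bound, max_le_iff] at hp
    refine ⟨_, .assignReal _ _ _ _ _, ?_, agreeAbove_setReal hp.1 _ _ _ _⟩
    rw [hs.eval_nexpr hp.2.1, hs.eval_nexpr hp.2.2.1, hs.eval_rexpr hp.2.2.2]
    exact hs.setReal _ _ _ _
  | sample s a i j =>
    simp only [Prog.bound, max_le_iff] at hp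
    have h1 := agreeAbove_setReal hp.1 s' (i.eval s') (j.eval s') (s'.tape 0)
    refine ⟨_, .sample _ _ _ _, ?_, ⟨h1.nat, h1.real⟩⟩
    rw [hs.eval_nexpr hp.2.1, hs.eval_nexpr hp.2.2, hs.tape]
    have h2 := hs.setReal a (i.eval s') (j.eval s') (s'.tape 0)
    exact ⟨h2.nat, h2.real, by simp only [State.advance, h2.tape]⟩
  | seq _ _ ih₁ ih₂ =>
    simp only [Prog.bound, max_le_iff] at hp
    obtain ⟨_, h1, h2, h3⟩ := ih₁ hp.1 hs
    obtain ⟨_, h4, h5, h6⟩ := ih₂ hp.2 h2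
    exact ⟨_, .seq h1 h4, h5, h6.trans h3⟩
  | iteTrue hb _ ih =>
    simp only [Prog.bound, max_le_iff] at hp
    obtain ⟨_, h1, h2, h3⟩ := ih hp.2.1 hs
    exact ⟨_, .iteTrue ((hs.holds hp.1).1 hb) h1, h2, h3⟩
  | iteFalse hb _ ih =>
    simp only [Prog.bound, max_le_iff] at hp
    obtain ⟨_, h1, h2, h3⟩ := ih hp.2.2 hs
    exact ⟨_, .iteFalse (fun h => hb ((hs.holds hp.1).2 h)) h1, h2, h3⟩
  | loopTrue hb _ _ ih₁ ih₂ =>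
    have hp' := hp
    simp only [Prog.bound, max_le_iff] at hp
    obtain ⟨_, h1, h2, h3⟩ := ih₁ hp.2 hs
    obtain ⟨_, h4, h5, h6⟩ := ih₂ hp' h2
    exact ⟨_, .loopTrue ((hs.holds hp.1).1 hb) h1 h4, h5, h6.trans h3⟩
  | loopFalse hb =>
    simp only [Prog.bound, max_le_iff] at hp
    exact ⟨_, .loopFalse fun h => hb ((hs.holds hp.1).2 h), hs, .refl _⟩

/-! ### Which arrays a program can change -/

/-- The program may write into the array of naturals `a`. -/
def Prog.WritesNat (a : ℕ) : Prog → Prop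
  | .skip => False
  | .assignNat a' _ _ => a = a'
  | .assignReal _ _ _ _ => False
  | .sample _ _ _ => False
  | .seq p q => p.WritesNat a ∨ q.WritesNat a
  | .ite _ p q => p.WritesNat a ∨ q.WritesNat a
  | .loop _ p => p.WritesNat a

/-- The program may write into the array of reals `a`. -/
def Prog.WritesReal (a : ℕ) : Prog → Prop
  | .skip => False
  | .assignNat _ _ _ => False
  | .assignReal a' _ _ _ => a = a'
  | .sample a' _ _ => a = a'
  | .seq p q => p.WritesReal a ∨ q.WritesReal a
  | .ite _ p q => p.WritesReal a ∨ q.WritesReal a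
  | .loop _ p => p.WritesReal a

theorem Exec.nat_eq {p : Prog} {t : ℕ} (h : Exec p s t s₁) {a : ℕ} (ha : ¬ p.WritesNat a) :
    s₁.nat a = s.nat a := by
  induction h with
  | skip | assignReal | sample | loopFalse => rfl
  | assignNat =>
    simp only [Prog.WritesNat] at ha
    simp [State.setNat, ha]
  | seq _ _ ih₁ ih₂ =>
    simp only [Prog.WritesNat, not_or] at ha
    exact (ih₂ ha.2).trans (ih₁ ha.1)
  | iteTrue _ _ ih =>
    simp only [Prog.WritesNat, not_or] at ha
    exact ih ha.1
  | iteFalse _ _ ih =>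
    simp only [Prog.WritesNat, not_or] at ha
    exact ih ha.2
  | loopTrue _ _ _ ih₁ ih₂ => exact (ih₂ ha).trans (ih₁ ha)

theorem Exec.real_eq {p : Prog} {t : ℕ} (h : Exec p s t s₁) {a : ℕ} (ha : ¬ p.WritesReal a) :
    s₁.real a = s.real a := by
  induction h with
  | skip | assignNat | loopFalse => rfl
  | assignReal =>
    simp only [Prog.WritesReal] at ha
    simp [State.setReal, ha]
  | sample =>
    simp only [Prog.WritesReal] at ha
    simp [State.advance, State.setReal, ha]
  | seq _ _ ih₁ ih₂ =>
    simp only [Prog.WritesReal, not_or] at ha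
    exact (ih₂ ha.2).trans (ih₁ ha.1)
  | iteTrue _ _ ih =>
    simp only [Prog.WritesReal, not_or] at ha
    exact ih ha.1
  | iteFalse _ _ ih =>
    simp only [Prog.WritesReal, not_or] at ha
    exact ih ha.2
  | loopTrue _ _ _ ih₁ ih₂ => exact (ih₂ ha).trans (ih₁ ha)

/-! ## Running times and results -/

/-- Started in `s`, the program halts within `T` steps in a memory that satisfies `Q`. -/
def Prog.Runs (p : Prog) (s : State) (T : ℕ) (Q : State → Prop) : Prop :=
  ∃ t s', Exec p s t s' ∧ t ≤ T ∧ Q s'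

theorem Prog.Runs.mono {p : Prog} {T T' : ℕ} {Q Q' : State → Prop} (h : p.Runs s T Q)
    (hT : T ≤ T') (hQ : ∀ s', Q s' → Q' s') : p.Runs s T' Q' :=
  let ⟨t, s', h1, h2, h3⟩ := h
  ⟨t, s', h1, h2.trans hT, hQ s' h3⟩

/-- Arrays that are not written into are unchanged. -/
theorem Prog.Runs.frame {p : Prog} {T : ℕ} {Q : State → Prop} (h : p.Runs s T Q) :
    p.Runs s T fun s' => Q s' ∧ (∀ a, ¬ p.WritesNat a → s'.nat a = s.nat a) ∧
      ∀ a, ¬ p.WritesReal a → s'.real a = s.real a :=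
  let ⟨t, s', h1, h2, h3⟩ := h
  ⟨t, s', h1, h2, h3, fun _ ha => h1.nat_eq ha, fun _ ha => h1.real_eq ha⟩

/-- Brings time bounds to a common power of `M + 1`, so that `Prog.Runs.seq` can add their
coefficients. -/
theorem Prog.Runs.raise {p : Prog} {a M i j : ℕ} {Q : State → Prop}
    (h : p.Runs s (a * (M + 1) ^ i) Q) (hij : i ≤ j) : p.Runs s (a * (M + 1) ^ j) Q :=
  h.mono (Nat.mul_le_mul_left _ (Nat.pow_le_pow_right (Nat.succ_pos M) hij)) fun _ h => h

theorem Prog.Runs.seq {p q : Prog} {a b W : ℕ} {Q R : State → Prop} (h : p.Runs s (a * W) Q)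
    (h' : ∀ s₁, Q s₁ → q.Runs s₁ (b * W) R) : (Prog.seq p q).Runs s ((a + b) * W) R := by
  obtain ⟨t, s₁, h1, h2, h3⟩ := h
  obtain ⟨t', s₂, h4, h5, h6⟩ := h' s₁ h3
  exact ⟨_, _, .seq h1 h4, by rw [add_mul]; exact add_le_add h2 h5, h6⟩

/-! ### Counted loops, filling and accumulating arrays -/

/-- The scalar in cell `0` of the array of naturals `v`. -/
abbrev NExpr.var (v : ℕ) : NExpr := .get v (.const 0)

/-- For all values of the scalar `v` from `0` up to the scalar `u`, run `p`. -/
def forLoop (v u : ℕ) (p : Prog) : Prog :=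
  .seq (.assignNat v (.const 0) (.const 0))
    (.loop (.natLt (.var v) (.var u))
      (.seq p (.assignNat v (.const 0) (.add (.var v) (.const 1)))))

theorem writesNat_forLoop {v u a : ℕ} {p : Prog} :
    (forLoop v u p).WritesNat a ↔ a = v ∨ p.WritesNat a := by
  simp only [forLoop, Prog.WritesNat]
  tauto

theorem writesReal_forLoop {v u a : ℕ} {p : Prog} :
    (forLoop v u p).WritesReal a ↔ p.WritesReal a := by
  simp [forLoop, Prog.WritesReal]

theorem State.setNat_real (s : State) (a i v : ℕ) : (s.setNat a i v).real = s.real := rfl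

theorem State.setReal_real (s : State) (a i j : ℕ) (v : ℝ) (a' i' j' : ℕ) :
    (s.setReal a i j v).real a' i' j' =
      if a' = a ∧ i' = i ∧ j' = j then v else s.real a' i' j' := rfl

/-- The memories agree on all arrays of naturals, except possibly `v`, and on all arrays of reals,
that `p` does not write into. -/
structure Unchanged (v : ℕ) (p : Prog) (s s' : State) : Prop where
  nat : ∀ a, a ≠ v → ¬ p.WritesNat a → s'.nat a = s.nat a
  real : ∀ a, ¬ p.WritesReal a → s'.real a = s.real a

/-- The invariant must survive a change of the counter, since the loop itself sets and increments it
outside the body. The summand `11` is the cost of one test and one increment. -/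
theorem forLoop_runs {v u n T M : ℕ} {p : Prog} {I : ℕ → State → Prop} (hv : ¬ p.WritesNat v)
    (hu : ¬ p.WritesNat u) (huv : u ≠ v) (hn : s.nat u 0 = n) (hM : n ≤ M)
    (hI : ∀ i s' x, I i s' → I i (s'.setNat v 0 x)) (h0 : I 0 s)
    (hstep : ∀ i < n, ∀ s', Unchanged v p s s' → s'.nat v 0 = i → I i s' →
      p.Runs s' T (I (i + 1))) :
    (forLoop v u p).Runs s ((T + 11) * (M + 1)) (I n) := by
  have key : ∀ r i s', i + r = n → Unchanged v p s s' → s'.nat v 0 = i → I i s' →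
      ∃ t s'', Exec (.loop (.natLt (.var v) (.var u))
        (.seq p (.assignNat v (.const 0) (.add (.var v) (.const 1))))) s' t s'' ∧
        t ≤ r * (T + 11) + 5 ∧ I n s'' := by
    intro r
    induction r with
    | zero =>
      intro i s' hi hF hvi hIi
      refine ⟨_, s', .loopFalse ?_, by simp [Test.cost, NExpr.cost], by simpa [← hi] using hIi⟩
      simp only [Test.Holds, NExpr.eval, hF.nat u huv hu, hn, hvi]
      omega
    | succ r ih =>
      intro i s' hi hF hvi hIi
      obtain ⟨t₁, s₁, h1, h2, h3⟩ := hstep i (by omega) s' hF hvi hIi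
      have hv1 : s₁.nat v 0 = i := by rw [h1.nat_eq hv, hvi]
      have hex := Exec.assignNat s₁ v (.const 0) (.add (.var v) (.const 1))
      simp only [NExpr.eval, hv1] at hex
      obtain ⟨t₂, s₂, h4, h5, h6⟩ := ih (i + 1) (s₁.setNat v 0 (i + 1)) (by omega)
        ⟨fun a ha ha' => by
          rw [← hF.nat a ha ha', ← h1.nat_eq ha']
          funext x
          simp [State.setNat, ha],
         fun a ha => (h1.real_eq ha).trans (hF.real a ha)⟩
        (by simp [State.setNat]) (hI _ _ _ h3)
      refine ⟨_, s₂, .loopTrue ?_ (.seq h1 hex) h4, ?_, h6⟩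
      · simp only [Test.Holds, NExpr.eval, hF.nat u huv hu, hn, hvi]
        omega
      · simp only [Test.cost, NExpr.cost, add_mul]
        omega
  have hex := Exec.assignNat s v (.const 0) (.const 0)
  simp only [NExpr.eval] at hex
  obtain ⟨t, s₁, h1, h2, h3⟩ := key n 0 (s.setNat v 0 0) (by omega)
    ⟨fun a ha _ => by funext x; simp [State.setNat, ha], fun _ _ => rfl⟩
    (by simp [State.setNat]) (hI _ _ _ h0)
  refine ⟨_, s₁, .seq hex h1, ?_, h3⟩
  -- The extra round in `M + 1` pays for the initialization and the final failing test.
  have h4 : n * (T + 11) ≤ M * (T + 11) := Nat.mul_le_mul_right _ hM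
  rw [mul_add, mul_comm (T + 11) M]
  simp only [NExpr.cost]
  omega

/-- For all `i, j` below the scalars `u₁, u₂`, write `e` into cell `(o + i, j)` of the array of
reals `a`; here `v₁, v₂` hold `i` and `j`. -/
def fill (v₁ u₁ v₂ u₂ a : ℕ) (o : NExpr) (e : RExpr) : Prog :=
  forLoop v₁ u₁ (forLoop v₂ u₂ (.assignReal a (.add o (.var v₁)) (.var v₂) e))

/-- The number of steps of the assignment in `fill`. -/
def fillCost (o : NExpr) (e : RExpr) : ℕ := o.cost + e.cost + 50

/-- Cell `(p, q)` of an array during the execution of `fill`, just before cell `(o + i, j)` is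
written. -/
noncomputable def partialFill (o n₂ : ℕ) (f g : ℕ → ℕ → ℝ) (i j p q : ℕ) : ℝ :=
  if o ≤ p ∧ q < n₂ ∧ (p - o < i ∨ p - o = i ∧ q < j) then f (p - o) q else g p q

/-- The memory during the execution of `fill`. -/
structure FillState (v₁ v₂ a o n₂ : ℕ) (f : ℕ → ℕ → ℝ) (s : State) (i j : ℕ) (s' : State) :
    Prop where
  nat : ∀ x, x ≠ v₁ → x ≠ v₂ → s'.nat x = s.nat x
  real : ∀ x, x ≠ a → s'.real x = s.real x
  cell : ∀ p q, s'.real a p q = partialFill o n₂ f (s.real a) i j p q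

/-- The expression is evaluated in a memory described by `FillState`, so it may read cells of the
array being filled: earlier ones hold new values, the current and later ones still hold the old.
Both `accumulate` and `signRows` depend on this. -/
theorem fill_runs {v₁ u₁ v₂ u₂ a n₁ n₂ M o' : ℕ} {o : NExpr} {e : RExpr} {f : ℕ → ℕ → ℝ}
    (hv : v₁ ≠ v₂) (hu₁ : u₁ ≠ v₁) (hu₁' : u₁ ≠ v₂) (hu₂ : u₂ ≠ v₁) (hu₂' : u₂ ≠ v₂)
    (hn₁ : s.nat u₁ 0 = n₁) (hn₂ : s.nat u₂ 0 = n₂) (hM₁ : n₁ ≤ M) (hM₂ : n₂ ≤ M)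
    (ho : ∀ s' : State, (∀ x, x ≠ v₁ → x ≠ v₂ → s'.nat x = s.nat x) → o.eval s' = o')
    (he : ∀ i < n₁, ∀ j < n₂, ∀ s', FillState v₁ v₂ a o' n₂ f s i j s' → s'.nat v₁ 0 = i →
      s'.nat v₂ 0 = j → e.eval s' = f i j) :
    (fill v₁ u₁ v₂ u₂ a o e).Runs s (fillCost o e * (M + 1) ^ 2)
      (FillState v₁ v₂ a o' n₂ f s n₁ 0) := by
  have hset : ∀ i j s' x, FillState v₁ v₂ a o' n₂ f s i j s' →
      FillState v₁ v₂ a o' n₂ f s i j (s'.setNat v₁ 0 x) := fun i j s' x h =>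
    ⟨fun y hy hy' => by rw [← h.nat y hy hy']; funext z; simp [State.setNat, hy],
      h.real, h.cell⟩
  have hset' : ∀ i j s' x, FillState v₁ v₂ a o' n₂ f s i j s' →
      FillState v₁ v₂ a o' n₂ f s i j (s'.setNat v₂ 0 x) := fun i j s' x h =>
    ⟨fun y hy hy' => by rw [← h.nat y hy hy']; funext z; simp [State.setNat, hy'],
      h.real, h.cell⟩
  have h := forLoop_runs (s := s) (v := v₁) (u := u₁) (n := n₁) (M := M)
    (T := (o.cost + e.cost + 6 + 11) * (M + 1))
    (p := forLoop v₂ u₂ (.assignReal a (.add o (.var v₁)) (.var v₂) e))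
    (I := fun i => FillState v₁ v₂ a o' n₂ f s i 0)
    (by simp [writesNat_forLoop, Prog.WritesNat, hv])
    (by simp [writesNat_forLoop, Prog.WritesNat, hu₁']) hu₁ hn₁ hM₁ (fun i => hset i 0)
    ⟨fun _ _ _ => rfl, fun _ _ => rfl, fun p q => by simp [partialFill]⟩ (by
      intro i hi s₁ _ hv1 hF
      refine (forLoop_runs (M := M) (T := o.cost + e.cost + 6) (n := n₂)
        (I := fun j s' => s'.nat v₁ 0 = i ∧ FillState v₁ v₂ a o' n₂ f s i j s')
        (by simp [Prog.WritesNat]) (by simp [Prog.WritesNat]) hu₂'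
        (by rw [hF.nat u₂ hu₂ hu₂', hn₂]) hM₂ ?_ ⟨hv1, hF⟩ ?_).mono le_rfl ?_
      · rintro j s' x ⟨h1, h2⟩
        exact ⟨by simp [State.setNat, hv, h1], hset' _ _ _ _ h2⟩
      · rintro j hj s₂ - hv2 ⟨h1, h2⟩
        refine ⟨_, _, .assignReal _ _ _ _ _, ?_, ?_⟩
        · simp only [NExpr.cost]
          omega
        · have hee := he i hi j hj s₂ h2 h1 hv2
          have hoo := ho s₂ h2.nat
          simp only [NExpr.eval, hee, hoo, h1, hv2]
          refine ⟨h1, h2.nat, fun x hx => ?_, fun p q => ?_⟩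
          · rw [← h2.real x hx]
            funext p q
            simp [State.setReal, hx]
          · rw [State.setReal_real]
            simp only [true_and]
            by_cases hc : p = o' + i ∧ q = j
            · rw [if_pos hc, partialFill, if_pos (by omega), hc.1, hc.2, Nat.add_sub_cancel_left]
            · rw [if_neg hc, h2.cell, partialFill, partialFill]
              exact if_congr (by omega) rfl rfl
      · rintro s' ⟨-, h⟩
        refine ⟨h.nat, h.real, fun p q => ?_⟩
        rw [h.cell, partialFill, partialFill]
        exact if_congr (by omega) rfl rfl)
  refine h.mono ?_ fun _ h => h
  rw [fillCost]
  nlinarith [Nat.zero_le M]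

theorem FillState.apply {v₁ v₂ a o n₁ n₂ : ℕ} {f : ℕ → ℕ → ℝ}
    (h : FillState v₁ v₂ a o n₂ f s n₁ 0 s') {i j : ℕ} (hi : i < n₁) (hj : j < n₂) :
    s'.real a (o + i) j = f i j := by
  rw [h.cell, partialFill, if_pos (by omega), Nat.add_sub_cancel_left]

theorem FillState.apply_zero {v₁ v₂ a n₁ n₂ : ℕ} {f : ℕ → ℕ → ℝ}
    (h : FillState v₁ v₂ a 0 n₂ f s n₁ 0 s') {i j : ℕ} (hi : i < n₁) (hj : j < n₂) :
    s'.real a i j = f i j := by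
  simpa using h.apply hi hj

/-- The current cell still has its original value. -/
theorem FillState.current {v₁ v₂ a o n₂ : ℕ} {f : ℕ → ℕ → ℝ} {i j : ℕ}
    (h : FillState v₁ v₂ a o n₂ f s i j s') : s'.real a (o + i) j = s.real a (o + i) j := by
  rw [h.cell, partialFill, if_neg (by omega)]

/-- For all `l` below the scalar `u₀`, add `e` to all cells `(i, j)` of the array of reals `a`. -/
def accumulate (v₀ u₀ v₁ u₁ v₂ u₂ a : ℕ) (e : RExpr) : Prog :=
  forLoop v₀ u₀ (fill v₁ u₁ v₂ u₂ a (.const 0) (.add (.get a (.var v₁) (.var v₂)) e))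

/-- The memory after `l` rounds of `accumulate`. -/
structure AccumulateState (v₀ v₁ v₂ a n₁ n₂ : ℕ) (g : ℕ → ℕ → ℕ → ℝ) (s : State) (l : ℕ)
    (s' : State) : Prop where
  nat : ∀ x, x ≠ v₀ → x ≠ v₁ → x ≠ v₂ → s'.nat x = s.nat x
  real : ∀ x, x ≠ a → s'.real x = s.real x
  cell : ∀ i < n₁, ∀ j < n₂, s'.real a i j = ∑ r ∈ Finset.range l, g r i j

/-- Round `l` is one `fill` that adds the `l`-th summand to all cells, so partial sums form the
invariant. The cells have to be zero at the start. -/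
theorem accumulate_runs {v₀ u₀ v₁ u₁ v₂ u₂ a n₀ n₁ n₂ M : ℕ} {e : RExpr} {g : ℕ → ℕ → ℕ → ℝ}
    (h01 : v₀ ≠ v₁) (h02 : v₀ ≠ v₂) (h12 : v₁ ≠ v₂)
    (hu₀ : u₀ ≠ v₀ ∧ u₀ ≠ v₁ ∧ u₀ ≠ v₂) (hu₁ : u₁ ≠ v₀ ∧ u₁ ≠ v₁ ∧ u₁ ≠ v₂)
    (hu₂ : u₂ ≠ v₀ ∧ u₂ ≠ v₁ ∧ u₂ ≠ v₂)
    (hn₀ : s.nat u₀ 0 = n₀) (hn₁ : s.nat u₁ 0 = n₁) (hn₂ : s.nat u₂ 0 = n₂)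
    (hM₀ : n₀ ≤ M) (hM₁ : n₁ ≤ M) (hM₂ : n₂ ≤ M)
    (hzero : ∀ i < n₁, ∀ j < n₂, s.real a i j = 0)
    (he : ∀ l < n₀, ∀ i < n₁, ∀ j < n₂, ∀ s' : State,
      (∀ x, x ≠ v₀ → x ≠ v₁ → x ≠ v₂ → s'.nat x = s.nat x) →
      (∀ x, x ≠ a → s'.real x = s.real x) →
      s'.nat v₀ 0 = l → s'.nat v₁ 0 = i → s'.nat v₂ 0 = j → e.eval s' = g l i j) :
    (accumulate v₀ u₀ v₁ u₁ v₂ u₂ a e).Runs s ((e.cost + 100) * (M + 1) ^ 3)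
      (AccumulateState v₀ v₁ v₂ a n₁ n₂ g s n₀) := by
  have h := forLoop_runs (s := s) (v := v₀) (u := u₀) (n := n₀) (M := M)
    (T := fillCost (.const 0) (.add (.get a (.var v₁) (.var v₂)) e) * (M + 1) ^ 2)
    (p := fill v₁ u₁ v₂ u₂ a (.const 0) (.add (.get a (.var v₁) (.var v₂)) e))
    (I := AccumulateState v₀ v₁ v₂ a n₁ n₂ g s)
    (by simp [fill, writesNat_forLoop, Prog.WritesNat, h01, h02])
    (by simp [fill, writesNat_forLoop, Prog.WritesNat, hu₀]) hu₀.1 hn₀ hM₀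
    (fun l s' x h => ⟨fun y hy hy1 hy2 => by
      rw [← h.nat y hy hy1 hy2]; funext z; simp [State.setNat, hy], h.real, h.cell⟩)
    ⟨fun _ _ _ _ => rfl, fun _ _ => rfl, fun i hi j hj => by simp [hzero i hi j hj]⟩ (by
      intro l hl s₁ _ hv0 hA
      refine (fill_runs (o' := 0) (M := M) (n₁ := n₁) (n₂ := n₂)
        (f := fun i j => ∑ r ∈ Finset.range (l + 1), g r i j)
        h12 hu₁.2.1 hu₁.2.2 hu₂.2.1 hu₂.2.2
        (by rw [hA.nat u₁ hu₁.1 hu₁.2.1 hu₁.2.2, hn₁])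
        (by rw [hA.nat u₂ hu₂.1 hu₂.2.1 hu₂.2.2, hn₂]) hM₁ hM₂ (fun _ _ => rfl) ?_).mono le_rfl ?_
      · intro i hi j hj s₂ hF h1 h2
        -- The current cell has not been overwritten in this round, so reading it gives the previous
        -- partial sum.
        have hcur := hF.current
        rw [zero_add] at hcur
        simp only [RExpr.eval, NExpr.eval, h1, h2, hcur, hA.cell i hi j hj,
          Finset.sum_range_succ]
        congr 1
        exact he l hl i hi j hj s₂
          (fun x hx hx1 hx2 => by rw [hF.nat x hx1 hx2, hA.nat x hx hx1 hx2])
          (fun x hx => by rw [hF.real x hx, hA.real x hx])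
          (by rw [hF.nat v₀ h01 h02, hv0]) h1 h2
      · intro s₂ hF
        exact ⟨fun x hx hx1 hx2 => by rw [hF.nat x hx1 hx2, hA.nat x hx hx1 hx2],
          fun x hx => by rw [hF.real x hx, hA.real x hx], fun i hi j hj => hF.apply_zero hi hj⟩)
  refine h.mono ?_ fun _ h => h
  simp only [fillCost, NExpr.cost, RExpr.cost]
  have h1 : 1 ≤ (M + 1) ^ 2 := Nat.one_le_pow _ _ (by omega)
  calc ((1 + (1 + 1 + (1 + 1) + 1 + e.cost + 1) + 50) * (M + 1) ^ 2 + 11) * (M + 1)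
      ≤ ((e.cost + 100) * (M + 1) ^ 2) * (M + 1) := by
        refine Nat.mul_le_mul_right _ ?_
        nlinarith
    _ = _ := by ring

end RealRAM

namespace RealRAM

variable {N : ℕ} {s s' s₁ s₂ : State}

/-! ## Tables of quotients and remainders -/

/-- For all `j` up to the scalar `u`, write the quotient and the remainder of `j` by the scalar `q`
into the arrays of naturals `b` and `r`. -/
def divTable (v u q b r : ℕ) : Prog :=
  forLoop v u (.ite (.natLt (.add (.get r (.var v)) (.const 1)) (.var q))
    (.seq (.assignNat b (.add (.var v) (.const 1)) (.get b (.var v)))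
      (.assignNat r (.add (.var v) (.const 1)) (.add (.get r (.var v)) (.const 1))))
    (.seq (.assignNat b (.add (.var v) (.const 1)) (.add (.get b (.var v)) (.const 1)))
      (.assignNat r (.add (.var v) (.const 1)) (.const 0))))

/-- Passing from `i` to `i + 1`, the remainder either grows by one or wraps to zero and carries into
the quotient; so tables need no division. -/
theorem div_mod_succ {i q : ℕ} (hq : 1 ≤ q) :
    (i % q + 1 < q → (i + 1) / q = i / q ∧ (i + 1) % q = i % q + 1) ∧
      (¬ i % q + 1 < q → (i + 1) / q = i / q + 1 ∧ (i + 1) % q = 0) := by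
  have h := Nat.mod_add_div i q
  have h' := Nat.mod_lt i hq
  refine ⟨fun hlt => (Nat.div_mod_unique hq).2 ⟨by omega, hlt⟩,
    fun hlt => (Nat.div_mod_unique hq).2 ⟨?_, hq⟩⟩
  rw [mul_add]
  omega

/-- Round `i` writes entry `i + 1`. Entry `0` is never written, and its correct value is the initial
zero. -/
theorem divTable_runs {v u q b r n c M : ℕ} (hvb : v ≠ b) (hvr : v ≠ r) (hub : u ≠ b) (hur : u ≠ r)
    (huv : u ≠ v) (hqv : q ≠ v) (hqb : q ≠ b) (hqr : q ≠ r) (hbr : b ≠ r)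
    (hn : s.nat u 0 = n) (hM : n ≤ M) (hq : s.nat q 0 = c) (hc : 1 ≤ c) (hb : s.nat b 0 = 0)
    (hr : s.nat r 0 = 0) :
    (divTable v u q b r).Runs s (60 * (M + 1) ^ 1)
      fun s' => ∀ j ≤ n, s'.nat b j = j / c ∧ s'.nat r j = j % c := by
  refine (forLoop_runs (M := M) (T := 49) (n := n)
    (I := fun i s' => ∀ j ≤ i, s'.nat b j = j / c ∧ s'.nat r j = j % c)
    (by simp [Prog.WritesNat, hvb, hvr]) (by simp [Prog.WritesNat, hub, hur]) huv hn hM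
    ?_ ?_ ?_).mono (by simp) fun _ h => h
  · intro i s' x h j hj
    simpa [State.setNat, hvb.symm, hvr.symm] using h j hj
  · intro j hj
    obtain rfl : j = 0 := by omega
    simp [hb, hr]
  · intro i hi s₁ hU hv hI
    have hq1 : s₁.nat q 0 = c := by
      rw [hU.nat q hqv (by simp [Prog.WritesNat, hqb, hqr]), hq]
    obtain ⟨h1, h2⟩ := hI i le_rfl
    obtain ⟨h3, h4⟩ := div_mod_succ (i := i) hc
    by_cases hlt : i % c + 1 < c
    · refine ⟨_, _, .iteTrue (by simpa [Test.Holds, NExpr.eval, hv, h2, hq1] using hlt)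
        (.seq (.assignNat _ _ _ _) (.assignNat _ _ _ _)), by simp [Test.cost, NExpr.cost], ?_⟩
      intro j hj
      by_cases hj' : j = i + 1
      · subst hj'
        simp [State.setNat, NExpr.eval, hv, h1, h2, hbr, hbr.symm, hvb, h3 hlt]
      · simpa [State.setNat, NExpr.eval, hv, hvb, hj'] using hI j (by omega)
    · refine ⟨_, _, .iteFalse (by simpa [Test.Holds, NExpr.eval, hv, h2, hq1] using hlt)
        (.seq (.assignNat _ _ _ _) (.assignNat _ _ _ _)), by simp [Test.cost, NExpr.cost], ?_⟩
      intro j hj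
      by_cases hj' : j = i + 1
      · subst hj'
        simp [State.setNat, NExpr.eval, hv, h1, hbr, hvb, h4 hlt]
      · simpa [State.setNat, NExpr.eval, hv, hvb, hj'] using hI j (by omega)

/-! ## The parameters -/

/-- The contents of the arrays of naturals with names from `N + 3` on: the constant one, the
parameters `d, k, m`, the block length `D`, the numbers `2 ^ D` and `k * 2 ^ D`, and tables of
quotients and remainders by `2`, by `D` and by `2 ^ D`. -/
structure Layout (N d k m D : ℕ) (s : State) : Prop where
  one : s.nat (N + 3) 0 = 1
  dim : s.nat (N + 4) 0 = d
  blocks : s.nat (N + 5) 0 = k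
  samples : s.nat (N + 6) 0 = m
  length : s.nat (N + 7) 0 = D
  power : s.nat (N + 8) 0 = 2 ^ D
  columns : s.nat (N + 9) 0 = k * 2 ^ D
  half : ∀ j ≤ 2 ^ D, s.nat (N + 10) j = j / 2 ∧ s.nat (N + 11) j = j % 2
  coord : ∀ l ≤ d, s.nat (N + 12) l = l / D ∧ s.nat (N + 13) l = l % D
  column : ∀ c ≤ k * 2 ^ D, s.nat (N + 14) c = c / 2 ^ D ∧ s.nat (N + 15) c = c % 2 ^ D

theorem Layout.congr {d k m D : ℕ} (h : Layout N d k m D s)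
    (hs : ∀ x, N + 3 ≤ x → s'.nat x = s.nat x) : Layout N d k m D s' := by
  constructor <;> (try intro _ _) <;> simp only [hs _ (Nat.add_le_add_left (by norm_num : 3 ≤ 3) N),
    hs _ (Nat.add_le_add_left (by norm_num : 3 ≤ 4) N),
    hs _ (Nat.add_le_add_left (by norm_num : 3 ≤ 5) N),
    hs _ (Nat.add_le_add_left (by norm_num : 3 ≤ 6) N),
    hs _ (Nat.add_le_add_left (by norm_num : 3 ≤ 7) N),
    hs _ (Nat.add_le_add_left (by norm_num : 3 ≤ 8) N),
    hs _ (Nat.add_le_add_left (by norm_num : 3 ≤ 9) N),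
    hs _ (Nat.add_le_add_left (by norm_num : 3 ≤ 10) N),
    hs _ (Nat.add_le_add_left (by norm_num : 3 ≤ 11) N),
    hs _ (Nat.add_le_add_left (by norm_num : 3 ≤ 12) N),
    hs _ (Nat.add_le_add_left (by norm_num : 3 ≤ 13) N),
    hs _ (Nat.add_le_add_left (by norm_num : 3 ≤ 14) N),
    hs _ (Nat.add_le_add_left (by norm_num : 3 ≤ 15) N)]
  exacts [h.one, h.dim, h.blocks, h.samples, h.length, h.power, h.columns,
    h.half _ ‹_›, h.coord _ ‹_›, h.column _ ‹_›]

/-- Write `e` into the scalar `v`. -/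
def assignVar (v : ℕ) (e : NExpr) : Prog := .assignNat v (.const 0) e

/-- Copy the parameters and initialize the scalars. -/
def initScalars (N : ℕ) : Prog :=
  .seq (assignVar (N + 3) (.const 1)) (.seq (assignVar (N + 4) (.get 0 (.const 0)))
    (.seq (assignVar (N + 5) (.get 0 (.const 1))) (.seq (assignVar (N + 6) (.get 0 (.const 2)))
      (.seq (assignVar (N + 8) (.const 1)) (assignVar (N + 17) (.const 2))))))

/-- Compute `d / k`. -/
def computeBlockLength (N : ℕ) : Prog :=
  forLoop N (N + 4) (.ite (.natLt (.var (N + 16)) (.var (N + 4)))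
    (.seq (assignVar (N + 16) (.add (.var (N + 16)) (.var (N + 5))))
      (assignVar (N + 7) (.add (.var (N + 7)) (.const 1)))) .skip)

/-- Compute `2 ^ (d / k)`. -/
def computePower (N : ℕ) : Prog :=
  forLoop N (N + 7) (assignVar (N + 8) (.add (.var (N + 8)) (.var (N + 8))))

/-- Compute `k * 2 ^ (d / k)`. -/
def computeColumns (N : ℕ) : Prog :=
  forLoop N (N + 5) (assignVar (N + 9) (.add (.var (N + 9)) (.var (N + 8))))

theorem initScalars_runs {d k m M : ℕ} (h0 : s.nat 0 0 = d) (h1 : s.nat 0 1 = k)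
    (h2 : s.nat 0 2 = m) :
    (initScalars N).Runs s (30 * (M + 1) ^ 1) fun s' => s'.nat (N + 3) 0 = 1 ∧
      s'.nat (N + 4) 0 = d ∧ s'.nat (N + 5) 0 = k ∧ s'.nat (N + 6) 0 = m ∧
      s'.nat (N + 8) 0 = 1 ∧ s'.nat (N + 17) 0 = 2 := by
  refine ⟨_, _, .seq (.assignNat _ _ _ _) (.seq (.assignNat _ _ _ _) (.seq (.assignNat _ _ _ _)
    (.seq (.assignNat _ _ _ _) (.seq (.assignNat _ _ _ _) (.assignNat _ _ _ _))))), ?_, ?_⟩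
  · simp only [NExpr.cost, pow_one]
    omega
  · simp [State.setNat, NExpr.eval, h0, h1, h2]

/-- Multiples of `k` are accumulated until they reach `d = k D`, which happens after `D` additions.
The loop has `d ≥ D` rounds, and the surplus ones do nothing, hence `min i D`. -/
theorem computeBlockLength_runs {d k D M : ℕ} (hk : k * D = d) (hd : 1 ≤ d) (hM : d ≤ M)
    (hd' : s.nat (N + 4) 0 = d) (hk' : s.nat (N + 5) 0 = k) (hr : s.nat (N + 16) 0 = 0)
    (hD : s.nat (N + 7) 0 = 0) :
    (computeBlockLength N).Runs s (40 * (M + 1) ^ 1) fun s' => s'.nat (N + 7) 0 = D := by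
  have hk1 : 1 ≤ k := Nat.one_le_iff_ne_zero.2 fun h => by simp [h] at hk; omega
  have hDd : D ≤ d := by nlinarith
  refine (forLoop_runs (M := M) (T := 29) (n := d)
    (I := fun i s' => s'.nat (N + 16) 0 = k * min i D ∧ s'.nat (N + 7) 0 = min i D)
    (by simp [Prog.WritesNat, assignVar]) (by simp [Prog.WritesNat, assignVar]) (by omega) hd' hM
    ?_ ?_ ?_).mono (by simp) fun s' h => by rw [h.2, min_eq_right hDd]
  · intro i s' x h
    simpa [State.setNat] using h
  · simp [hr, hD]
  · rintro i hi s₁ hU - ⟨h1, h2⟩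
    have hd1 : s₁.nat (N + 4) 0 = d := by
      rw [hU.nat _ (by omega) (by simp [Prog.WritesNat, assignVar]), hd']
    have hk1' : s₁.nat (N + 5) 0 = k := by
      rw [hU.nat _ (by omega) (by simp [Prog.WritesNat, assignVar]), hk']
    have hiff : k * min i D < d ↔ i < D := by
      rw [← hk, Nat.mul_lt_mul_left hk1]
      omega
    by_cases hlt : i < D
    · refine ⟨_, _, .iteTrue (by simpa [Test.Holds, NExpr.eval, h1, hd1] using hiff.2 hlt)
        (.seq (.assignNat _ _ _ _) (.assignNat _ _ _ _)), by simp [Test.cost, NExpr.cost], ?_⟩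
      rw [min_eq_left hlt.le] at h1 h2
      simp [State.setNat, NExpr.eval, h1, h2, hk1', min_eq_left (Nat.succ_le_of_lt hlt), mul_add]
    · refine ⟨_, _, .iteFalse (by simpa [Test.Holds, NExpr.eval, h1, hd1] using mt hiff.1 hlt)
        (.skip _), by simp [Test.cost, NExpr.cost], ?_⟩
      rw [min_eq_right (by omega)] at h1 h2 ⊢
      exact ⟨h1, h2⟩

theorem computePower_runs {D M : ℕ} (hM : D ≤ M) (hD : s.nat (N + 7) 0 = D)
    (hQ : s.nat (N + 8) 0 = 1) :
    (computePower N).Runs s (20 * (M + 1) ^ 1) fun s' => s'.nat (N + 8) 0 = 2 ^ D := by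
  refine (forLoop_runs (M := M) (T := 9) (n := D) (I := fun i s' => s'.nat (N + 8) 0 = 2 ^ i)
    (by simp [Prog.WritesNat, assignVar]) (by simp [Prog.WritesNat, assignVar]) (by omega) hD hM
    ?_ (by simpa using hQ) ?_).mono (by simp) fun s' h => h
  · intro i s' x h
    simpa [State.setNat] using h
  · intro i hi s₁ hU _ h
    refine ⟨_, _, .assignNat _ _ _ _, by simp [NExpr.cost], ?_⟩
    simp [State.setNat, NExpr.eval, h, pow_succ, mul_two]

theorem computeColumns_runs {k Q M : ℕ} (hM : k ≤ M) (hk : s.nat (N + 5) 0 = k)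
    (hQ : s.nat (N + 8) 0 = Q) (hn : s.nat (N + 9) 0 = 0) :
    (computeColumns N).Runs s (20 * (M + 1) ^ 1) fun s' => s'.nat (N + 9) 0 = k * Q := by
  refine (forLoop_runs (M := M) (T := 9) (n := k) (I := fun i s' => s'.nat (N + 9) 0 = i * Q)
    (by simp [Prog.WritesNat, assignVar]) (by simp [Prog.WritesNat, assignVar]) (by omega) hk hM
    ?_ (by simpa using hn) ?_).mono (by simp) fun s' h => h
  · intro i s' x h
    simpa [State.setNat] using h
  · intro i hi s₁ hU _ h
    have hQ1 : s₁.nat (N + 8) 0 = Q := by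
      rw [hU.nat _ (by omega) (by simp [Prog.WritesNat, assignVar]), hQ]
    refine ⟨_, _, .assignNat _ _ _ _, by simp [NExpr.cost], ?_⟩
    simp [State.setNat, NExpr.eval, h, hQ1, add_mul]

/-- Compute all scalars and tables. -/
def setup (N : ℕ) : Prog :=
  .seq (initScalars N) (.seq (computeBlockLength N) (.seq (computePower N)
    (.seq (computeColumns N) (.seq (divTable N (N + 8) (N + 17) (N + 10) (N + 11))
      (.seq (divTable N (N + 4) (N + 7) (N + 12) (N + 13))
        (divTable N (N + 9) (N + 8) (N + 14) (N + 15)))))))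

theorem setup_runs {d k m D M : ℕ} (hk : k * D = d) (hd : 1 ≤ d) (hdM : d ≤ M)
    (hnM : k * 2 ^ D ≤ M) (h0 : s.nat 0 0 = d) (h1 : s.nat 0 1 = k) (h2 : s.nat 0 2 = m)
    (hfresh : ∀ x i, N ≤ x → s.nat x i = 0) :
    (setup N).Runs s (300 * (M + 1) ^ 1) fun s' => Layout N d k m D s' ∧
      (∀ x < N, s'.nat x = s.nat x) ∧ s'.real = s.real := by
  have hk1 : 1 ≤ k := Nat.one_le_iff_ne_zero.2 fun h => by simp [h] at hk; omega
  have hD1 : 1 ≤ D := Nat.one_le_iff_ne_zero.2 fun h => by simp [h] at hk; omega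
  have hDd : D ≤ d := by nlinarith
  have hkd : k ≤ d := by nlinarith
  have hQ1 : 1 ≤ 2 ^ D := Nat.one_le_two_pow
  have hQM : 2 ^ D ≤ M := by nlinarith
  have hfr : ∀ {s' : State} {x : ℕ}, s'.nat x = s.nat x → N ≤ x → s'.nat x 0 = 0 :=
    fun h hx => by rw [h, hfresh _ _ hx]
  refine ((Prog.Runs.seq (R := fun s' => Layout N d k m D s') (initScalars_runs (M := M) h0 h1 h2).frame ?_).frame).mono
    (Nat.mul_le_mul_right _ (by norm_num : 30 + (40 + (20 + (20 + (60 + (60 + 60))))) ≤ 300)) ?_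
  · rintro s₁ ⟨⟨a1, a2, a3, a4, a5, a6⟩, f1, -⟩
    simp only [initScalars, assignVar, Prog.WritesNat] at f1
    refine Prog.Runs.seq (computeBlockLength_runs hk hd hdM a2 a3 (hfr (f1 _ (by omega)) (by omega))
      (hfr (f1 _ (by omega)) (by omega))).frame ?_
    rintro s₂ ⟨b1, f2, -⟩
    simp only [computeBlockLength, assignVar, writesNat_forLoop, Prog.WritesNat, or_false] at f2
    refine Prog.Runs.seq (computePower_runs (hDd.trans hdM) b1
      (by rw [f2 _ (by omega), a5])).frame ?_
    rintro s₃ ⟨c1, f3, -⟩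
    simp only [computePower, assignVar, writesNat_forLoop, Prog.WritesNat] at f3
    refine Prog.Runs.seq (computeColumns_runs (hkd.trans hdM)
      (by rw [f3 _ (by omega), f2 _ (by omega), a3]) c1
      (hfr (by rw [f3 _ (by omega), f2 _ (by omega), f1 _ (by omega)]) (by omega))).frame ?_
    rintro s₄ ⟨e1, f4, -⟩
    simp only [computeColumns, assignVar, writesNat_forLoop, Prog.WritesNat] at f4
    have f5 : ∀ x, x = N + 10 ∨ x = N + 11 ∨ x = N + 12 ∨ x = N + 13 ∨ x = N + 14 ∨ x = N + 15 →
        s₄.nat x = s.nat x := fun x hx => by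
      rw [f4 _ (by omega), f3 _ (by omega), f2 _ (by omega), f1 _ (by omega)]
    have f6 : ∀ x, x = N + 3 ∨ x = N + 4 ∨ x = N + 5 ∨ x = N + 6 ∨ x = N + 17 →
        s₄.nat x = s₁.nat x := fun x hx => by
      rw [f4 _ (by omega), f3 _ (by omega), f2 _ (by omega)]
    have e2 : s₄.nat (N + 7) 0 = D := by rw [f4 _ (by omega), f3 _ (by omega), b1]
    have e3 : s₄.nat (N + 8) 0 = 2 ^ D := by rw [f4 _ (by omega), c1]
    refine Prog.Runs.seq (divTable_runs (c := 2) (by omega) (by omega) (by omega) (by omega)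
      (by omega) (by omega) (by omega) (by omega) (by omega) e3 hQM (by rw [f6 _ (by omega), a6])
      (by omega) (hfr (f5 _ (by omega)) (by omega)) (hfr (f5 _ (by omega)) (by omega))).frame ?_
    rintro s₅ ⟨g1, f7, -⟩
    simp only [divTable, writesNat_forLoop, Prog.WritesNat] at f7
    refine Prog.Runs.seq (divTable_runs (c := D) (n := d) (by omega) (by omega) (by omega)
      (by omega) (by omega) (by omega) (by omega) (by omega) (by omega)
      (by rw [f7 _ (by omega), f6 _ (by omega), a2]) hdM
      (by rw [f7 _ (by omega), e2]) hD1
      (hfr (by rw [f7 _ (by omega), f5 _ (by omega)]) (by omega))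
      (hfr (by rw [f7 _ (by omega), f5 _ (by omega)]) (by omega))).frame ?_
    rintro s₆ ⟨g2, f8, -⟩
    simp only [divTable, writesNat_forLoop, Prog.WritesNat] at f8
    refine (divTable_runs (c := 2 ^ D) (n := k * 2 ^ D) (by omega) (by omega) (by omega)
      (by omega) (by omega) (by omega) (by omega) (by omega) (by omega)
      (by rw [f8 _ (by omega), f7 _ (by omega), e1]) hnM
      (by rw [f8 _ (by omega), f7 _ (by omega), e3]) hQ1
      (hfr (by rw [f8 _ (by omega), f7 _ (by omega), f5 _ (by omega)]) (by omega))
      (hfr (by rw [f8 _ (by omega), f7 _ (by omega), f5 _ (by omega)]) (by omega))).frame.mono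
      le_rfl ?_
    rintro s₇ ⟨g3, f9, -⟩
    simp only [divTable, writesNat_forLoop, Prog.WritesNat] at f9
    have f10 : ∀ x, N + 3 ≤ x → x ≤ N + 9 → s₇.nat x = s₄.nat x := fun x hx hx' => by
      rw [f9 _ (by omega), f8 _ (by omega), f7 _ (by omega)]
    refine ⟨?_, ?_, ?_, ?_, ?_, ?_, ?_, fun j hj => ?_, fun j hj => ?_, g3⟩
    · rw [f10 _ (by omega) (by omega), f6 _ (by omega), a1]
    · rw [f10 _ (by omega) (by omega), f6 _ (by omega), a2]
    · rw [f10 _ (by omega) (by omega), f6 _ (by omega), a3]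
    · rw [f10 _ (by omega) (by omega), f6 _ (by omega), a4]
    · rw [f10 _ (by omega) (by omega), e2]
    · rw [f10 _ (by omega) (by omega), e3]
    · rw [f10 _ (by omega) (by omega), e1]
    · rw [f9 _ (by omega), f9 _ (by omega), f8 _ (by omega), f8 _ (by omega)]
      exact g1 j hj
    · rw [f9 _ (by omega), f9 _ (by omega)]
      exact g2 j hj
  · rintro s' ⟨h, f1, f2⟩
    refine ⟨h, fun x hx => f1 x ?_, funext fun x => f2 x ?_⟩
    · simp only [initScalars, computeBlockLength, computePower, computeColumns, divTable,
        assignVar, writesNat_forLoop, Prog.WritesNat, or_false]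
      omega
    · simp [initScalars, computeBlockLength, computePower, computeColumns, divTable,
        assignVar, writesReal_forLoop, Prog.WritesReal]

end RealRAM

namespace RealRAM

variable {N : ℕ} {s s' s₁ s₂ : State}

/-! ## The gadget matrix and the products -/

/-- `1` if the two values are equal and `0` otherwise. -/
def NExpr.eqInd (e f : NExpr) : NExpr := .sub (.const 1) (.add (.sub e f) (.sub f e))

/-- With truncated subtraction, the two differences add up to the distance of the values, and one
minus a positive distance is zero. -/
theorem NExpr.eval_eqInd (e f : NExpr) :
    (e.eqInd f).eval s = if e.eval s = f.eval s then 1 else 0 := by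
  simp only [eqInd, eval]
  split_ifs <;> omega

/-- Copy the basis. -/
def copyBasis (N : ℕ) : Prog :=
  fill N (N + 4) (N + 1) (N + 4) N (.const 0) (.get 0 (.var N) (.var (N + 1)))

/-- Copy the target. -/
def copyTarget (N : ℕ) : Prog :=
  fill N (N + 4) (N + 1) (N + 3) (N + 1) (.const 0) (.get 1 (.var N) (.var (N + 1)))

/-- The first row of the table of sign vectors. -/
def signRow (N : ℕ) : Prog :=
  fill N (N + 3) (N + 1) (N + 8) (N + 2) (.const 0)
    (.sub (.ofNat (.add (.get (N + 11) (.var (N + 1))) (.get (N + 11) (.var (N + 1)))))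
      (.ofNat (.const 1)))

/-- The other rows of the table of sign vectors. -/
def signRows (N : ℕ) : Prog :=
  fill N (N + 7) (N + 1) (N + 8) (N + 2) (.const 1)
    (.get (N + 2) (.var N) (.get (N + 10) (.var (N + 1))))

/-- The gadget matrix. -/
def gadgetTable (N : ℕ) : Prog :=
  fill N (N + 4) (N + 1) (N + 9) (N + 3) (.const 0)
    (.mul (.ofNat (.eqInd (.get (N + 12) (.var N)) (.get (N + 14) (.var (N + 1)))))
      (.get (N + 2) (.get (N + 13) (.var N)) (.get (N + 15) (.var (N + 1)))))

/-- The product of the basis and the gadget matrix. -/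
def productTable (N : ℕ) : Prog :=
  accumulate (N + 2) (N + 4) N (N + 4) (N + 1) (N + 9) (N + 4)
    (.mul (.get N (.var N) (.var (N + 2))) (.get (N + 3) (.var (N + 2)) (.var (N + 1))))

/-- The sums of the squares of the rows of the basis. -/
def rowSquares (N : ℕ) : Prog :=
  accumulate (N + 2) (N + 4) N (N + 4) (N + 1) (N + 3) (N + 5)
    (.mul (.get N (.var N) (.var (N + 2))) (.get N (.var N) (.var (N + 2))))

/-- The sum of all squares of entries of the basis. -/
def sumSquares (N : ℕ) : Prog :=
  accumulate (N + 2) (N + 4) N (N + 3) (N + 1) (N + 3) (N + 6)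
    (.get (N + 5) (.var (N + 2)) (.var (N + 1)))

/-- Compute all real tables. -/
def prepare (N : ℕ) : Prog :=
  .seq (copyBasis N) (.seq (copyTarget N) (.seq (signRow N) (.seq (signRows N)
    (.seq (gadgetTable N) (.seq (productTable N) (.seq (rowSquares N) (sumSquares N)))))))

/-- The contents of the arrays of reals after `prepare`, for the basis `b` and the target `t`. -/
structure Tables (N d k D : ℕ) (b : ℕ → ℕ → ℝ) (t : ℕ → ℝ) (s : State) : Prop where
  target : ∀ i < d, s.real (N + 1) i 0 = t i
  gadget : ∀ l < d, ∀ c < k * 2 ^ D, s.real (N + 3) l c = SLR.gadgetEntry D l c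
  product : ∀ i < d, ∀ c < k * 2 ^ D, s.real (N + 4) i c =
    ∑ l ∈ Finset.range d, b i l * SLR.gadgetEntry D l c
  squares : s.real (N + 6) 0 0 = ∑ i ∈ Finset.range d, ∑ l ∈ Finset.range d, b i l * b i l
  zero : ∀ i j, s.real (N + 7) i j = 0

theorem Tables.congr {d k D : ℕ} {b : ℕ → ℕ → ℝ} {t : ℕ → ℝ} (h : Tables N d k D b t s)
    (hs : ∀ x, N ≤ x → s'.real x = s.real x) : Tables N d k D b t s' := by
  constructor
  · rw [hs _ (by omega)]; exact h.target
  · rw [hs _ (by omega)]; exact h.gadget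
  · rw [hs _ (by omega)]; exact h.product
  · rw [hs _ (by omega)]; exact h.squares
  · rw [hs _ (by omega)]; exact h.zero

variable {d k m D M : ℕ}

theorem copyBasis_runs (hL : Layout N d k m D s) (hd : d ≤ M) (hN : 2 ≤ N) :
    (copyBasis N).Runs s (100 * (M + 1) ^ 2) fun s' =>
      ∀ i < d, ∀ j < d, s'.real N i j = s.real 0 i j := by
  refine (fill_runs (o' := 0) (f := s.real 0) (by omega) (by omega) (by omega) (by omega)
    (by omega) hL.dim hL.dim hd hd (fun _ _ => rfl) ?_).mono
    (Nat.mul_le_mul_right _ (by simp [fillCost, NExpr.cost, RExpr.cost]))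
    fun s' h i hi j hj => h.apply_zero hi hj
  intro i _ j _ s' hF h1 h2
  simp only [RExpr.eval, NExpr.eval, h1, h2]
  rw [hF.real _ (by omega)]

theorem copyTarget_runs (hL : Layout N d k m D s) (hd : d ≤ M) (hM : 1 ≤ M) (hN : 2 ≤ N) :
    (copyTarget N).Runs s (100 * (M + 1) ^ 2) fun s' =>
      ∀ i < d, s'.real (N + 1) i 0 = s.real 1 i 0 := by
  refine (fill_runs (o' := 0) (f := s.real 1) (by omega) (by omega) (by omega) (by omega)
    (by omega) hL.dim hL.one hd hM (fun _ _ => rfl) ?_).mono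
    (Nat.mul_le_mul_right _ (by simp [fillCost, NExpr.cost, RExpr.cost]))
    fun s' h i hi => h.apply_zero hi one_pos
  intro i _ j _ s' hF h1 h2
  simp only [RExpr.eval, NExpr.eval, h1, h2]
  rw [hF.real _ (by omega)]

theorem signRow_runs (hL : Layout N d k m D s) (hQ : 2 ^ D ≤ M) (hM : 1 ≤ M) :
    (signRow N).Runs s (100 * (M + 1) ^ 2) fun s' =>
      ∀ j < 2 ^ D, s'.real (N + 2) 0 j = SLR.bitSign 0 j := by
  refine (fill_runs (o' := 0) (f := fun _ j => SLR.bitSign 0 j) (by omega) (by omega) (by omega)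
    (by omega) (by omega) hL.one hL.power hM hQ (fun _ _ => rfl) ?_).mono
    (Nat.mul_le_mul_right _ (by simp [fillCost, NExpr.cost, RExpr.cost]))
    fun s' h j hj => h.apply_zero one_pos hj
  intro i _ j hj s' hF h1 h2
  simp only [RExpr.eval, NExpr.eval, h2]
  rw [hF.nat _ (by omega) (by omega), (hL.half j hj.le).2, SLR.bitSign_zero, Nat.cast_one]

/-- The array is filled from itself with row offset `1`: row `i + 1` at `j` is row `i` at `j / 2`.
It reaches row `D`, one more than the gadget reads. -/
theorem signRows_runs (hL : Layout N d k m D s) (hD : D ≤ M) (hQ : 2 ^ D ≤ M)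
    (h0 : ∀ j < 2 ^ D, s.real (N + 2) 0 j = SLR.bitSign 0 j) :
    (signRows N).Runs s (100 * (M + 1) ^ 2) fun s' =>
      ∀ i ≤ D, ∀ j < 2 ^ D, s'.real (N + 2) i j = SLR.bitSign i j := by
  refine (fill_runs (o' := 1) (f := fun i j => SLR.bitSign (i + 1) j) (by omega) (by omega)
    (by omega) (by omega) (by omega) hL.length hL.power hD hQ (fun _ _ => rfl) ?_).mono
    (Nat.mul_le_mul_right _ (by simp [fillCost, NExpr.cost, RExpr.cost])) ?_
  · intro i hi j hj s' hF h1 h2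
    simp only [RExpr.eval, NExpr.eval, h1, h2]
    have hj2 : j / 2 < 2 ^ D := (Nat.div_le_self j 2).trans_lt hj
    rw [hF.nat _ (by omega) (by omega), (hL.half j hj.le).1, hF.cell, partialFill,
      SLR.bitSign_succ i j]
    -- The row being read is either the precomputed row `0` or was completed in the preceding round.
    rcases Nat.eq_zero_or_pos i with rfl | hi0
    · rw [if_neg (by omega), h0 _ hj2]
    · rw [if_pos (by omega), show i - 1 + 1 = i by omega]
  · intro s' h i hi j hj
    rcases Nat.eq_zero_or_pos i with rfl | hi0
    · rw [h.cell, partialFill, if_neg (by omega), h0 j hj]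
    · obtain ⟨i, rfl⟩ := Nat.exists_eq_add_of_le hi0
      rw [h.apply (show i < D by omega) hj, add_comm]

theorem gadgetTable_runs (hL : Layout N d k m D s) (hD : 1 ≤ D) (hd : d ≤ M)
    (hn : k * 2 ^ D ≤ M)
    (h0 : ∀ i ≤ D, ∀ j < 2 ^ D, s.real (N + 2) i j = SLR.bitSign i j) :
    (gadgetTable N).Runs s (100 * (M + 1) ^ 2) fun s' =>
      ∀ l < d, ∀ c < k * 2 ^ D, s'.real (N + 3) l c = SLR.gadgetEntry D l c := by
  refine (fill_runs (o' := 0) (f := SLR.gadgetEntry D) (by omega) (by omega) (by omega)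
    (by omega) (by omega) hL.dim hL.columns hd hn (fun _ _ => rfl) ?_).mono
    (Nat.mul_le_mul_right _ (by simp [fillCost, NExpr.cost, RExpr.cost, NExpr.eqInd]))
    fun s' h i hi j hj => h.apply_zero hi hj
  intro i hi j hj s' hF h1 h2
  simp only [RExpr.eval, NExpr.eval_eqInd, NExpr.eval, h1, h2]
  rw [hF.nat _ (by omega) (by omega), hF.nat _ (by omega) (by omega),
    hF.nat _ (by omega) (by omega), hF.nat _ (by omega) (by omega), (hL.coord i hi.le).1,
    (hL.coord i hi.le).2, (hL.column j hj.le).1, (hL.column j hj.le).2, hF.real _ (by omega),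
    h0 _ (Nat.mod_lt _ hD).le _ (Nat.mod_lt _ (by positivity)), SLR.gadgetEntry]
  split_ifs <;> simp

theorem productTable_runs {b : ℕ → ℕ → ℝ} (hL : Layout N d k m D s) (hd : d ≤ M)
    (hn : k * 2 ^ D ≤ M) (hzero : ∀ i j, s.real (N + 4) i j = 0)
    (hb : ∀ i < d, ∀ j < d, s.real N i j = b i j)
    (hg : ∀ l < d, ∀ c < k * 2 ^ D, s.real (N + 3) l c = SLR.gadgetEntry D l c) :
    (productTable N).Runs s (200 * (M + 1) ^ 3) fun s' =>
      ∀ i < d, ∀ c < k * 2 ^ D, s'.real (N + 4) i c =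
        ∑ l ∈ Finset.range d, b i l * SLR.gadgetEntry D l c := by
  refine (accumulate_runs (g := fun l i c => b i l * SLR.gadgetEntry D l c) (by omega) (by omega)
    (by omega) (by omega) (by omega) (by omega) hL.dim hL.dim hL.columns hd hd hn
    (fun i _ j _ => hzero i j) ?_).mono
    (Nat.mul_le_mul_right _ (by simp [NExpr.cost, RExpr.cost])) fun s' h => h.cell
  intro l hl i hi j hj s' hn' hr h0 h1 h2
  simp only [RExpr.eval, NExpr.eval, h0, h1, h2]
  rw [hr _ (by omega), hr _ (by omega), hb i hi l hl, hg l hl j hj]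

theorem rowSquares_runs {b : ℕ → ℕ → ℝ} (hL : Layout N d k m D s) (hd : d ≤ M) (hM : 1 ≤ M)
    (hzero : ∀ i j, s.real (N + 5) i j = 0) (hb : ∀ i < d, ∀ j < d, s.real N i j = b i j) :
    (rowSquares N).Runs s (200 * (M + 1) ^ 3) fun s' =>
      ∀ i < d, s'.real (N + 5) i 0 = ∑ l ∈ Finset.range d, b i l * b i l := by
  refine (accumulate_runs (g := fun l i _ => b i l * b i l) (by omega) (by omega)
    (by omega) (by omega) (by omega) (by omega) hL.dim hL.dim hL.one hd hd hM
    (fun i _ j _ => hzero i j) ?_).mono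
    (Nat.mul_le_mul_right _ (by simp [NExpr.cost, RExpr.cost]))
    fun s' h i hi => h.cell i hi 0 one_pos
  intro l hl i hi j hj s' hn' hr h0 h1 h2
  simp only [RExpr.eval, NExpr.eval, h0, h1]
  rw [hr _ (by omega), hb i hi l hl]

theorem sumSquares_runs {r : ℕ → ℝ} (hL : Layout N d k m D s) (hd : d ≤ M) (hM : 1 ≤ M)
    (hzero : ∀ i j, s.real (N + 6) i j = 0) (hr : ∀ i < d, s.real (N + 5) i 0 = r i) :
    (sumSquares N).Runs s (200 * (M + 1) ^ 3) fun s' =>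
      s'.real (N + 6) 0 0 = ∑ i ∈ Finset.range d, r i := by
  refine (accumulate_runs (g := fun l _ _ => r l) (by omega) (by omega)
    (by omega) (by omega) (by omega) (by omega) hL.dim hL.one hL.one hd hM hM
    (fun i _ j _ => hzero i j) ?_).mono
    (Nat.mul_le_mul_right _ (by simp [NExpr.cost, RExpr.cost]))
    fun s' h => h.cell 0 one_pos 0 one_pos
  intro l hl i hi j hj s' hn' hr' h0 h1 h2
  simp only [RExpr.eval, NExpr.eval, h0, h2]
  obtain rfl : j = 0 := by omega
  rw [hr' _ (by omega), hr l hl]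

/-- The accumulations here and in `decode` need zero targets, so untouched arrays are tracked
through every stage. Nothing below `N` changes, so the input is still in place when the instance is
written over it. -/
theorem prepare_runs (hL : Layout N d k m D s) (hN : 2 ≤ N) (hD : 1 ≤ D) (hd : d ≤ M)
    (hDM : D ≤ M) (hQ : 2 ^ D ≤ M) (hn : k * 2 ^ D ≤ M) (hM : 1 ≤ M)
    (hfresh : ∀ x i j, N ≤ x → s.real x i j = 0) :
    (prepare N).Runs s (1100 * (M + 1) ^ 3) fun s' => Layout N d k m D s' ∧
      Tables N d k D (s.real 0) (fun i => s.real 1 i 0) s' ∧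
      (∀ x < N, s'.nat x = s.nat x) ∧ ∀ x < N, s'.real x = s.real x := by
  have hLay : ∀ {s₁ s₂ : State} {v₁ u₁ v₂ u₂ a : ℕ} {o : NExpr} {e : RExpr},
      Layout N d k m D s₁ → v₁ < N + 3 → v₂ < N + 3 →
      (∀ x, ¬ (fill v₁ u₁ v₂ u₂ a o e).WritesNat x → s₂.nat x = s₁.nat x) →
      Layout N d k m D s₂ := by
    intro s₁ s₂ v₁ u₁ v₂ u₂ a o e h h1 h2 hf
    refine h.congr fun x hx => hf x ?_
    simp only [fill, writesNat_forLoop, Prog.WritesNat, or_false]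
    omega
  have hLay' : ∀ {s₁ s₂ : State} {v₀ u₀ v₁ u₁ v₂ u₂ a : ℕ} {e : RExpr},
      Layout N d k m D s₁ → v₀ < N + 3 → v₁ < N + 3 → v₂ < N + 3 →
      (∀ x, ¬ (accumulate v₀ u₀ v₁ u₁ v₂ u₂ a e).WritesNat x → s₂.nat x = s₁.nat x) →
      Layout N d k m D s₂ := by
    intro s₁ s₂ v₀ u₀ v₁ u₁ v₂ u₂ a e h h0 h1 h2 hf
    refine h.congr fun x hx => hf x ?_
    simp only [accumulate, fill, writesNat_forLoop, Prog.WritesNat, or_false]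
    omega
  refine ((Prog.Runs.seq (R := fun s' => Layout N d k m D s' ∧
      Tables N d k D (s.real 0) (fun i => s.real 1 i 0) s')
    ((copyBasis_runs hL hd hN).raise (by norm_num : 2 ≤ 3)).frame ?_).frame).mono
    (Nat.mul_le_mul_right _
      (by norm_num : 100 + (100 + (100 + (100 + (100 + (200 + (200 + 200)))))) ≤ 1100)) ?_
  · rintro s₁ ⟨p1, n1, r1⟩
    have L1 := hLay hL (by omega) (by omega) n1
    simp only [copyBasis, fill, writesReal_forLoop, Prog.WritesReal] at r1
    refine Prog.Runs.seq ((copyTarget_runs L1 hd hM hN).raise (by norm_num : 2 ≤ 3)).frame ?_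
    rintro s₂ ⟨p2, n2, r2⟩
    have L2 := hLay L1 (by omega) (by omega) n2
    simp only [copyTarget, fill, writesReal_forLoop, Prog.WritesReal] at r2
    refine Prog.Runs.seq ((signRow_runs L2 hQ hM).raise (by norm_num : 2 ≤ 3)).frame ?_
    rintro s₃ ⟨p3, n3, r3⟩
    have L3 := hLay L2 (by omega) (by omega) n3
    simp only [signRow, fill, writesReal_forLoop, Prog.WritesReal] at r3
    refine Prog.Runs.seq ((signRows_runs L3 hDM hQ p3).raise (by norm_num : 2 ≤ 3)).frame ?_
    rintro s₄ ⟨p4, n4, r4⟩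
    have L4 := hLay L3 (by omega) (by omega) n4
    simp only [signRows, fill, writesReal_forLoop, Prog.WritesReal] at r4
    refine Prog.Runs.seq ((gadgetTable_runs L4 hD hd hn p4).raise (by norm_num : 2 ≤ 3)).frame ?_
    rintro s₅ ⟨p5, n5, r5⟩
    have L5 := hLay L4 (by omega) (by omega) n5
    simp only [gadgetTable, fill, writesReal_forLoop, Prog.WritesReal] at r5
    have hfr : ∀ x, x ≠ N → x ≠ N + 1 → x ≠ N + 2 → x ≠ N + 3 → s₅.real x = s.real x :=
      fun x h0 h1 h2 h3 => by
        rw [r5 x (by omega), r4 x (by omega), r3 x (by omega), r2 x (by omega), r1 x (by omega)]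
    have hb : ∀ i < d, ∀ j < d, s₅.real N i j = s.real 0 i j := by
      rw [r5 _ (by omega), r4 _ (by omega), r3 _ (by omega), r2 _ (by omega)]
      exact p1
    refine Prog.Runs.seq (productTable_runs L5 hd hn (fun i j => by
      rw [hfr _ (by omega) (by omega) (by omega) (by omega), hfresh _ _ _ (by omega)])
      hb p5).frame ?_
    rintro s₆ ⟨p6, n6, r6⟩
    have L6 := hLay' L5 (by omega) (by omega) (by omega) n6
    simp only [productTable, accumulate, fill, writesReal_forLoop, Prog.WritesReal] at r6
    refine Prog.Runs.seq (rowSquares_runs L6 hd hM (fun i j => by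
      rw [r6 _ (by omega), hfr _ (by omega) (by omega) (by omega) (by omega),
        hfresh _ _ _ (by omega)])
      (by rw [r6 _ (by omega)]; exact hb)).frame ?_
    rintro s₇ ⟨p7, n7, r7⟩
    have L7 := hLay' L6 (by omega) (by omega) (by omega) n7
    simp only [rowSquares, accumulate, fill, writesReal_forLoop, Prog.WritesReal] at r7
    refine (sumSquares_runs L7 hd hM (fun i j => by
      rw [r7 _ (by omega), r6 _ (by omega), hfr _ (by omega) (by omega) (by omega) (by omega),
        hfresh _ _ _ (by omega)]) p7).frame.mono le_rfl ?_
    rintro s₈ ⟨p8, n8, r8⟩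
    simp only [sumSquares, accumulate, fill, writesReal_forLoop, Prog.WritesReal] at r8
    refine ⟨hLay' L7 (by omega) (by omega) (by omega) n8, ?_, ?_, ?_, p8, ?_⟩
    · rw [r8 _ (by omega), r7 _ (by omega), r6 _ (by omega), r5 _ (by omega), r4 _ (by omega),
        r3 _ (by omega)]
      intro i hi
      rw [p2 i hi, r1 _ (by omega)]
    · rw [r8 _ (by omega), r7 _ (by omega), r6 _ (by omega)]
      exact p5
    · rw [r8 _ (by omega), r7 _ (by omega)]
      exact p6
    · intro i j
      rw [r8 _ (by omega), r7 _ (by omega), r6 _ (by omega),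
        hfr _ (by omega) (by omega) (by omega) (by omega), hfresh _ _ _ (by omega)]
  · rintro s' ⟨⟨h1, h2⟩, h3, h4⟩
    refine ⟨h1, h2, fun x hx => h3 x ?_, fun x hx => h4 x ?_⟩
    · simp only [copyBasis, copyTarget, signRow, signRows, gadgetTable, productTable, rowSquares,
        sumSquares, accumulate, fill, writesNat_forLoop, Prog.WritesNat, or_false]
      omega
    · simp only [copyBasis, copyTarget, signRow, signRows, gadgetTable, productTable, rowSquares,
        sumSquares, accumulate, fill, writesReal_forLoop, Prog.WritesReal]
      omega

end RealRAM

namespace RealRAM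

variable {N : ℕ} {s s' s₁ s₂ : State} {d k m D M : ℕ}

/-! ## Writing the instance of sparse linear regression -/

/-- The factor of the product in the design matrix. -/
def scaleExpr (N : ℕ) : RExpr :=
  .div (.sqrt (.ofNat (.var (N + 6)))) (.mul (.ofNat (.const 2))
    (.sqrt (.mul (.ofNat (.var (N + 4))) (.get (N + 6) (.const 0) (.const 0)))))

/-- The factor of the block sums in the design matrix. -/
def weightExpr (N : ℕ) : RExpr := .div (.sqrt (.ofNat (.var (N + 6)))) (.ofNat (.const 2))

/-- Write the upper part of the design matrix. -/
def writeProduct (N : ℕ) : Prog :=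
  fill N (N + 4) (N + 1) (N + 9) 0 (.const 0)
    (.mul (scaleExpr N) (.get (N + 4) (.var N) (.var (N + 1))))

/-- Write the lower part of the design matrix. -/
def writeBlockSums (N : ℕ) : Prog :=
  fill N (N + 5) (N + 1) (N + 9) 0 (.var (N + 4))
    (.mul (weightExpr N) (.ofNat (.eqInd (.var N) (.get (N + 14) (.var (N + 1))))))

/-- Write the upper part of the response. -/
def writeTarget (N : ℕ) : Prog :=
  fill N (N + 4) (N + 1) (N + 3) 1 (.const 0)
    (.mul (scaleExpr N) (.get (N + 1) (.var N) (.var (N + 1))))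

/-- Write the lower part of the response. -/
def writeOnes (N : ℕ) : Prog :=
  fill N (N + 5) (N + 1) (N + 3) 1 (.var (N + 4)) (weightExpr N)

/-- Write the parameters of the regression instance. -/
def writeParameters (N : ℕ) : Prog :=
  .seq (.assignNat 0 (.const 0) (.var (N + 6))) (.seq (.assignNat 0 (.const 1) (.var (N + 9)))
    (.assignNat 0 (.const 2) (.var (N + 5))))

/-- Write the whole instance. -/
def writeInstance (N : ℕ) : Prog :=
  .seq (writeProduct N) (.seq (writeBlockSums N) (.seq (writeTarget N) (.seq (writeOnes N)
    (writeParameters N))))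

theorem eval_scaleExpr (hL : Layout N d k m D s) :
    (scaleExpr N).eval s = √m / (2 * √(d * s.real (N + 6) 0 0)) := by
  simp [scaleExpr, RExpr.eval, NExpr.eval, hL.samples, hL.dim]

theorem eval_weightExpr (hL : Layout N d k m D s) : (weightExpr N).eval s = √m / 2 := by
  simp [weightExpr, RExpr.eval, NExpr.eval, hL.samples]

theorem FillState.layout {v₁ v₂ a o n₂ i j : ℕ} {f : ℕ → ℕ → ℝ}
    (h : FillState v₁ v₂ a o n₂ f s i j s') (hL : Layout N d k m D s) (h1 : v₁ < N + 3)
    (h2 : v₂ < N + 3) : Layout N d k m D s' :=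
  hL.congr fun x hx => h.nat x (by omega) (by omega)

/-- The design matrix as a function of natural numbers. -/
noncomputable def designCell (d k D : ℕ) (σ W : ℝ) (f : ℕ → ℕ → ℝ) (p q : ℕ) : ℝ :=
  if q < k * 2 ^ D then
    if p < d then σ * f p q
    else if p - d < k then W * (if p - d = q / 2 ^ D then 1 else 0) else 0
  else 0

/-- The response as a function of a natural number. -/
noncomputable def responseCell (d k : ℕ) (σ W : ℝ) (t : ℕ → ℝ) (p : ℕ) : ℝ :=
  if p < d then σ * t p else if p - d < k then W else 0

/-- The instance overwrites the input in place, working from the copies kept above `N`. Since `d ≤ k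
* 2 ^ D`, the new upper block covers the whole old basis, so no stale entries remain and every other
cell is zero. -/
theorem writeInstance_runs {b : ℕ → ℕ → ℝ} {t : ℕ → ℝ} (hL : Layout N d k m D s)
    (hT : Tables N d k D b t s) (hN : 2 ≤ N) (hd : d ≤ M) (hk : k ≤ M) (hn : k * 2 ^ D ≤ M)
    (hdn : d ≤ k * 2 ^ D) (hM : 1 ≤ M)
    (h0 : ∀ p q, ¬ (p < d ∧ q < d) → s.real 0 p q = 0)
    (h1 : ∀ p q, ¬ (p < d ∧ q = 0) → s.real 1 p q = 0) :
    (writeInstance N).Runs s (800 * (M + 1) ^ 3) fun s' => Layout N d k m D s' ∧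
      (∀ x, 2 ≤ x → s'.real x = s.real x) ∧ (∀ x, 1 ≤ x → x < N → s'.nat x = s.nat x) ∧
      (s'.nat 0 0 = m ∧ s'.nat 0 1 = k * 2 ^ D ∧ s'.nat 0 2 = k ∧
        ∀ i, 3 ≤ i → s'.nat 0 i = s.nat 0 i) ∧
      (∀ p q, s'.real 0 p q = designCell d k D (√m / (2 * √(d * s.real (N + 6) 0 0))) (√m / 2)
        (fun i c => ∑ l ∈ Finset.range d, b i l * SLR.gadgetEntry D l c) p q) ∧
      ∀ p q, s'.real 1 p q =
        if q = 0 then responseCell d k (√m / (2 * √(d * s.real (N + 6) 0 0))) (√m / 2) t p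
        else 0 := by
  set σ := √(m : ℝ) / (2 * √(d * s.real (N + 6) 0 0))
  set f := fun i c => ∑ l ∈ Finset.range d, b i l * SLR.gadgetEntry D l c
  have hvar : ∀ {s₁ : State}, Layout N d k m D s₁ → ∀ s' : State,
      (∀ x, x ≠ N → x ≠ N + 1 → s'.nat x = s₁.nat x) → (NExpr.var (N + 4)).eval s' = d := by
    intro s₁ hL1 s' h
    rw [NExpr.eval, h _ (by omega) (by omega)]
    exact hL1.dim
  refine (Prog.Runs.seq ((fill_runs (o' := 0) (f := fun i c => σ * f i c) (M := M) (by omega)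
    (by omega) (by omega) (by omega) (by omega) hL.dim hL.columns hd hn (fun _ _ => rfl)
    ?_).raise (by norm_num : 2 ≤ 3)) fun s₁ F1 => Prog.Runs.seq ((fill_runs (o' := d) (n₁ := k)
      (n₂ := k * 2 ^ D) (f := fun p q => √m / 2 * (if p = q / 2 ^ D then 1 else 0)) (M := M)
      (by omega) (by omega) (by omega) (by omega) (by omega) ?_ ?_ hk hn ?_ ?_).raise
      (by norm_num : 2 ≤ 3)) fun s₂ F2 => Prog.Runs.seq ((fill_runs (o' := 0)
      (f := fun p _ => σ * t p) (n₁ := d) (n₂ := 1) (M := M) (by omega) (by omega) (by omega)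
      (by omega) (by omega) ?_ ?_ hd hM (fun _ _ => rfl) ?_).raise (by norm_num : 2 ≤ 3))
      fun s₃ F3 => Prog.Runs.seq ((fill_runs (o' := d) (f := fun _ _ => √m / 2) (n₁ := k) (n₂ := 1)
      (M := M) (by omega) (by omega) (by omega) (by omega) (by omega) ?_ ?_ hk hM ?_ ?_).raise
      (by norm_num : 2 ≤ 3)) fun s₄ F4 =>
      (⟨_, _, .seq (.assignNat _ _ _ _) (.seq (.assignNat _ _ _ _) (.assignNat _ _ _ _)), ?_, ?_⟩ :
        (writeParameters N).Runs s₄ (30 * (M + 1) ^ 3) _)).mono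
    (Nat.mul_le_mul_right _ ?_) fun _ h => h
  · intro i hi j hj s' hF h1 h2
    have h3 := eval_scaleExpr (hF.layout hL (by omega) (by omega))
    simp only [RExpr.eval, NExpr.eval, h1, h2, h3]
    rw [hF.real _ (by omega), hF.real _ (by omega), hT.product i hi j hj]
  · exact (F1.layout hL (by omega) (by omega)).blocks
  · exact (F1.layout hL (by omega) (by omega)).columns
  · exact hvar (F1.layout hL (by omega) (by omega))
  · intro i hi j hj s' hF h1 h2
    have hL1 := F1.layout hL (by omega) (by omega)
    have h3 := eval_weightExpr (hF.layout hL1 (by omega) (by omega))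
    simp only [RExpr.eval, NExpr.eval_eqInd, NExpr.eval, h1, h2, h3]
    rw [hF.nat _ (by omega) (by omega), (hL1.column j hj.le).1]
    split_ifs <;> simp
  · exact (F2.layout (F1.layout hL (by omega) (by omega)) (by omega) (by omega)).dim
  · exact (F2.layout (F1.layout hL (by omega) (by omega)) (by omega) (by omega)).one
  · intro i hi j hj s' hF h1 h2
    have hL2 := F2.layout (F1.layout hL (by omega) (by omega)) (by omega) (by omega)
    have h3 := eval_scaleExpr (hF.layout hL2 (by omega) (by omega))
    obtain rfl : j = 0 := by omega
    simp only [RExpr.eval, NExpr.eval, h1, h2, h3]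
    rw [hF.real _ (by omega), hF.real _ (by omega), F2.real _ (by omega), F2.real _ (by omega),
      F1.real _ (by omega), F1.real _ (by omega), hT.target i hi]
  · exact (F3.layout (F2.layout (F1.layout hL (by omega) (by omega)) (by omega) (by omega))
      (by omega) (by omega)).blocks
  · exact (F3.layout (F2.layout (F1.layout hL (by omega) (by omega)) (by omega) (by omega))
      (by omega) (by omega)).one
  · exact hvar (F3.layout (F2.layout (F1.layout hL (by omega) (by omega)) (by omega) (by omega))
      (by omega) (by omega))
  · intro i hi j hj s' hF h1 h2
    have hL3 := F3.layout (F2.layout (F1.layout hL (by omega) (by omega)) (by omega) (by omega))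
      (by omega) (by omega)
    exact eval_weightExpr (hF.layout hL3 (by omega) (by omega))
  · have : 1 ≤ (M + 1) ^ 3 := Nat.one_le_pow _ _ (by omega)
    simp only [NExpr.cost]
    omega
  · have hL4 := F4.layout (F3.layout (F2.layout (F1.layout hL (by omega) (by omega)) (by omega)
      (by omega)) (by omega) (by omega)) (by omega) (by omega)
    have hnat : ∀ x, x ≠ N → x ≠ N + 1 → s₄.nat x = s.nat x := fun x hx hx' => by
      rw [F4.nat x hx hx', F3.nat x hx hx', F2.nat x hx hx', F1.nat x hx hx']
    have hN0 : N ≠ 0 := by omega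
    refine ⟨hL4.congr fun x hx => ?_, fun x hx => ?_, fun x hx hx' => ?_, ⟨?_, ?_, ?_, ?_⟩,
      fun p q => ?_, fun p q => ?_⟩
    · funext i
      simp [State.setNat, show x ≠ 0 by omega]
    · simp only [State.setNat_real]
      rw [F4.real x (by omega), F3.real x (by omega), F2.real x (by omega), F1.real x (by omega)]
    · funext i
      simp [State.setNat, show x ≠ 0 by omega, hnat x (by omega) (by omega)]
    · simp [State.setNat, NExpr.eval, hL4.samples]
    · simp [State.setNat, NExpr.eval, hL4.columns]
    · simp [State.setNat, NExpr.eval, hL4.blocks]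
    · intro i hi
      simp [State.setNat, NExpr.eval, show i ≠ 0 by omega, show i ≠ 1 by omega,
        show i ≠ 2 by omega, hnat 0 (by omega) (by omega)]
    · simp only [State.setNat_real]
      rw [F4.real 0 (by omega), F3.real 0 (by omega), F2.cell, partialFill, F1.cell, partialFill,
        designCell]
      by_cases hq : q < k * 2 ^ D
      · by_cases hp : p < d
        · rw [if_neg (by omega), if_pos (by omega), if_pos hq, if_pos hp, Nat.sub_zero]
        · by_cases hp' : p - d < k
          · rw [if_pos (by omega), if_pos hq, if_neg hp, if_pos hp']
          · rw [if_neg (by omega), if_neg (by omega), if_pos hq, if_neg hp, if_neg hp',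
              h0 p q (by omega)]
      · rw [if_neg (by omega), if_neg (by omega), if_neg hq, h0 p q (by omega)]
    · simp only [State.setNat_real]
      rw [F4.cell, partialFill, F3.cell, partialFill, F2.real 1 (by omega), F1.real 1 (by omega),
        responseCell]
      by_cases hq : q = 0
      · by_cases hp : p < d
        · rw [if_neg (by omega), if_pos (by omega), if_pos hq, if_pos hp, Nat.sub_zero]
        · by_cases hp' : p - d < k
          · rw [if_pos (by omega), if_pos hq, if_neg hp, if_pos hp']
          · rw [if_neg (by omega), if_neg (by omega), if_pos hq, if_neg hp, if_neg hp',
              h1 p q (by omega)]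
      · rw [if_neg (by omega), if_neg (by omega), if_neg hq, h1 p q (by omega)]
  · simp [fillCost, NExpr.cost, RExpr.cost, scaleExpr, weightExpr, NExpr.eqInd]

/-! ## Decoding -/

/-- Multiply the output of the regression algorithm by the gadget matrix. -/
def decodeSums (N : ℕ) : Prog :=
  accumulate (N + 2) (N + 9) N (N + 4) (N + 1) (N + 3) (N + 7)
    (.mul (.get (N + 3) (.var N) (.var (N + 2))) (.get 2 (.var (N + 2)) (.var (N + 1))))

/-- Output the signs of the computed vector. -/
def decodeSigns (N : ℕ) : Prog :=
  fill N (N + 4) (N + 1) (N + 3) 2 (.const 0)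
    (.div (.get (N + 7) (.var N) (.var (N + 1)))
      (.sqrt (.mul (.get (N + 7) (.var N) (.var (N + 1))) (.get (N + 7) (.var N) (.var (N + 1))))))

/-- Compute the sign vector from the output of the regression algorithm. -/
def decode (N : ℕ) : Prog := .seq (decodeSums N) (decodeSigns N)

/-- The sums go to a separate array because the signs overwrite the one holding the regression
output. -/
theorem decode_runs {b : ℕ → ℕ → ℝ} {t v : ℕ → ℝ} (hL : Layout N d k m D s)
    (hT : Tables N d k D b t s) (hN : 3 ≤ N) (hd : d ≤ M) (hn : k * 2 ^ D ≤ M) (hM : 1 ≤ M)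
    (hv : ∀ i, v i = ∑ c ∈ Finset.range (k * 2 ^ D), SLR.gadgetEntry D i c * s.real 2 c 0) :
    (decode N).Runs s (300 * (M + 1) ^ 3) fun s' =>
      ∀ i < d, s'.real 2 i 0 = v i / √(v i * v i) := by
  refine (Prog.Runs.seq (accumulate_runs
    (g := fun c i _ => SLR.gadgetEntry D i c * s.real 2 c 0) (M := M) (by omega) (by omega)
    (by omega) (by omega) (by omega) (by omega) hL.columns hL.dim hL.one hn hd hM
    (fun i _ j _ => hT.zero i j) ?_) fun s₁ A1 => (((fill_runs (o' := 0)
      (f := fun i _ => v i / √(v i * v i)) (n₁ := d) (n₂ := 1) (M := M) (by omega) (by omega)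
      (by omega) (by omega) (by omega) ?_ ?_ hd hM (fun _ _ => rfl) ?_).raise
      (by norm_num : 2 ≤ 3)).mono le_rfl fun s' h i hi => h.apply_zero hi one_pos)).mono
      (Nat.mul_le_mul_right _ ?_) fun _ h => h
  · intro l hl i hi j hj s' hn' hr h0 h1 h2
    obtain rfl : j = 0 := by omega
    simp only [RExpr.eval, NExpr.eval, h0, h1, h2]
    rw [hr _ (by omega), hr _ (by omega), hT.gadget i hi l hl]
  · rw [A1.nat _ (by omega) (by omega) (by omega), hL.dim]
  · rw [A1.nat _ (by omega) (by omega) (by omega), hL.one]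
  · intro i hi j hj s' hF h1 h2
    obtain rfl : j = 0 := by omega
    have h3 : s'.real (N + 7) i 0 = v i := by
      rw [hF.real _ (by omega), A1.cell i hi 0 one_pos, hv]
    simp only [RExpr.eval, NExpr.eval, h1, h2, h3]
  · simp [fillCost, NExpr.cost, RExpr.cost]

/-! ## The reduction -/

/-- The decoding algorithm that is built from the regression algorithm `A`; the arrays that it uses
in addition to those of `A` have names at least `N`.  It draws no Gaussian numbers of its own: the
design matrix is deterministic, so that the decoding succeeds for every tape. -/
def reduction (N : ℕ) (A : Prog) : Prog :=
  .seq (setup N) (.seq (prepare N) (.seq (writeInstance N) (.seq A (decode N))))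

theorem sum_range_eq_sum_fin {n : ℕ} {f : ℕ → ℝ} {g : Fin n → ℝ} (h : ∀ i : Fin n, f i = g i) :
    ∑ i ∈ Finset.range n, f i = ∑ i, g i := by
  rw [Finset.sum_range]
  exact Finset.sum_congr rfl fun i _ => h i

/-- The regression guarantee is about a fresh input memory, and the program may read any cell it
names. Agreement is therefore needed on all cells below `N`, including the zeros outside the matrix
and the vector. -/
theorem agreeBelow_input {a₀ a₁ a₂ r c : ℕ} {X : Matrix (Fin r) (Fin c) ℝ} {y : Fin r → ℝ}
    (h0 : s.nat 0 0 = a₀) (h1 : s.nat 0 1 = a₁) (h2 : s.nat 0 2 = a₂)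
    (h3 : ∀ i, 3 ≤ i → s.nat 0 i = 0) (h4 : ∀ x i, 1 ≤ x → x < N → s.nat x i = 0)
    (h5 : ∀ p q, s.real 0 p q = if h : p < r ∧ q < c then X ⟨p, h.1⟩ ⟨q, h.2⟩ else 0)
    (h6 : ∀ p q, s.real 1 p q = if q = 0 then (if h : p < r then y ⟨p, h⟩ else 0) else 0)
    (h7 : ∀ x p q, 2 ≤ x → x < N → s.real x p q = 0) :
    AgreeBelow N (inputState a₀ a₁ a₂ X y s.tape) s := by
  refine ⟨fun x hx => funext fun i => ?_, fun x hx => funext fun p => funext fun q => ?_, rfl⟩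
  · rcases Nat.eq_zero_or_pos x with rfl | hx0
    · simp only [inputState, true_and]
      split_ifs with e1 e2 e3
      · rw [e1, h0]
      · rw [e2, h1]
      · rw [e3, h2]
      · exact (h3 i (by omega)).symm
    · rw [h4 x i hx0 hx]
      simp [inputState, show x ≠ 0 by omega]
  · by_cases hx0 : x = 0
    · subst hx0
      rw [h5]
      simp [inputState]
    · by_cases hx1 : x = 1
      · subst hx1
        rw [h6]
        by_cases hq : q = 0 <;> simp [inputState, hq]
      · rw [h7 x p q (by omega) hx]
        simp [inputState, hx0, hx1]

/-- The tape met by `A` is left existential: halting is assumed for every tape and the regression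
guarantee holds for every tape, so its identity does not matter. The summand `2500` collects setup,
preparation, writing and decoding. -/
theorem reduction_runs {A : Prog} {T : ℕ} (hA : A.bound ≤ N) (hN : 3 ≤ N) (hk : k * D = d)
    (hd : 1 ≤ d) (hm : 2 * d ≤ m) (hnM : k * 2 ^ D ≤ M) (B : Matrix (Fin d) (Fin d) ℝ)
    (t : Fin d → ℝ) (ω : ℕ → ℝ) {X : Matrix (Fin m) (Fin (k * 2 ^ D)) ℝ} {y : Fin m → ℝ}
    (hX : X = SLR.design m k D (SLR.scale m B) (√m / 2) B)
    (hy : y = SLR.stack m (SLR.scale m B • t) (fun _ : Fin k => √m / 2))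
    (hrun : ∀ ω, ∃ τ s, Exec A (SLR.input k X y ω) τ s ∧ τ ≤ T) :
    (reduction N A).Runs (BinaryBDD.input k m B t ω) (2500 * (M + 1) ^ 3 + T) fun s' =>
      ∃ ω' τ s₁, Exec A (SLR.input k X y ω') τ s₁ ∧ ∀ l, s'.output d l =
        (SLR.gadget d k D).mulVec (s₁.output (k * 2 ^ D)) l /
          √((SLR.gadget d k D).mulVec (s₁.output (k * 2 ^ D)) l *
            (SLR.gadget d k D).mulVec (s₁.output (k * 2 ^ D)) l) := by
  have hk1 : 1 ≤ k := Nat.one_le_iff_ne_zero.2 fun h => by simp [h] at hk; omega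
  have hD1 : 1 ≤ D := Nat.one_le_iff_ne_zero.2 fun h => by simp [h] at hk; omega
  have hD2 : D ≤ 2 ^ D := Nat.lt_two_pow_self.le
  have hdn : d ≤ k * 2 ^ D := hk ▸ Nat.mul_le_mul_left k hD2
  have hDd : D ≤ d := by nlinarith
  have hkd : k ≤ d := by nlinarith
  have hQM : 2 ^ D ≤ M := by nlinarith
  set s := BinaryBDD.input k m B t ω with hs
  obtain ⟨τ₁, s₁, E1, T1, L1, N1, R1⟩ := setup_runs (N := N) (s := s) (m := m) hk hd
    (hdn.trans hnM) hnM rfl rfl rfl fun x i hx => by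
      simp [hs, BinaryBDD.input, inputState, show x ≠ 0 by omega]
  have hreal : ∀ x p q, 2 ≤ x → s.real x p q = 0 := fun x p q hx => by
    simp [hs, BinaryBDD.input, inputState, show x ≠ 0 by omega, show x ≠ 1 by omega]
  obtain ⟨τ₂, s₂, E2, T2, L2, Tb2, N2, R2⟩ := prepare_runs L1 (by omega) hD1 (hdn.trans hnM)
    (hD2.trans hQM) hQM hnM (by omega) fun x p q hx => by rw [R1, hreal _ _ _ (by omega)]
  have R2' : ∀ x < N, s₂.real x = s.real x := fun x hx => by rw [R2 x hx, R1]
  obtain ⟨τ₃, s₃, E3, T3, L3, R3, N3, ⟨a0, a1, a2, a3⟩, X3, Y3⟩ :=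
    writeInstance_runs L2 Tb2 (by omega) (hdn.trans hnM) (hkd.trans (hdn.trans hnM)) hnM hdn
      (by omega) (fun p q h => by
        rw [R2' 0 (by omega)]
        simp [hs, BinaryBDD.input, inputState, h]) (fun p q h => by
        rw [R2' 1 (by omega)]
        simp only [hs, BinaryBDD.input, inputState, one_ne_zero, if_false, true_and]
        split_ifs with h1 h2
        · exact absurd ⟨h2, h1⟩ h
        · rfl
        · rfl)
  have hB : ∀ i l : Fin d, s₁.real 0 i l = B i l := fun i l => by
    simp [R1, hs, BinaryBDD.input, inputState]
  have hsq : s₂.real (N + 6) 0 0 = ∑ i, ∑ j, B i j ^ 2 := by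
    rw [Tb2.squares]
    exact sum_range_eq_sum_fin fun i => sum_range_eq_sum_fin fun j => by rw [hB, sq]
  have hscale : √(m : ℝ) / (2 * √(d * s₂.real (N + 6) 0 0)) = SLR.scale m B := by
    rw [hsq, SLR.scale]
  rw [hscale] at X3 Y3
  have hAgree : AgreeBelow N (SLR.input k X y s₃.tape) s₃ := by
    refine agreeBelow_input a0 a1 a2 (fun i hi => ?_) (fun x i hx hx' => ?_) (fun p q => ?_)
      (fun p q => ?_) fun x p q hx hx' => ?_
    · rw [a3 i hi, N2 0 (by omega), N1 0 (by omega)]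
      simp [hs, BinaryBDD.input, inputState, show i ≠ 0 by omega, show i ≠ 1 by omega,
        show i ≠ 2 by omega]
    · rw [N3 x hx hx', N2 x hx', N1 x hx']
      simp [hs, BinaryBDD.input, inputState, show x ≠ 0 by omega]
    · rw [X3, designCell]
      by_cases hq : q < k * 2 ^ D
      · rw [if_pos hq]
        by_cases hp : p < m
        · rw [dif_pos ⟨hp, hq⟩, hX]
          simp only [SLR.design, SLR.stack]
          by_cases hpd : p < d
          · rw [if_pos hpd, dif_pos hpd, Matrix.mul_apply]
            congr 1
            exact sum_range_eq_sum_fin fun l => by rw [hB ⟨p, hpd⟩ l]; rfl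
          · rw [if_neg hpd, dif_neg hpd]
            by_cases hpk : p - d < k
            · rw [if_pos hpk, dif_pos hpk]
              rfl
            · rw [if_neg hpk, dif_neg hpk]
        · rw [dif_neg (by tauto), if_neg (by omega), if_neg (by omega)]
      · rw [if_neg hq, dif_neg (by tauto)]
    · rw [Y3, hy]
      refine if_congr Iff.rfl ?_ rfl
      rw [responseCell]
      by_cases hp : p < m
      · rw [dif_pos hp, SLR.stack]
        by_cases hpd : p < d
        · rw [if_pos hpd, dif_pos hpd, R1]
          simp [hs, BinaryBDD.input, inputState, hpd]
        · rw [if_neg hpd, dif_neg hpd]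
          by_cases hpk : p - d < k
          · rw [if_pos hpk, dif_pos hpk]
          · rw [if_neg hpk, dif_neg hpk]
      · rw [dif_neg hp, if_neg (by omega), if_neg (by omega)]
    · rw [R3 x hx, R2' x hx', hreal x p q hx]
  obtain ⟨τ₄, sA, E4, T4⟩ := hrun s₃.tape
  -- The run on the clean input transfers to the actual memory: its output appears below `N`, and
  -- the tables from `N` on survive for the decoding.
  obtain ⟨s₄, E4', B4, A4⟩ := E4.frame hA hAgree
  obtain ⟨τ₅, s₅, E5, T5, O5⟩ := decode_runs (M := M)
    (L3.congr fun x hx => A4.nat x (by omega))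
    (Tb2.congr fun x hx => (A4.real x hx).trans (R3 x (by omega)))
    hN (hdn.trans hnM) hnM (by omega) fun i => rfl
  refine ⟨_, s₅, .seq E1 (.seq E2 (.seq E3 (.seq E4' E5))), ?_, s₃.tape, τ₄, sA, E4, fun l => ?_⟩
  · have : 300 * (M + 1) ^ 1 ≤ 300 * (M + 1) ^ 3 :=
      Nat.mul_le_mul_left _ (Nat.pow_le_pow_right (Nat.succ_pos M) (by norm_num))
    omega
  · have hv : ∑ c ∈ Finset.range (k * 2 ^ D), SLR.gadgetEntry D l c * s₄.real 2 c 0 =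
        (SLR.gadget d k D).mulVec (sA.output (k * 2 ^ D)) l :=
      sum_range_eq_sum_fin fun c => by rw [← B4.real 2 (by omega)]; rfl
    rw [← hv]
    exact O5 l l.2

end RealRAM

/-- A polynomial-time algorithm for sparse linear regression whose prediction error is bounded in
terms of the restricted eigenvalue constant gives a polynomial-time algorithm for binary bounded
distance decoding. -/
theorem mainTheorem2 :
    ∃ (c₀ : ℕ) (c : ℝ), 0 < c ∧ ∀ K : ℝ, 0 < K → ∃ C : ℝ, 0 < C ∧
      ∀ β : ℝ, 0 < β → β ≤ 2 →
      ∀ P : ℕ → ℕ → ℕ → Prop, (∀ d k m, P d k m → 1 ≤ d ∧ k ∣ d ∧ c₀ * d ≤ m) →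
      ∀ A : RealRAM.Prog, SLR.PolyTime P A → SLR.AchievesError P K β A →
      ∃ D : RealRAM.Prog, BinaryBDD.PolyTime P D ∧
        ∀ d k m : ℕ, P d k m → ∀ B : Matrix (Fin d) (Fin d) ℝ, B.det ≠ 0 →
          ∀ α : ℝ,
            α ≤ C * ((k : ℝ) ^ (1 - β / 2) /
              ((d : ℝ) ^ (5 - 2 * β) * BinaryBDD.condNumber B ^ (2 - β))) →
            BinaryBDD.SolvesFor D k m B α (Real.exp (-(c * m))) := by
  -- `2 d ≤ m` leaves room for the `d + k` nonzero rows, as `k ≤ d`. The rate `1` is arbitrary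
  -- because the failure event is empty. The workspace starts at `3` or later, beyond the arrays
  -- `0`, `1`, `2` used for input and output.
  refine ⟨2, 1, one_pos, fun K hK => ⟨1 / (7200 * √K), by positivity, fun β hβ hβ2 P hP A hpoly
    herr => ⟨RealRAM.reduction (max A.bound 3) A, ?_, ?_⟩⟩⟩
  · obtain ⟨q, hq⟩ := hpoly
    refine ⟨Polynomial.C 2500 * (Polynomial.X + 1) ^ 3 + q, fun d k m hdkm B t ω => ?_⟩
    obtain ⟨hd, hk, hm⟩ := hP d k m hdkm
    obtain ⟨τ, s, h1, h2, -⟩ := RealRAM.reduction_runs (M := m + k * 2 ^ (d / k))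
      (le_max_left _ _) (le_max_right A.bound 3) (Nat.mul_div_cancel' hk) hd hm
      (Nat.le_add_left _ _) B t ω rfl rfl fun ω' => hq d k m hdkm _ _ ω'
    exact ⟨τ, s, h1, by simpa using h2⟩
  · intro d k m hdkm B hB α hα z hz e he
    obtain ⟨hd, hk, hm⟩ := hP d k m hdkm
    obtain ⟨q, hq⟩ := hpoly
    have hempty : BinaryBDD.failure (RealRAM.reduction (max A.bound 3) A) k m B
        (B.mulVec z + e) z = ∅ := by
      refine Set.eq_empty_iff_forall_notMem.2 fun ω hω => hω ?_
      obtain ⟨τ, s, h1, -, ω', τ', s₁, h2, h3⟩ :=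
        RealRAM.reduction_runs (M := m + k * 2 ^ (d / k)) (le_max_left _ _)
          (le_max_right A.bound 3) (Nat.mul_div_cancel' hk) hd hm (Nat.le_add_left _ _) B
          (B.mulVec z + e) ω rfl rfl fun ω' => hq d k m hdkm _ _ ω'
      refine ⟨τ, s, h1, funext fun l => (h3 l).trans ?_⟩
      refine SLR.recover_signVector hK hβ hβ2 hd (Nat.mul_div_cancel' hk) hm hB hz
        (he.trans (mul_le_mul_of_nonneg_right hα (SLR.binaryMinDist_pos hd hB).le)) rfl rfl ?_ l
      intro θ w ζ ε hζ hε hε2 hθ hsparse hre hy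
      exact herr d k m hdkm _ θ w ζ ε hζ hε hε2 hθ hsparse hre ω' τ' s₁ (by rw [hy]; exact h2)
    rw [hempty, measure_empty]
    exact zero_le
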